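/- Work over $\mathbb C$, with indices in $\{1,2,3,4\}$ modulo $4$ and unordered labels ($\theta_{ij}=\theta_{ji}$ etc.). Let $X_{\mathsf G_2}\subset\mathbb A^{18}$, with coordinates $\theta_i,\theta_{i,i+1},A_i,A_{i,i+1}$ $(i=1,\dots,4)$ and $\lambda_{13},\lambda_{24}$, be defined by the equations \begin{align*} \theta_i\theta_j &= A_{ij}\theta_{ij} + A_{jk}A_kA_{kl}^2A_lA_{li},\\ \theta_{ij}\theta_{jk} &= A_j\theta_j^3 + \lambda_{jl}A_{kl}A_{li}\theta_j^2 + \lambda_{ik}A_{kl}^2A_lA_{li}^2\theta_j + A_kA_{kl}^3A_l^2A_{li}^3A_i,\\ \theta_i\theta_{jk} &= A_{ij}A_j\theta_j^2 + \lambda_{jl}A_{kl}A_{li}A_{ij}\theta_j + \lambda_{ik}A_{kl}^2A_lA_{li}^2A_{ij} + A_kA_{kl}^2A_lA_{li}\theta_k,\\ \theta_i\theta_k &= A_{ij}A_jA_{jk}\theta_j + \lambda_{jl}A_{ij}A_{jk}A_{kl}A_{li} + A_{kl}A_lA_{li}\theta_l,\\ \theta_{ij}\theta_{kl} &= A_jA_{jk}^2A_k\theta_j\theta_k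 + A_{li}A_{jk}(\lambda_{ik}\theta_i\theta_k + \lambda_{jl}\theta_j\theta_l) + A_lA_{li}^2A_i\theta_l\theta_i + A_{ij}A_{jk}^2A_{kl}A_{li}^2(A_iA_jA_kA_l - \lambda_{ik}\lambda_{jl}), \end{align*} where $(i,j,k,l)$ runs over all $\mathrm{Dih}_8$-permutations of $(1,2,3,4)$. Let $X_{\mathsf C_2}\subset\mathbb A^{13}$, with coordinates $\theta_i,\theta_{ij},A_i,A_{ij}$ (indices in $\{1,2,3\}$) and $\lambda$, be defined by $$\theta_i\theta_j=A_{ij}\theta_{ij}+A_{jk}A_kA_{ki},\quad \theta_{ki}\theta_{ij}=A_i\theta_i^2+\lambda A_{jk}\theta_i+A_jA_{jk}^2A_k,\quad \theta_i\theta_{jk}=A_{ij}A_j\theta_j+\lambda A_{ki}A_{ij}+A_kA_{ki}\theta_k$$ for all permutations $(i,j,k)$ of $(1,2,3)$. A torus $\mathbb T^8$ acts on $X_{\mathsf G_2}$, the $\theta$'s having independent characters. A cocharacter $\rho=(\rho_i,\rho_{i,i+1})\in\mathbb Z^8$ gives the variables the degrees $$d(\theta_i)=\rho_i,\quad d(\theta_{ij})=\rho_{ij},\quad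 d(A_i)=\rho_{li}-3\rho_i+\rho_{ij},\quad d(A_{ij})=\rho_i-\rho_{ij}+\rho_j,$$ $$d(\lambda_{ik})=-2\rho_i+\rho_{ij}-\rho_j+\rho_{jk}-2\rho_k+\rho_{kl}-\rho_l+\rho_{li}.$$ Give $\mathbb A^{10}$ positive integral weights and let $\phi\colon\mathbb A^{10}\to\mathbb A^{18}$ be a graded morphism of degree zero, i.e. each $\phi^*(z)$ is weighted homogeneous of degree $d(z)$, such that $\phi^*(z)\neq0$ for each of the 18 variables $z$ with $d(z)=0$. Suppose that $\widehat Y=\phi^{-1}(X_{\mathsf G_2})$ is a regular pullback, i.e. has codimension $6$ in $\mathbb A^{10}$. **(I)** Suppose moreover that $\widehat Y$ has at worst an isolated singularity at the vertex (so that it is the 4-dimensional affine cone over a quasismooth weighted projective 3-fold) and is not a complete intersection. Then $d(\theta_i)>0$ and $d(\theta_{i,i+1})>0$ for all $i$, and up to $\mathrm{Dih}_8$-symmetry one of the following holds. 1. ($\mathsf G_2^{(6)}$ format) $d(A_{ij})>0$ for all $i,j$; then $d(A_i)\ge0$ for all $i$ and $d(\lambda_{13}),d(\lambda_{24})\ge0$.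 2. ($\mathsf G_2^{(5)}+\mathrm{CI}^{(1)}$ format) $d(A_{12})=0$ and the other $d(A_{ij})>0$; then $d(A_1),d(A_2)\ge0$ and $d(\lambda_{13}),d(\lambda_{24})\ge0$. 3. ($\mathsf G_2^{(4)}+\mathrm{CI}^{(2)}$ format) $d(A_{12})=d(A_{34})=0$ and $d(A_{23}),d(A_{41})>0$. 4. ($\mathsf C_2+\mathrm{CI}^{(2)}$ format) $d(A_{12})=d(A_{23})=0$ and $d(A_{34}),d(A_{41})>0$. 5. ($\mathsf A_2+\mathrm{CI}^{(3)}$ format) $d(A_{12})=d(A_{23})=d(A_{34})=0$ and $d(A_{41})>0$. In cases 2–5, after composing $\phi$ with an element of $\mathbb T^8$ (which does not change the ideal of $\widehat Y$), $\phi^*(A_{ij})=1$ for those $A_{ij}$ whose degree is required to be $0$. The ideal of $\widehat Y$ is then generated by the pullbacks of the tag equations $\theta_{ij}=\theta_i\theta_j-A_{jk}A_kA_{kl}^2A_lA_{li}$ for these $ij$, together with: in cases 2 and 3, the pullbacks of the equations of $X_{\mathsf G_2}$ in which these $A_{ij}$ are set to $1$ and the corresponding redundant $\theta_{ij}$ are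 eliminated (the $\mathsf G_2^{(5)}$, resp. $\mathsf G_2^{(4)}$ format); in case 4, the pullback of the ideal of $X_{\mathsf C_2}$ under the coordinates displayed in (III); in case 5, the $4\times4$ Pfaffians displayed in (IV). In cases 4 and 5 these coordinates are homogeneous for the $\mathsf C_2$, resp. $\mathsf A_2$, grading that is determined by the degrees of the cluster variables. (A cocharacter $\rho'$ of the $\mathsf C_2$ torus gives $d(\theta_i)=\rho'_i$, $d(\theta_{ij})=\rho'_{ij}$, $d(A_i)=\rho'_{ki}-2\rho'_i+\rho'_{ij}$, $d(A_{ij})=\rho'_i-\rho'_{ij}+\rho'_j$, $d(\lambda)=\rho'_{12}+\rho'_{23}+\rho'_{31}-\rho'_1-\rho'_2-\rho'_3$. For $\mathsf A_2$, with cluster variables $(\theta_1,\dots,\theta_5)$ equal to $(\theta_3,\theta_4,\theta_{41},\theta_1,\theta_2)$ and coefficients $(A_1,\dots,A_5)$ equal to $(A_3,\ A_4\theta_4+\lambda_{24},\ A_{41},\ A_1\theta_1+\lambda_{13},\ A_2)$, one has $d(\theta_i)=\rho'_i$, $d(A_i)=\rho'_{i-1}-\rho'_i+\rho'_{i+1}$,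 indices modulo $5$.) **(II)** If all four $d(A_{ij})=0$, then the regular pullback $\widehat Y$ is a complete intersection of codimension $6$. **(III)** The pullback of $X_{\mathsf G_2}$ by $\mathbb A^{16}\to\mathbb A^{18}$, $A_{12},A_{23}\mapsto1$ and $z\mapsto z$ for the other variables, has ideal generated by $$\theta_{12}-(\theta_1\theta_2-A_3A_{34}^2A_4A_{41}),\qquad \theta_{23}-(\theta_2\theta_3-A_{34}A_4A_{41}^2A_1)$$ and the equations of $X_{\mathsf C_2}$ with $(\theta_{12},\theta_{23},\theta_{31}\,|\,\theta_1,\theta_2,\theta_3)$ replaced by $(\theta_2,\theta_{34},\theta_{41}\,|\,\theta_1,\theta_3,\theta_4)$, $(A_{12},A_{23},A_{31}\,|\,A_1,A_2,A_3)$ by $(A_2,A_{34},A_{41}\,|\,A_1,A_3,A_4\theta_4+\lambda_{24})$ and $\lambda$ by $\lambda_{13}$. **(IV)** The pullback of $X_{\mathsf G_2}$ by $\mathbb A^{15}\to\mathbb A^{18}$, $A_{12},A_{23},A_{34}\mapsto1$ and $z\mapsto z$ for the other variables, has ideal generated by $$\theta_{12}-(\theta_1\theta_2-A_3A_4A_{41}),\quad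 \theta_{23}-(\theta_2\theta_3-A_4A_{41}^2A_1),\quad \theta_{34}-(\theta_3\theta_4-A_{41}A_1A_2)$$ and the $4\times4$ Pfaffians of the skew-symmetric $5\times5$ matrix with strict upper triangle $$\begin{pmatrix} A_2&\theta_3&\theta_4&A_{41}\\ &A_4\theta_4+\lambda_{24}&\theta_{41}&\theta_1\\ &&A_1\theta_1+\lambda_{13}&\theta_2\\ &&&A_3\end{pmatrix}.$$ -/

import Mathlib

open MvPolynomial

/-! ### Generators of the cluster algebras

Vertices of the `n`-gon are labelled by `ZMod n` (so the vertex `n` is `0`), and the index `i` of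
`thE i` and `AE i` stands for the unordered edge `{i, i + 1}`. -/

/-- The edge `{i, j}` joining two adjacent vertices of the `n`-gon, labelled by the vertex which
comes first in the cyclic order. -/
def polyEdge {n : ℕ} (i j : ZMod n) : ZMod n := if j = i + 1 then i else j

/-- The dihedral group acting on the vertices of the `n`-gon. -/
def dihVertex {n : ℕ} : DihedralGroup n → ZMod n → ZMod n
  | .r a, i => i + a
  | .sr a, i => a - i

/-- The 18 generators for `G₂`: `th i = θ_i`, `thE i = θ_{i,i+1}`, `A i = A_i`,
`AE i = A_{i,i+1}`, and `lam 1 = λ₁₃`, `lam 0 = λ₂₄`. -/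
inductive G2Var : Type
  | th (i : ZMod 4)
  | thE (i : ZMod 4)
  | A (i : ZMod 4)
  | AE (i : ZMod 4)
  | lam (p : ZMod 2)
  deriving DecidableEq

/-- The 13 generators for `C₂`, with the same conventions on the triangle. -/
inductive C2Var : Type
  | th (i : ZMod 3)
  | thE (i : ZMod 3)
  | A (i : ZMod 3)
  | AE (i : ZMod 3)
  | lam

/-- The 10 generators for `A₂`: `θ_i` and `A_i` for `i` modulo 5. -/
inductive A2Var : Type
  | th (i : ZMod 5)
  | A (i : ZMod 5)

/-- The diagonal of the square through the vertex `i`. -/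
def diagThrough (i : ZMod 4) : ZMod 2 := (i.val : ZMod 2)

/-- A vertex on the given diagonal of the square; the other one is its translate by `2`. -/
def diagVertex (p : ZMod 2) : ZMod 4 := (p.val : ZMod 4)

/-- The action of `Dih₈` on the generators for `G₂`. -/
def G2Var.relabel (g : DihedralGroup 4) : G2Var → G2Var
  | .th i => .th (dihVertex g i)
  | .thE i => .thE (polyEdge (dihVertex g i) (dihVertex g (i + 1)))
  | .A i => .A (dihVertex g i)
  | .AE i => .AE (polyEdge (dihVertex g i) (dihVertex g (i + 1)))
  | .lam p => .lam (diagThrough (dihVertex g (diagVertex p)))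

/-! ### The ideals of the cluster varieties

`g2Ideal x` is generated by the defining equations of `X_{G₂} ⊆ 𝔸¹⁸` evaluated at
`x : G2Var → R`. For `x = X` it is the ideal of `X_{G₂}`, and if `x v = φ^*(v)` are the components
of a morphism `φ : 𝔸ᵐ → 𝔸¹⁸` it is the ideal of `φ⁻¹(X_{G₂})`. Similarly for `C₂` and `A₂`. -/

section Ideals

variable {R : Type*} [CommRing R]

/-- The five types of equations of `X_{G₂}` for the labelling `(i, j, k, l)` of the square. -/
def g2Equation (x : G2Var → R) (i j k l : ZMod 4) : Fin 5 → R :=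
  let θ := fun a => x (.th a)
  let θE := fun a b => x (.thE (polyEdge a b))
  let A := fun a => x (.A a)
  let B := fun a b => x (.AE (polyEdge a b))
  let ik := x (.lam (diagThrough i))
  let jl := x (.lam (diagThrough j))
  ![θ i * θ j - (B i j * θE i j + B j k * A k * B k l ^ 2 * A l * B l i),
    θE i j * θE j k - (A j * θ j ^ 3 + jl * B k l * B l i * θ j ^ 2
      + ik * B k l ^ 2 * A l * B l i ^ 2 * θ j
      + A k * B k l ^ 3 * A l ^ 2 * B l i ^ 3 * A i),
    θ i * θE j k - (B i j * A j * θ j ^ 2 + jl * B k l * B l i * B i j * θ j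
      + ik * B k l ^ 2 * A l * B l i ^ 2 * B i j + A k * B k l ^ 2 * A l * B l i * θ k),
    θ i * θ k - (B i j * A j * B j k * θ j + jl * B i j * B j k * B k l * B l i
      + B k l * A l * B l i * θ l),
    θE i j * θE k l - (A j * B j k ^ 2 * A k * θ j * θ k
      + B l i * B j k * (ik * θ i * θ k + jl * θ j * θ l)
      + A l * B l i ^ 2 * A i * θ l * θ i
      + B i j * B j k ^ 2 * B k l * B l i ^ 2 * (A i * A j * A k * A l - ik * jl))]

/-- The ideal of (the pullback of) `X_{G₂}`, generated by all `Dih₈`-permutations of the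
equations. -/
def g2Ideal (x : G2Var → R) : Ideal R :=
  Ideal.span {f | ∃ (g : DihedralGroup 4) (n : Fin 5),
    f = g2Equation x (dihVertex g 1) (dihVertex g 2) (dihVertex g 3) (dihVertex g 4) n}

/-- The three types of equations of `X_{C₂}` for the labelling `(i, j, k)` of the triangle. -/
def c2Equation (x : C2Var → R) (i j k : ZMod 3) : Fin 3 → R :=
  let θ := fun a => x (.th a)
  let θE := fun a b => x (.thE (polyEdge a b))
  let A := fun a => x (.A a)
  let B := fun a b => x (.AE (polyEdge a b))
  let μ := x .lam
  ![θ i * θ j - (B i j * θE i j + B j k * A k * B k i),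
    θE k i * θE i j - (A i * θ i ^ 2 + μ * B j k * θ i + A j * B j k ^ 2 * A k),
    θ i * θE j k - (B i j * A j * θ j + μ * B k i * B i j + A k * B k i * θ k)]

/-- The ideal of (the pullback of) `X_{C₂}`. -/
def c2Ideal (x : C2Var → R) : Ideal R :=
  Ideal.span {f | ∃ (g : DihedralGroup 3) (n : Fin 3),
    f = c2Equation x (dihVertex g 1) (dihVertex g 2) (dihVertex g 3) n}

/-- The ideal `Pf₄ M` of maximal Pfaffians of a skew-symmetric `5 × 5` matrix. -/
def pf4Ideal (M : Matrix (Fin 5) (Fin 5) R) : Ideal R :=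
  Ideal.span {f | ∃ a b c d : Fin 5, a < b ∧ b < c ∧ c < d ∧
    f = M a b * M c d - M a c * M b d + M a d * M b c}

/-- The skew-symmetric matrix of `X_{A₂}`, the affine cone over `Gr(2,5)`. -/
def a2Matrix (x : A2Var → R) : Matrix (Fin 5) (Fin 5) R :=
  let θ := fun a => x (.th a)
  let A := fun a => x (.A a)
  !![0, A 5, θ 1, θ 2, A 3;
     -A 5, 0, A 2, θ 3, θ 4;
     -θ 1, -A 2, 0, A 4, θ 5;
     -θ 2, -θ 3, -A 4, 0, A 1;
     -A 3, -θ 4, -θ 5, -A 1, 0]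

/-- The ideal of (the pullback of) `X_{A₂}`. -/
def a2Ideal (x : A2Var → R) : Ideal R := pf4Ideal (a2Matrix x)

/-! ### Specialisations of `G₂` format -/

/-- The value `θ_i θ_j - A_{jk} A_k A_{kl}² A_l A_{li}` (where `j, k, l = i+1, i+2, i+3`) that the
tag equation gives to `θ_{ij}` when `A_{ij} = 1`. -/
def tagValue (x : G2Var → R) (i : ZMod 4) : R :=
  x (.th i) * x (.th (i + 1))
    - x (.AE (i + 1)) * x (.A (i + 2)) * x (.AE (i + 2)) ^ 2 * x (.A (i + 3)) * x (.AE (i + 3))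

/-- The ideal generated by the equations `θ_{i,i+1} = tagValue x i` for the edges in `E`. -/
def tagIdeal (E : Finset (ZMod 4)) (x : G2Var → R) : Ideal R :=
  Ideal.span {f | ∃ i ∈ E, f = x (.thE i) - tagValue x i}

/-- Specialise the coefficients `A_{i,i+1}` to `1` for the edges in `E`. -/
def setOne (E : Finset (ZMod 4)) (x : G2Var → R) : G2Var → R
  | .AE i => if i ∈ E then 1 else x (.AE i)
  | v => x v

/-- Specialise the coefficients `A_{i,i+1}` to `1` for the edges in `E`, and eliminate the
redundant variables `θ_{i,i+1}`. -/
def eliminateEdges (E : Finset (ZMod 4)) (x : G2Var → R) : G2Var → R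
  | .thE i => if i ∈ E then tagValue (setOne E x) i else x (.thE i)
  | v => setOne E x v

/-- The `G₂⁽⁵⁾` format of codimension 5: put `A₁₂ = 1` and eliminate `θ₁₂`. -/
def g25Ideal (x : G2Var → R) : Ideal R := g2Ideal (eliminateEdges {1} x)

/-- The `G₂⁽⁴⁾` format of codimension 4: put `A₁₂ = A₃₄ = 1` and eliminate `θ₁₂`, `θ₃₄`. -/
def g24Ideal (x : G2Var → R) : Ideal R := g2Ideal (eliminateEdges {1, 3} x)

/-- The coordinate change to `C₂` format
`(θ₁₂, θ₂₃, θ₃₁ | θ₁, θ₂, θ₃) = (θ₂, θ₃₄, θ₄₁ | θ₁, θ₃, θ₄)`,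
`(A₁₂, A₂₃, A₃₁ | A₁, A₂, A₃) = (A₂, A₃₄, A₄₁ | A₁, A₃, A₄θ₄ + λ₂₄)`, `λ = λ₁₃`.
Entries are listed for the index `0, 1, 2` modulo 3. -/
def c2Coords (x : G2Var → R) : C2Var → R
  | .th i => ![x (.th 4), x (.th 1), x (.th 3)] i
  | .thE i => ![x (.thE 4), x (.th 2), x (.thE 3)] i
  | .A i => ![x (.A 4) * x (.th 4) + x (.lam 0), x (.A 1), x (.A 3)] i
  | .AE i => ![x (.AE 4), x (.A 2), x (.AE 3)] i
  | .lam => x (.lam 1)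

/-- The coordinate change to `A₂` format, with matrix of strict upper triangle
`(A₂, θ₃, θ₄, A₄₁ | A₄θ₄ + λ₂₄, θ₄₁, θ₁ | A₁θ₁ + λ₁₃, θ₂ | A₃)`.
Entries are listed for the index `0, 1, 2, 3, 4` modulo 5. -/
def a2Coords (x : G2Var → R) : A2Var → R
  | .th i => ![x (.th 2), x (.th 3), x (.th 4), x (.thE 4), x (.th 1)] i
  | .A i => ![x (.A 2), x (.A 3), x (.A 4) * x (.th 4) + x (.lam 0), x (.AE 4),
      x (.A 1) * x (.th 1) + x (.lam 1)] i

end Ideals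

/-- The morphism from affine space, with all the coordinates of `𝔸¹⁸` except `A_{i,i+1}` for
`i ∈ E`, to `𝔸¹⁸` given by `A_{i,i+1} ↦ 1` for `i ∈ E` and `z ↦ z` for all other variables. -/
noncomputable def genericSpecialisation (E : Finset (ZMod 4)) :
    G2Var → MvPolynomial {v : G2Var // ∀ i ∈ E, v ≠ .AE i} ℂ :=
  fun v => if h : ∀ i ∈ E, v ≠ .AE i then X ⟨v, h⟩ else 1

/-! ### Gradings -/

/-- The degrees on `X_{G₂}` for the one parameter subgroup with `ρ_i = r i` and
`ρ_{i,i+1} = s i`. -/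
def g2Degree (r s : ZMod 4 → ℤ) : G2Var → ℤ
  | .th i => r i
  | .thE i => s i
  | .A i => s (i - 1) - 3 * r i + s i
  | .AE i => r i - s i + r (i + 1)
  | .lam p =>
    s 1 + s 2 + s 3 + s 4 - (r 1 + r 2 + r 3 + r 4)
      - r (diagVertex p) - r (diagVertex p + 2)

/-- The degrees on `X_{C₂}` for the one parameter subgroup with `ρ_i = r i` and
`ρ_{i,i+1} = s i`. -/
def c2Degree (r s : ZMod 3 → ℤ) : C2Var → ℤ
  | .th i => r i
  | .thE i => s i
  | .A i => s (i - 1) - 2 * r i + s i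
  | .AE i => r i - s i + r (i + 1)
  | .lam => s 1 + s 2 + s 3 - r 1 - r 2 - r 3

/-- The degrees on `X_{A₂}` for the one parameter subgroup with `ρ_i = r i`. -/
def a2Degree (r : ZMod 5 → ℤ) : A2Var → ℤ
  | .th i => r i
  | .A i => r (i - 1) - r i + r (i + 1)

/-- The character by which `(t, u) ∈ 𝕋⁸` acts on each generator for `G₂`. -/
def g2Character (t u : ZMod 4 → ℂˣ) : G2Var → ℂˣ
  | .th i => t i
  | .thE i => u i
  | .A i => u (i - 1) * (t i ^ 3)⁻¹ * u i
  | .AE i => t i * (u i)⁻¹ * t (i + 1)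
  | .lam p =>
    u 1 * u 2 * u 3 * u 4 * (t 1 * t 2 * t 3 * t 4)⁻¹
      * (t (diagVertex p))⁻¹ * (t (diagVertex p + 2))⁻¹

/-- The morphism `φ` followed by the action of `(t, u) ∈ 𝕋⁸` on `𝔸¹⁸`. -/
noncomputable def torusAct {m : ℕ} (t u : ZMod 4 → ℂˣ) (φ : G2Var → MvPolynomial (Fin m) ℂ) :
    G2Var → MvPolynomial (Fin m) ℂ :=
  fun v => C (g2Character t u v : ℂ) * φ v

/-- `φ : 𝔸ᵐ → 𝔸^V` is homogeneous of degree zero for the weights `w` on `𝔸ᵐ` and `d` on `𝔸^V`. -/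
def IsGradedMorphism {m : ℕ} {V : Type*} (w : Fin m → ℕ) (d : V → ℤ)
    (φ : V → MvPolynomial (Fin m) ℂ) : Prop :=
  ∀ v, IsWeightedHomogeneous (fun i => (w i : ℤ)) (φ v) (d v)

/-! ### Cones in affine space -/

/-- The gradient of `f` at the point `P`. -/
noncomputable def gradientAt {m : ℕ} (P : Fin m → ℂ) (f : MvPolynomial (Fin m) ℂ) : Fin m → ℂ :=
  fun i => eval P (pderiv i f)

/-- The affine cone `V(I)`, of pure codimension `c`, has at worst an isolated singularity at the
vertex: at all its other points the Jacobian matrix has rank at least `c`. -/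
def IsQuasismoothCone {m : ℕ} (c : ℕ) (I : Ideal (MvPolynomial (Fin m) ℂ)) : Prop :=
  ∀ P : Fin m → ℂ, P ≠ 0 → (∀ f ∈ I, eval P f = 0) →
    c ≤ Module.finrank ℂ (Submodule.span ℂ (gradientAt P '' (I : Set (MvPolynomial (Fin m) ℂ))))

/-- `V(I)` is a complete intersection of codimension `c`. -/
def IsCompleteIntersection {m : ℕ} (c : ℕ) (I : Ideal (MvPolynomial (Fin m) ℂ)) : Prop :=
  I.height = c ∧ ∃ f : Fin c → MvPolynomial (Fin m) ℂ, Ideal.span (Set.range f) = I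

/-- `φ⁻¹(X_{G₂}) ⊆ 𝔸¹⁰` is a regular pullback in the `G₂` format with degrees `g2Degree r s`,
for positive weights `w` on `𝔸¹⁰`. As is the convention for generic morphisms, the components of
degree zero are non-zero (constants). -/
structure IsG2RegularPullback (w : Fin 10 → ℕ) (r s : ZMod 4 → ℤ)
    (φ : G2Var → MvPolynomial (Fin 10) ℂ) : Prop where
  weight_pos : ∀ i, 0 < w i
  graded : IsGradedMorphism w (g2Degree r s) φ
  ne_zero_of_degree_zero : ∀ v, g2Degree r s v = 0 → φ v ≠ 0
  codim : (g2Ideal φ).height = 6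

/-! ### Points of affine cones -/

/-! For positive weights a homogeneous polynomial is zero, a non-zero constant, or vanishes at the
vertex. Hence the sign of `d(z)` is controlled by two questions about `φ^*(z)`: can it be constant,
and can it vanish identically?

Constants lead to complete intersections. Where a cluster variable is invertible, `X_{G₂}` is a
graph: six of its equations solve for six other coordinates and imply the remaining ones
(`G2Eqs.of_isUnit_t1`, `G2Eqs.of_isUnit_t12`). So if `Ŷ` is not a complete intersection, all `θ_i`
and `θ_{ij}` vanish at the vertex.

Identically zero components lead to singularities. At most nine functions `Z` on `𝔸¹⁰` that vanish
at the vertex have another common zero `P`, by Krull's height theorem. If modulo `(Z)²` all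
equations of `X_{G₂}` follow from at most five elements of `(Z)`, then `P` lies on `Ŷ` and the
Jacobian there has rank at most five, which contradicts quasismoothness
(`not_isQuasismoothCone_of_le`). Each `of_small_*` lemma is the algebra of one such linear section.
A coordinate that is identically zero either shortens a list of ten functions to nine or removes the
terms that would spoil the rank count.

Constant coefficients `A_{ij}` are normalised to 1 by the torus, and the tag equation then
eliminates `θ_{ij}`. With two adjacent coefficients equal to 1 the equations free of `θ₁₂` and `θ₂₃`
are those of `X_{C₂}`, and with three the equations free of the tagged variables are the five
Pfaffians of `X_{A₂}`. The same two arguments apply to a Pfaffian format: a unit entry makes three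
Pfaffians suffice, and a zero entry makes the rank drop on a locus cut out by nine functions
(`isCompleteIntersection_of_pf4Ideal`, `pf4Ideal_entry_ne_zero`). If `A₂` is constant, the `C₂`
format itself reduces to Pfaffians, so that subcase is treated separately.

The signs of `d(λ₁₃)` and `d(λ₂₄)` use in addition the relation `d(A₁) + d(A₃) = 2d(λ₁₃) - d(λ₂₄)`
and its mirror image. Identities of ideals are always checked on points over quotient rings
(`g2Ideal_le_iff`), where they become polynomial identities. -/

theorem height_vanishingIdeal_zero (m : ℕ) :
    (vanishingIdeal ℂ {(0 : Fin m → ℂ)}).height = m := by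
  have hdim : ringKrullDim (MvPolynomial (Fin m) ℂ) = m := by
    simp [ringKrullDim_eq_zero_of_field]
  have : FiniteRingKrullDim (MvPolynomial (Fin m) ℂ) := by
    rw [finiteRingKrullDim_iff_ne_bot_and_top, hdim]
    exact ⟨WithBot.coe_ne_bot (a := (m : ℕ∞)), fun h => ENat.natCast_ne_top m (WithBot.coe_inj.1 h)⟩
  obtain ⟨p, hp, hht⟩ := Ideal.exists_isMaximal_height (R := MvPolynomial (Fin m) ℂ)
  obtain ⟨a, rfl⟩ := eq_vanishingIdeal_singleton_of_isMaximal ℂ hp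
  -- Some maximal ideal has height equal to the dimension, and by the Nullstellensatz it is the
  -- ideal of a point `a`. Translation by `a` carries this height to the origin.
  let e : MvPolynomial (Fin m) ℂ ≃ₐ[ℂ] MvPolynomial (Fin m) ℂ :=
    AlgEquiv.ofAlgHom (aeval fun i => X i - C (a i)) (aeval fun i => X i + C (a i))
      (by ext i; simp [algebraMap_eq]) (by ext i; simp [algebraMap_eq])
  have he' : (vanishingIdeal ℂ {(0 : Fin m → ℂ)}).comap e.symm.toRingEquiv =
      vanishingIdeal ℂ {a} := by
    ext f
    rw [Ideal.mem_comap, mem_vanishingIdeal_singleton_iff, mem_vanishingIdeal_singleton_iff]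
    have : (aeval (0 : Fin m → ℂ)).comp (e.symm : MvPolynomial (Fin m) ℂ →ₐ[ℂ] _) = aeval a := by
      ext i; simp [e]
    exact iff_of_eq (congrArg (· = 0) (DFunLike.congr_fun this f))
  rw [← he', RingEquiv.height_comap, hdim] at hht
  exact_mod_cast hht

/-- Fewer than `m` polynomials on `𝔸ᵐ` which vanish at the origin have another common zero. -/
theorem exists_ne_zero_forall_eval_eq_zero {m : ℕ} (s : Finset (MvPolynomial (Fin m) ℂ))
    (hs : s.card < m) (h0 : ∀ f ∈ s, eval 0 f = 0) :
    ∃ P : Fin m → ℂ, P ≠ 0 ∧ ∀ f ∈ s, eval P f = 0 := by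
  by_contra! hP
  have hz : zeroLocus ℂ (Ideal.span (s : Set (MvPolynomial (Fin m) ℂ))) = {0} := by
    ext P
    simp only [zeroLocus_span, Set.mem_ofPred_eq, Set.mem_singleton_iff]
    refine ⟨fun h => ?_, ?_⟩
    · by_contra hne
      obtain ⟨f, hf, hfP⟩ := hP P hne
      exact hfP (by simpa [aeval_eq_eval] using h f hf)
    · rintro rfl f hf
      simpa [aeval_eq_eval] using h0 f hf
  have hr := vanishingIdeal_zeroLocus_eq_radical (k := ℂ) (K := ℂ)
    (Ideal.span (s : Set (MvPolynomial (Fin m) ℂ)))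
  rw [hz] at hr
  -- If the origin were the only zero, its maximal ideal, of height `m`, would be the radical and so
  -- a minimal prime over the given polynomials. Krull's height theorem then bounds `m` by their
  -- number.
  have hmem : vanishingIdeal ℂ {(0 : Fin m → ℂ)} ∈
      (Ideal.span (s : Set (MvPolynomial (Fin m) ℂ))).minimalPrimes := by
    have hp : (vanishingIdeal ℂ {(0 : Fin m → ℂ)}).IsPrime :=
      (isMaximal_iff_eq_vanishingIdeal_singleton.2 ⟨0, rfl⟩).isPrime
    rw [← Ideal.radical_minimalPrimes, ← hr, Ideal.minimalPrimes_eq_subsingleton_self]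
    rfl
  have := Ideal.height_le_card_of_mem_minimalPrimes_span_finset hmem
  rw [height_vanishingIdeal_zero] at this
  exact absurd hs (not_lt.2 (by exact_mod_cast this))

/-! ### Gradients -/

section Gradient

variable {m : ℕ} (P : Fin m → ℂ) (f g : MvPolynomial (Fin m) ℂ)

@[simp] theorem gradientAt_add : gradientAt P (f + g) = gradientAt P f + gradientAt P g := by
  ext i; simp [gradientAt]

@[simp] theorem gradientAt_sub : gradientAt P (f - g) = gradientAt P f - gradientAt P g := by
  ext i; simp [gradientAt]

@[simp] theorem gradientAt_neg : gradientAt P (-f) = -gradientAt P f := by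
  ext i; simp [gradientAt]

@[simp] theorem gradientAt_zero : gradientAt P 0 = 0 := by
  ext i; simp [gradientAt]

@[simp] theorem gradientAt_one : gradientAt P 1 = 0 := by
  ext i; simp [gradientAt]

@[simp] theorem gradientAt_mul :
    gradientAt P (f * g) = eval P f • gradientAt P g + eval P g • gradientAt P f := by
  ext i; simp [gradientAt]

@[simp] theorem gradientAt_pow (n : ℕ) :
    gradientAt P (f ^ n) = (n * eval P f ^ (n - 1)) • gradientAt P f := by
  ext i; simp [gradientAt]; ring

/-- By the Leibniz rule a multiple `a * f` of a function vanishing at `P` has gradient `a(P) • ∇f`.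
So the Jacobian rank may be bounded on generators, although `IsQuasismoothCone` refers to the whole
ideal. -/
theorem gradientAt_mem_span {G : Set (MvPolynomial (Fin m) ℂ)} (W : Submodule ℂ (Fin m → ℂ))
    (hG : ∀ f ∈ G, eval P f = 0) (hW : ∀ f ∈ G, gradientAt P f ∈ W)
    {f : MvPolynomial (Fin m) ℂ} (hf : f ∈ Ideal.span G) : gradientAt P f ∈ W := by
  suffices eval P f = 0 ∧ gradientAt P f ∈ W from this.2
  induction hf using Submodule.span_induction with
  | mem x hx => exact ⟨hG x hx, hW x hx⟩
  | zero => simp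
  | add x y _ _ hx hy => exact ⟨by simp [hx.1, hy.1], by simpa using W.add_mem hx.2 hy.2⟩
  | smul a x _ hx =>
    exact ⟨by simp [hx.1], by simpa [hx.1] using W.smul_mem _ hx.2⟩

end Gradient

/-- If at all common zeros of fewer than `m` polynomials `Z` the generators `G` of `I` vanish, with
gradients spanned by those of fewer than `c` polynomials `T`, then `I` is not quasismooth. -/
theorem not_isQuasismoothCone {m c : ℕ} {I : Ideal (MvPolynomial (Fin m) ℂ)}
    (G : Set (MvPolynomial (Fin m) ℂ)) (hI : I = Ideal.span G)
    (Z : List (MvPolynomial (Fin m) ℂ)) (hZ : Z.length < m) (hZ0 : ∀ f ∈ Z, eval 0 f = 0)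
    (T : List (MvPolynomial (Fin m) ℂ)) (hT : T.length < c)
    (h : ∀ P : Fin m → ℂ, (∀ f ∈ Z, eval P f = 0) → ∀ f ∈ G, eval P f = 0 ∧
      gradientAt P f ∈ Submodule.span ℂ {v | ∃ g ∈ T, v = gradientAt P g}) :
    ¬ IsQuasismoothCone c I := by
  classical
  intro hq
  obtain ⟨P, hP0, hP⟩ := exists_ne_zero_forall_eval_eq_zero Z.toFinset
    (Z.toFinset_card_le.trans_lt hZ) (by simpa using hZ0)
  have hP' := h P (by simpa using hP)
  subst hI
  have h1 := hq P hP0 fun f hf => by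
    have : Ideal.span G ≤ RingHom.ker (eval P) := Ideal.span_le.2 fun f hf => (hP' f hf).1
    exact this hf
  set W := Submodule.span ℂ {v | ∃ g ∈ T, v = gradientAt P g} with hW
  have hTs : {v | ∃ g ∈ T, v = gradientAt P g} = ((T.map (gradientAt P)).toFinset : Set _) := by
    ext v; simp [eq_comm]
  have h2 : Module.finrank ℂ W ≤ T.length := by
    rw [hW, hTs]
    exact (finrank_span_finset_le_card _).trans ((List.toFinset_card_le _).trans (by simp))
  have h3 : Submodule.span ℂ
      (gradientAt P '' (Ideal.span G : Set (MvPolynomial (Fin m) ℂ))) ≤ W := by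
    refine Submodule.span_le.2 ?_
    rintro _ ⟨f, hf, rfl⟩
    exact gradientAt_mem_span P W (fun f hf => (hP' f hf).1) (fun f hf => (hP' f hf).2) hf
  have := Submodule.finrank_mono h3
  omega

/-! ### Homogeneous polynomials -/

/-- A homogeneous polynomial for positive weights is zero in negative degrees, constant in degree
zero and vanishes at the origin in positive degrees. -/
theorem weightedHomogeneous_trichotomy {m : ℕ} {w : Fin m → ℕ} (hw : ∀ i, 0 < w i)
    {f : MvPolynomial (Fin m) ℂ} {d : ℤ}
    (hf : IsWeightedHomogeneous (fun i => (w i : ℤ)) f d) :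
    (d < 0 ∧ f = 0) ∨ (d = 0 ∧ f = C (eval 0 f)) ∨ (0 < d ∧ eval 0 f = 0) := by
  have hwt : ∀ a : Fin m →₀ ℕ, Finsupp.weight (fun i => (w i : ℤ)) a = ∑ i, (a i * w i : ℤ) := by
    intro a
    rw [Finsupp.weight_apply, Finsupp.sum_fintype _ _ (by simp)]
    simp
  have hpos : ∀ a : Fin m →₀ ℕ, a ≠ 0 → 0 < Finsupp.weight (fun i => (w i : ℤ)) a := by
    intro a ha
    obtain ⟨i, hi⟩ := Finsupp.ne_iff.1 ha
    rw [hwt]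
    refine Finset.sum_pos' (fun i _ => by positivity) ⟨i, Finset.mem_univ _, ?_⟩
    have := Nat.pos_of_ne_zero hi
    have := hw i
    positivity
  have hc : eval 0 f = coeff 0 f := by
    rw [eval_zero, constantCoeff_eq]
  rcases lt_trichotomy d 0 with hd | hd | hd
  · refine Or.inl ⟨hd, ?_⟩
    ext a
    by_contra hne
    have h1 := hf hne
    have : 0 ≤ Finsupp.weight (fun i => (w i : ℤ)) a := by
      rw [hwt]; exact Finset.sum_nonneg fun i _ => by positivity
    omega
  · refine Or.inr (Or.inl ⟨hd, ?_⟩)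
    ext a
    rw [coeff_C, hc]
    split_ifs with ha
    · rw [ha]
    · by_contra hne
      have h1 := hf hne
      have := hpos a (Ne.symm ha)
      omega
  · refine Or.inr (Or.inr ⟨hd, ?_⟩)
    rw [hc]
    by_contra hne
    have h1 := hf hne
    simp at h1
    omega

/-! ### The equations of `X_{G₂}` in coordinates -/

/-- The equations of `X_{G₂}`, in the coordinates `θ_i`, `θ_{ij}`, `A_i`, `A_{ij}`, `λ_{ik}`. -/
structure G2Eqs {Q : Type*} [CommRing Q] (t1 t2 t3 t4 t12 t23 t34 t41 a1 a2 a3 a4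
    b12 b23 b34 b41 l13 l24 : Q) : Prop where
  t1_t2 : t1 * t2 = b12 * t12 + b23 * a3 * b34 ^ 2 * a4 * b41
  t2_t3 : t2 * t3 = b23 * t23 + b34 * a4 * b41 ^ 2 * a1 * b12
  t3_t4 : t3 * t4 = b34 * t34 + b41 * a1 * b12 ^ 2 * a2 * b23
  t4_t1 : t4 * t1 = b41 * t41 + b12 * a2 * b23 ^ 2 * a3 * b34
  t12_t23 : t12 * t23 = a2 * t2 ^ 3 + l24 * b34 * b41 * t2 ^ 2 + l13 * b34 ^ 2 * a4 * b41 ^ 2 * t2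
      + a3 * b34 ^ 3 * a4 ^ 2 * b41 ^ 3 * a1
  t23_t34 : t23 * t34 = a3 * t3 ^ 3 + l13 * b41 * b12 * t3 ^ 2 + l24 * b41 ^ 2 * a1 * b12 ^ 2 * t3
      + a4 * b41 ^ 3 * a1 ^ 2 * b12 ^ 3 * a2
  t34_t41 : t34 * t41 = a4 * t4 ^ 3 + l24 * b12 * b23 * t4 ^ 2 + l13 * b12 ^ 2 * a2 * b23 ^ 2 * t4
      + a1 * b12 ^ 3 * a2 ^ 2 * b23 ^ 3 * a3
  t41_t12 : t41 * t12 = a1 * t1 ^ 3 + l13 * b23 * b34 * t1 ^ 2 + l24 * b23 ^ 2 * a3 * b34 ^ 2 * t1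
      + a2 * b23 ^ 3 * a3 ^ 2 * b34 ^ 3 * a4
  t1_t23 : t1 * t23 = b12 * a2 * t2 ^ 2 + l24 * b34 * b41 * b12 * t2
      + l13 * b34 ^ 2 * a4 * b41 ^ 2 * b12 + a3 * b34 ^ 2 * a4 * b41 * t3
  t2_t34 : t2 * t34 = b23 * a3 * t3 ^ 2 + l13 * b41 * b12 * b23 * t3
      + l24 * b41 ^ 2 * a1 * b12 ^ 2 * b23 + a4 * b41 ^ 2 * a1 * b12 * t4
  t3_t41 : t3 * t41 = b34 * a4 * t4 ^ 2 + l24 * b12 * b23 * b34 * t4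
      + l13 * b12 ^ 2 * a2 * b23 ^ 2 * b34 + a1 * b12 ^ 2 * a2 * b23 * t1
  t4_t12 : t4 * t12 = b41 * a1 * t1 ^ 2 + l13 * b23 * b34 * b41 * t1
      + l24 * b23 ^ 2 * a3 * b34 ^ 2 * b41 + a2 * b23 ^ 2 * a3 * b34 * t2
  t3_t12 : t3 * t12 = b23 * a2 * t2 ^ 2 + l24 * b41 * b34 * b23 * t2
      + l13 * b41 ^ 2 * a4 * b34 ^ 2 * b23 + a1 * b41 ^ 2 * a4 * b34 * t1
  t4_t23 : t4 * t23 = b34 * a3 * t3 ^ 2 + l13 * b12 * b41 * b34 * t3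
      + l24 * b12 ^ 2 * a1 * b41 ^ 2 * b34 + a2 * b12 ^ 2 * a1 * b41 * t2
  t1_t34 : t1 * t34 = b41 * a4 * t4 ^ 2 + l24 * b23 * b12 * b41 * t4
      + l13 * b23 ^ 2 * a2 * b12 ^ 2 * b41 + a3 * b23 ^ 2 * a2 * b12 * t3
  t2_t41 : t2 * t41 = b12 * a1 * t1 ^ 2 + l13 * b34 * b23 * b12 * t1
      + l24 * b34 ^ 2 * a3 * b23 ^ 2 * b12 + a4 * b34 ^ 2 * a3 * b23 * t4
  t1_t3 : t1 * t3 = b12 * a2 * b23 * t2 + l24 * b12 * b23 * b34 * b41 + b34 * a4 * b41 * t4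
  t2_t4 : t2 * t4 = b23 * a3 * b34 * t3 + l13 * b23 * b34 * b41 * b12 + b41 * a1 * b12 * t1
  t12_t34 : t12 * t34 = a2 * b23 ^ 2 * a3 * t2 * t3 + b41 * b23 * (l13 * t1 * t3 + l24 * t2 * t4)
      + a4 * b41 ^ 2 * a1 * t4 * t1
      + b12 * b23 ^ 2 * b34 * b41 ^ 2 * (a1 * a2 * a3 * a4 - l13 * l24)
  t23_t41 : t23 * t41 = a3 * b34 ^ 2 * a4 * t3 * t4 + b12 * b34 * (l24 * t2 * t4 + l13 * t3 * t1)
      + a1 * b12 ^ 2 * a2 * t1 * t2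
      + b23 * b34 ^ 2 * b41 * b12 ^ 2 * (a2 * a3 * a4 * a1 - l24 * l13)

/-- The point `y` of affine space over `Q` lies on `X_{G₂}`. -/
def G2Sat {Q : Type*} [CommRing Q] (y : G2Var → Q) : Prop :=
  ∀ (g : DihedralGroup 4) (n : Fin 5),
    g2Equation y (dihVertex g 1) (dihVertex g 2) (dihVertex g 3) (dihVertex g 4) n = 0

theorem zmod4_cases (a : ZMod 4) : a = 0 ∨ a = 1 ∨ a = 2 ∨ a = 3 := by revert a; decide

/-- The 40 labelled equations give only 20 different ones: the types `θ_iθ_j` and `θ_{ij}θ_{jk}` are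
each invariant under a reflection, and each of `θ_iθ_k` and `θ_{ij}θ_{kl}` arises from four
labellings. Only the type `θ_iθ_{jk}` has a free orbit. -/
theorem g2Sat_iff {Q : Type*} [CommRing Q] (y : G2Var → Q) : G2Sat y ↔
    G2Eqs (y (.th 1)) (y (.th 2)) (y (.th 3)) (y (.th 4))
    (y (.thE 1)) (y (.thE 2)) (y (.thE 3)) (y (.thE 4))
    (y (.A 1)) (y (.A 2)) (y (.A 3)) (y (.A 4))
    (y (.AE 1)) (y (.AE 2)) (y (.AE 3)) (y (.AE 4)) (y (.lam 1)) (y (.lam 0)) := by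
  constructor
  · intro h
    exact
      { t1_t2 := sub_eq_zero.1 (h (.r 0) 0)
        t2_t3 := sub_eq_zero.1 (h (.r 1) 0)
        t3_t4 := sub_eq_zero.1 (h (.r 2) 0)
        t4_t1 := sub_eq_zero.1 (h (.r 3) 0)
        t12_t23 := sub_eq_zero.1 (h (.r 0) 1)
        t23_t34 := sub_eq_zero.1 (h (.r 1) 1)
        t34_t41 := sub_eq_zero.1 (h (.r 2) 1)
        t41_t12 := sub_eq_zero.1 (h (.r 3) 1)
        t1_t23 := sub_eq_zero.1 (h (.r 0) 2)
        t2_t34 := sub_eq_zero.1 (h (.r 1) 2)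
        t3_t41 := sub_eq_zero.1 (h (.r 2) 2)
        t4_t12 := sub_eq_zero.1 (h (.r 3) 2)
        t3_t12 := sub_eq_zero.1 (h (.sr 0) 2)
        t4_t23 := sub_eq_zero.1 (h (.sr 1) 2)
        t1_t34 := sub_eq_zero.1 (h (.sr 2) 2)
        t2_t41 := sub_eq_zero.1 (h (.sr 3) 2)
        t1_t3 := sub_eq_zero.1 (h (.r 0) 3)
        t2_t4 := sub_eq_zero.1 (h (.r 1) 3)
        t12_t34 := sub_eq_zero.1 (h (.r 0) 4)
        t23_t41 := sub_eq_zero.1 (h (.r 1) 4) }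
  · intro h g n
    have h1 : polyEdge (1 : ZMod 4) 2 = 1 := rfl
    have h2 : polyEdge (2 : ZMod 4) 3 = 2 := rfl
    have h3 : polyEdge (3 : ZMod 4) 0 = 3 := rfl
    have h4 : polyEdge (0 : ZMod 4) 1 = 0 := rfl
    have h5 : polyEdge (2 : ZMod 4) 1 = 1 := rfl
    have h6 : polyEdge (3 : ZMod 4) 2 = 2 := rfl
    have h7 : polyEdge (0 : ZMod 4) 3 = 3 := rfl
    have h8 : polyEdge (1 : ZMod 4) 0 = 0 := rfl
    have d0 : diagThrough 0 = 0 := rfl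
    have d1 : diagThrough 1 = 1 := rfl
    have d2 : diagThrough 2 = 0 := rfl
    have d3 : diagThrough 3 = 1 := rfl
    rw [show (4 : ZMod 4) = 0 from rfl] at h
    rcases g with a | a <;> rcases zmod4_cases a with rfl | rfl | rfl | rfl <;> fin_cases n <;>
      simp only [g2Equation, dihVertex, Fin.isValue, Fin.zero_eta, Fin.mk_one, Fin.reduceFinMk,
        Matrix.cons_val, Matrix.cons_val_zero, Matrix.cons_val_one] <;>
      reduce_mod_char <;>
      simp only [h1, h2, h3, h4, h5, h6, h7, h8, d0, d1, d2, d3]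
    · linear_combination h.t1_t2
    · linear_combination h.t12_t23
    · linear_combination h.t1_t23
    · linear_combination h.t1_t3
    · linear_combination h.t12_t34
    · linear_combination h.t2_t3
    · linear_combination h.t23_t34
    · linear_combination h.t2_t34
    · linear_combination h.t2_t4
    · linear_combination h.t23_t41
    · linear_combination h.t3_t4
    · linear_combination h.t34_t41
    · linear_combination h.t3_t41
    · linear_combination h.t1_t3
    · linear_combination h.t12_t34
    · linear_combination h.t4_t1
    · linear_combination h.t41_t12
    · linear_combination h.t4_t12
    · linear_combination h.t2_t4
    · linear_combination h.t23_t41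
    · linear_combination h.t2_t3
    · linear_combination h.t12_t23
    · linear_combination h.t3_t12
    · linear_combination h.t1_t3
    · linear_combination h.t23_t41
    · linear_combination h.t3_t4
    · linear_combination h.t23_t34
    · linear_combination h.t4_t23
    · linear_combination h.t2_t4
    · linear_combination h.t12_t34
    · linear_combination h.t4_t1
    · linear_combination h.t34_t41
    · linear_combination h.t1_t34
    · linear_combination h.t1_t3
    · linear_combination h.t23_t41
    · linear_combination h.t1_t2
    · linear_combination h.t41_t12
    · linear_combination h.t2_t41
    · linear_combination h.t2_t4
    · linear_combination h.t12_t34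

/-! ### Ideals and points over quotient rings. -/

section Maps

variable {R Q : Type*} [CommRing R] [CommRing Q]

theorem map_g2Equation (f : R →+* Q) (x : G2Var → R) (i j k l : ZMod 4) (n : Fin 5) :
    f (g2Equation x i j k l n) = g2Equation (fun v => f (x v)) i j k l n := by
  fin_cases n <;> simp [g2Equation]

/-- The universal property of the ideal. It turns containments of ideals into statements about a
point of `X_{G₂}` over `R ⧸ J`, so that later comparisons are done with equations in an arbitrary
ring. -/
theorem g2Ideal_le_iff (J : Ideal R) (x : G2Var → R) :
    g2Ideal x ≤ J ↔ G2Sat fun v => Ideal.Quotient.mk J (x v) := by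
  rw [g2Ideal, Ideal.span_le]
  constructor
  · intro h g n
    rw [← map_g2Equation, Ideal.Quotient.eq_zero_iff_mem]
    exact h ⟨g, n, rfl⟩
  · rintro h _ ⟨g, n, rfl⟩
    have := h g n
    rw [← map_g2Equation, Ideal.Quotient.eq_zero_iff_mem] at this
    exact this

theorem g2Sat_mk_g2Ideal (x : G2Var → R) :
    G2Sat fun v => Ideal.Quotient.mk (g2Ideal x) (x v) := (g2Ideal_le_iff _ x).1 le_rfl

end Maps

/-! ### Symmetries -/

theorem dihVertex_dihVertex {n : ℕ} (g h : DihedralGroup n) (i : ZMod n) :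
    dihVertex g (dihVertex h i) = dihVertex (h * g) i := by
  rcases g with a | a <;> rcases h with b | b <;> simp [dihVertex] <;> ring

theorem polyEdge_dihVertex (g : DihedralGroup 4) (i j : ZMod 4) (h : j = i + 1 ∨ i = j + 1) :
    polyEdge (dihVertex g (polyEdge i j)) (dihVertex g (polyEdge i j + 1)) =
      polyEdge (dihVertex g i) (dihVertex g j) := by
  rcases g with a | a <;> revert a i j <;> decide

theorem diagThrough_dihVertex (g : DihedralGroup 4) (i : ZMod 4) :
    diagThrough (dihVertex g (diagVertex (diagThrough i))) = diagThrough (dihVertex g i) := by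
  rcases g with a | a <;> revert a i <;> decide

theorem dihVertex_adjacent (g : DihedralGroup 4) (i j : ZMod 4) (h : j = i + 1 ∨ i = j + 1) :
    dihVertex g j = dihVertex g i + 1 ∨ dihVertex g i = dihVertex g j + 1 := by
  rcases g with a | a <;> revert a i j <;> decide

/-- Relabelling the coordinates only permutes the labellings of the square. The product is `h * g`
because `dihVertex` reverses the order of composition. -/
theorem g2Equation_relabel {R : Type*} [CommRing R] (x : G2Var → R) (g h : DihedralGroup 4)
    (n : Fin 5) :
    g2Equation (fun v => x (v.relabel g))
      (dihVertex h 1) (dihVertex h 2) (dihVertex h 3) (dihVertex h 4) n =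
    g2Equation x (dihVertex (h * g) 1) (dihVertex (h * g) 2) (dihVertex (h * g) 3)
      (dihVertex (h * g) 4) n := by
  have h1 := polyEdge_dihVertex g _ _ (dihVertex_adjacent h 1 2 (by decide))
  have h2 := polyEdge_dihVertex g _ _ (dihVertex_adjacent h 2 3 (by decide))
  have h3 := polyEdge_dihVertex g _ _ (dihVertex_adjacent h 3 4 (by decide))
  have h4 := polyEdge_dihVertex g _ _ (dihVertex_adjacent h 4 1 (by decide))
  simp only [g2Equation, G2Var.relabel, h1, h2, h3, h4, diagThrough_dihVertex]
  simp only [dihVertex_dihVertex]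

theorem g2Ideal_relabel {R : Type*} [CommRing R] (x : G2Var → R) (g : DihedralGroup 4) :
    g2Ideal (fun v => x (v.relabel g)) = g2Ideal x := by
  rw [g2Ideal, g2Ideal]
  congr 1
  ext f
  constructor
  · rintro ⟨h, n, rfl⟩
    exact ⟨h * g, n, g2Equation_relabel x g h n⟩
  · rintro ⟨h, n, rfl⟩
    refine ⟨h * g⁻¹, n, ?_⟩
    rw [g2Equation_relabel, inv_mul_cancel_right]

/-! ### Charts -/

/-- An ideal generated by `c` elements which has height `c` defines a complete intersection. -/
def g2EquationFamily {Q : Type*} [CommRing Q] {c : ℕ} (y : G2Var → Q)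
    (G : Fin c → DihedralGroup 4) (N : Fin c → Fin 5) (i : Fin c) : Q :=
  g2Equation y (dihVertex (G i) 1) (dihVertex (G i) 2) (dihVertex (G i) 3) (dihVertex (G i) 4) (N i)

/-- The codimension is already known, so it is enough that `c` chosen equations generate the ideal.
This is tested in every quotient ring. -/
theorem isCompleteIntersection_of_g2EquationFamily {m c : ℕ} {φ : G2Var → MvPolynomial (Fin m) ℂ}
    (hφ : (g2Ideal φ).height = c) (G : Fin c → DihedralGroup 4) (N : Fin c → Fin 5)
    (h : ∀ J : Ideal (MvPolynomial (Fin m) ℂ),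
      (∀ i, g2EquationFamily (fun v => Ideal.Quotient.mk J (φ v)) G N i = 0) →
      G2Sat fun v => Ideal.Quotient.mk J (φ v)) :
    IsCompleteIntersection c (g2Ideal φ) := by
  refine ⟨hφ, g2EquationFamily φ G N, le_antisymm (Ideal.span_le.2 ?_) ?_⟩
  · rintro _ ⟨i, rfl⟩
    exact Ideal.subset_span ⟨G i, N i, rfl⟩
  · rw [g2Ideal_le_iff]
    refine h _ fun i => ?_
    rw [g2EquationFamily, ← map_g2Equation, Ideal.Quotient.eq_zero_iff_mem]
    exact Ideal.subset_span ⟨i, rfl⟩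

/-- Where `θ₁` is invertible the six equations solve successively for `θ₂`, `θ₄`, `θ₃`, `θ₂₃`, `θ₃₄`
and `A₁`, the last because of the term `A₁θ₁³`. Each remaining equation, once multiplied by `θ₁`, is
a combination of those already established; the order of the derivations matters. -/
theorem G2Eqs.of_isUnit_t1 {Q : Type*} [CommRing Q]
    {t1 t2 t3 t4 t12 t23 t34 t41 a1 a2 a3 a4 b12 b23 b34 b41 l13 l24 : Q} (hu : IsUnit t1)
    (t1_t2 : t1 * t2 = b12 * t12 + b23 * a3 * b34 ^ 2 * a4 * b41)
    (t4_t1 : t4 * t1 = b41 * t41 + b12 * a2 * b23 ^ 2 * a3 * b34)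
    (t1_t3 : t1 * t3 = b12 * a2 * b23 * t2 + l24 * b12 * b23 * b34 * b41 + b34 * a4 * b41 * t4)
    (t1_t23 : t1 * t23 = b12 * a2 * t2 ^ 2 + l24 * b34 * b41 * b12 * t2
      + l13 * b34 ^ 2 * a4 * b41 ^ 2 * b12 + a3 * b34 ^ 2 * a4 * b41 * t3)
    (t1_t34 : t1 * t34 = b41 * a4 * t4 ^ 2 + l24 * b23 * b12 * b41 * t4
      + l13 * b23 ^ 2 * a2 * b12 ^ 2 * b41 + a3 * b23 ^ 2 * a2 * b12 * t3)
    (t41_t12 : t41 * t12 = a1 * t1 ^ 3 + l13 * b23 * b34 * t1 ^ 2 + l24 * b23 ^ 2 * a3 * b34 ^ 2 *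
        t1
      + a2 * b23 ^ 3 * a3 ^ 2 * b34 ^ 3 * a4)
    : G2Eqs t1 t2 t3 t4 t12 t23 t34 t41 a1 a2 a3 a4 b12 b23 b34 b41 l13 l24 := by
  have t4_t12 : t4 * t12 = b41 * a1 * t1 ^ 2 + l13 * b23 * b34 * b41 * t1
      + l24 * b23 ^ 2 * a3 * b34 ^ 2 * b41 + a2 * b23 ^ 2 * a3 * b34 * t2 :=
    hu.mul_left_cancel (by linear_combination t12 * t4_t1 + b41 * t41_t12
      - a2 * a3 * b23 ^ 2 * b34 * t1_t2)
  have t2_t4 : t2 * t4 = b23 * a3 * b34 * t3 + l13 * b23 * b34 * b41 * b12 + b41 * a1 * b12 * t1 :=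
    hu.mul_left_cancel (by linear_combination t4 * t1_t2 + b12 * t4_t12
      - a3 * b23 * b34 * t1_t3)
  have t2_t41 : t2 * t41 = b12 * a1 * t1 ^ 2 + l13 * b34 * b23 * b12 * t1
      + l24 * b34 ^ 2 * a3 * b23 ^ 2 * b12 + a4 * b34 ^ 2 * a3 * b23 * t4 :=
    hu.mul_left_cancel (by linear_combination t41 * t1_t2 + b12 * t41_t12
      - a3 * a4 * b23 * b34 ^ 2 * t4_t1)
  have t3_t41 : t3 * t41 = b34 * a4 * t4 ^ 2 + l24 * b12 * b23 * b34 * t4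
      + l13 * b12 ^ 2 * a2 * b23 ^ 2 * b34 + a1 * b12 ^ 2 * a2 * b23 * t1 :=
    hu.mul_left_cancel (by linear_combination t41 * t1_t3 + (-a4 * b34 * t4
      - b12 * b23 * b34 * l24) * t4_t1 + a2 * b12 * b23 * t2_t41)
  have t3_t4 : t3 * t4 = b34 * t34 + b41 * a1 * b12 ^ 2 * a2 * b23 :=
    hu.mul_left_cancel (by linear_combination t3 * t4_t1 + b41 * t3_t41 - b34 * t1_t34)
  have t3_t12 : t3 * t12 = b23 * a2 * t2 ^ 2 + l24 * b41 * b34 * b23 * t2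
      + l13 * b41 ^ 2 * a4 * b34 ^ 2 * b23 + a1 * b41 ^ 2 * a4 * b34 * t1 :=
    hu.mul_left_cancel (by linear_combination t12 * t1_t3 + (-a2 * b23 * t2
      - b23 * b34 * b41 * l24) * t1_t2 + a4 * b34 * b41 * t4_t12)
  have t2_t3 : t2 * t3 = b23 * t23 + b34 * a4 * b41 ^ 2 * a1 * b12 :=
    hu.mul_left_cancel (by linear_combination t3 * t1_t2 - b23 * t1_t23 + b12 * t3_t12)
  have t12_t23 : t12 * t23 = a2 * t2 ^ 3 + l24 * b34 * b41 * t2 ^ 2 + l13 * b34 ^ 2 * a4 * b41 ^ 2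
      * t2
      + a3 * b34 ^ 3 * a4 ^ 2 * b41 ^ 3 * a1 :=
    hu.mul_left_cancel (by linear_combination (-a2 * t2 ^ 2 - a4 * b34 ^ 2 * b41 ^ 2 * l13
      - b34 * b41 * l24 * t2) * t1_t2 + t12 * t1_t23 + a3 * a4 * b34 ^ 2 * b41 * t3_t12)
  have t34_t41 : t34 * t41 = a4 * t4 ^ 3 + l24 * b12 * b23 * t4 ^ 2 + l13 * b12 ^ 2 * a2 * b23 ^ 2
      * t4
      + a1 * b12 ^ 3 * a2 ^ 2 * b23 ^ 3 * a3 :=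
    hu.mul_left_cancel (by linear_combination (-a2 * b12 ^ 2 * b23 ^ 2 * l13 - a4 * t4 ^ 2
      - b12 * b23 * l24 * t4) * t4_t1 + t41 * t1_t34 + a2 * a3 * b12 * b23 ^ 2 * t3_t41)
  have t12_t34 : t12 * t34 = a2 * b23 ^ 2 * a3 * t2 * t3 + b41 * b23 * (l13 * t1 * t3 + l24 * t2 *
      t4)
      + a4 * b41 ^ 2 * a1 * t4 * t1
      + b12 * b23 ^ 2 * b34 * b41 ^ 2 * (a1 * a2 * a3 * a4 - l13 * l24) :=
    hu.mul_left_cancel (by linear_combination t12 * t1_t34 + (-a2 * a3 * b23 ^ 2 * t3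
      - a2 * b12 * b23 ^ 2 * b41 * l13 - b23 * b41 * l24 * t4) * t1_t2
      - b23 * b41 * l13 * t1 * t1_t3 + a4 * b41 * t4 * t4_t12
      + a2 * a3 * a4 * b23 ^ 2 * b34 * b41 * t2_t4)
  have t2_t34 : t2 * t34 = b23 * a3 * t3 ^ 2 + l13 * b41 * b12 * b23 * t3
      + l24 * b41 ^ 2 * a1 * b12 ^ 2 * b23 + a4 * b41 ^ 2 * a1 * b12 * t4 :=
    hu.mul_left_cancel (by linear_combination t34 * t1_t2 - a3 * b23 * t3 * t1_t3
      + b12 * t12_t34 + b12 * b23 * b41 * l24 * t2_t4 - a3 * a4 * b23 * b34 * b41 * t3_t4)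
  have t23_t34 : t23 * t34 = a3 * t3 ^ 3 + l13 * b41 * b12 * t3 ^ 2 + l24 * b41 ^ 2 * a1 * b12 ^ 2
      * t3
      + a4 * b41 ^ 3 * a1 ^ 2 * b12 ^ 3 * a2 :=
    hu.mul_left_cancel (by linear_combination (-a1 * b12 ^ 2 * b41 ^ 2 * l24 - a3 * t3 ^ 2
      - b12 * b41 * l13 * t3) * t1_t3 + t34 * t1_t23 + (-a3 * a4 * b34 * b41 * t3
      - a4 * b12 * b34 * b41 ^ 2 * l13) * t3_t4 + (a2 * b12 * t2 + b12 * b34 * b41 * l24) * t2_t34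
      + a1 * a2 * a4 * b12 ^ 2 * b41 ^ 2 * t2_t4)
  have t23_t41 : t23 * t41 = a3 * b34 ^ 2 * a4 * t3 * t4 + b12 * b34 * (l24 * t2 * t4 + l13 * t3 *
      t1)
      + a1 * b12 ^ 2 * a2 * t1 * t2
      + b23 * b34 ^ 2 * b41 * b12 ^ 2 * (a2 * a3 * a4 * a1 - l24 * l13) :=
    hu.mul_left_cancel (by linear_combination t41 * t1_t23 - b12 * b34 * l24 * t4 * t1_t2
      - b12 * b34 * l13 * t1 * t1_t3 + (-a3 * a4 * b34 ^ 2 * t3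
      - a4 * b12 * b34 ^ 2 * b41 * l13) * t4_t1 + (a2 * b12 * t2 + b12 * b34 * b41 * l24) * t2_t41
      - b12 ^ 2 * b34 * l24 * t4_t12 + a2 * a3 * a4 * b12 * b23 * b34 ^ 2 * t2_t4)
  have t4_t23 : t4 * t23 = b34 * a3 * t3 ^ 2 + l13 * b12 * b41 * b34 * t3
      + l24 * b12 ^ 2 * a1 * b41 ^ 2 * b34 + a2 * b12 ^ 2 * a1 * b41 * t2 :=
    hu.mul_left_cancel (by linear_combination t23 * t4_t1 - a3 * b34 * t3 * t1_t3
      + b41 * t23_t41 + b12 * b34 * b41 * l24 * t2_t4 - a2 * a3 * b12 * b23 * b34 * t2_t3)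
  constructor <;> assumption

/-- Where `θ₁₂` is invertible the six equations solve for `A₁₂`, `θ₂₃`, `θ₄₁`, `θ₃`, `θ₄` and `θ₃₄`.
The others follow after multiplication by `θ₁₂`. -/
theorem G2Eqs.of_isUnit_t12 {Q : Type*} [CommRing Q]
    {t1 t2 t3 t4 t12 t23 t34 t41 a1 a2 a3 a4 b12 b23 b34 b41 l13 l24 : Q} (hu : IsUnit t12)
    (t1_t2 : t1 * t2 = b12 * t12 + b23 * a3 * b34 ^ 2 * a4 * b41)
    (t12_t23 : t12 * t23 = a2 * t2 ^ 3 + l24 * b34 * b41 * t2 ^ 2 + l13 * b34 ^ 2 * a4 * b41 ^ 2 *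
        t2
      + a3 * b34 ^ 3 * a4 ^ 2 * b41 ^ 3 * a1)
    (t41_t12 : t41 * t12 = a1 * t1 ^ 3 + l13 * b23 * b34 * t1 ^ 2 + l24 * b23 ^ 2 * a3 * b34 ^ 2 *
        t1
      + a2 * b23 ^ 3 * a3 ^ 2 * b34 ^ 3 * a4)
    (t12_t34 : t12 * t34 = a2 * b23 ^ 2 * a3 * t2 * t3 + b41 * b23 * (l13 * t1 * t3 + l24 * t2 * t4)
      + a4 * b41 ^ 2 * a1 * t4 * t1
      + b12 * b23 ^ 2 * b34 * b41 ^ 2 * (a1 * a2 * a3 * a4 - l13 * l24))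
    (t3_t12 : t3 * t12 = b23 * a2 * t2 ^ 2 + l24 * b41 * b34 * b23 * t2
      + l13 * b41 ^ 2 * a4 * b34 ^ 2 * b23 + a1 * b41 ^ 2 * a4 * b34 * t1)
    (t4_t12 : t4 * t12 = b41 * a1 * t1 ^ 2 + l13 * b23 * b34 * b41 * t1
      + l24 * b23 ^ 2 * a3 * b34 ^ 2 * b41 + a2 * b23 ^ 2 * a3 * b34 * t2)
    : G2Eqs t1 t2 t3 t4 t12 t23 t34 t41 a1 a2 a3 a4 b12 b23 b34 b41 l13 l24 := by
  have t2_t3 : t2 * t3 = b23 * t23 + b34 * a4 * b41 ^ 2 * a1 * b12 :=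
    hu.mul_left_cancel (by linear_combination t2 * t3_t12 - b23 * t12_t23
      + a1 * a4 * b34 * b41 ^ 2 * t1_t2)
  have t4_t1 : t4 * t1 = b41 * t41 + b12 * a2 * b23 ^ 2 * a3 * b34 :=
    hu.mul_left_cancel (by linear_combination t1 * t4_t12 - b41 * t41_t12
      + a2 * a3 * b23 ^ 2 * b34 * t1_t2)
  have t1_t3 : t1 * t3 = b12 * a2 * b23 * t2 + l24 * b12 * b23 * b34 * b41 + b34 * a4 * b41 * t4 :=
    hu.mul_left_cancel (by linear_combination t1 * t3_t12 + (a2 * b23 * t2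
      + b23 * b34 * b41 * l24) * t1_t2 - a4 * b34 * b41 * t4_t12)
  have t2_t4 : t2 * t4 = b23 * a3 * b34 * t3 + l13 * b23 * b34 * b41 * b12 + b41 * a1 * b12 * t1 :=
    hu.mul_left_cancel (by linear_combination t2 * t4_t12 + (a1 * b41 * t1
      + b23 * b34 * b41 * l13) * t1_t2 - a3 * b23 * b34 * t3_t12)
  have t3_t4 : t3 * t4 = b34 * t34 + b41 * a1 * b12 ^ 2 * a2 * b23 :=
    hu.mul_left_cancel (by linear_combination t4 * t3_t12 + a2 * b23 * t2 * t2_t4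
      - b34 * t12_t34 - b23 * b34 * b41 * l13 * t1_t3 + a1 * a2 * b12 * b23 * b41 * t1_t2)
  have t1_t23 : t1 * t23 = b12 * a2 * t2 ^ 2 + l24 * b34 * b41 * b12 * t2
      + l13 * b34 ^ 2 * a4 * b41 ^ 2 * b12 + a3 * b34 ^ 2 * a4 * b41 * t3 :=
    hu.mul_left_cancel (by linear_combination t1 * t12_t23 + (a2 * t2 ^ 2
      + a4 * b34 ^ 2 * b41 ^ 2 * l13 + b34 * b41 * l24 * t2) * t1_t2
      - a3 * a4 * b34 ^ 2 * b41 * t3_t12)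
  have t2_t41 : t2 * t41 = b12 * a1 * t1 ^ 2 + l13 * b34 * b23 * b12 * t1
      + l24 * b34 ^ 2 * a3 * b23 ^ 2 * b12 + a4 * b34 ^ 2 * a3 * b23 * t4 :=
    hu.mul_left_cancel (by linear_combination t2 * t41_t12 + (a1 * t1 ^ 2
      + a3 * b23 ^ 2 * b34 ^ 2 * l24 + b23 * b34 * l13 * t1) * t1_t2
      - a3 * a4 * b23 * b34 ^ 2 * t4_t12)
  have t2_t34 : t2 * t34 = b23 * a3 * t3 ^ 2 + l13 * b41 * b12 * b23 * t3
      + l24 * b41 ^ 2 * a1 * b12 ^ 2 * b23 + a4 * b41 ^ 2 * a1 * b12 * t4 :=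
    hu.mul_left_cancel (by linear_combination t2 * t12_t34 + b23 * b41 * l24 * t2 * t2_t4
      + (a1 * a4 * b41 ^ 2 * t4 + a1 * b12 * b23 * b41 ^ 2 * l24 + b23 * b41 * l13 * t3) * t1_t2
      - a3 * b23 * t3 * t3_t12 - a1 * a3 * a4 * b23 * b34 * b41 ^ 2 * t1_t3)
  have t1_t34 : t1 * t34 = b41 * a4 * t4 ^ 2 + l24 * b23 * b12 * b41 * t4
      + l13 * b23 ^ 2 * a2 * b12 ^ 2 * b41 + a3 * b23 ^ 2 * a2 * b12 * t3 :=
    hu.mul_left_cancel (by linear_combination t1 * t12_t34 + (a2 * a3 * b23 ^ 2 * t3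
      + a2 * b12 * b23 ^ 2 * b41 * l13 + b23 * b41 * l24 * t4) * t1_t2
      + b23 * b41 * l13 * t1 * t1_t3 - a4 * b41 * t4 * t4_t12
      - a2 * a3 * a4 * b23 ^ 2 * b34 * b41 * t2_t4)
  have t3_t41 : t3 * t41 = b34 * a4 * t4 ^ 2 + l24 * b12 * b23 * b34 * t4
      + l13 * b12 ^ 2 * a2 * b23 ^ 2 * b34 + a1 * b12 ^ 2 * a2 * b23 * t1 :=
    hu.mul_left_cancel (by linear_combination t3 * t41_t12 + (a1 * t1 ^ 2
      + a3 * b23 ^ 2 * b34 ^ 2 * l24 + b23 * b34 * l13 * t1) * t1_t3 + (-a4 * b34 * t4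
      - b12 * b23 * b34 * l24) * t4_t12 + (a1 * a2 * b12 * b23 * t1
      + a2 * b12 * b23 ^ 2 * b34 * l13) * t1_t2 - a2 * a3 * a4 * b23 ^ 2 * b34 ^ 2 * t2_t4)
  have t4_t23 : t4 * t23 = b34 * a3 * t3 ^ 2 + l13 * b12 * b41 * b34 * t3
      + l24 * b12 ^ 2 * a1 * b41 ^ 2 * b34 + a2 * b12 ^ 2 * a1 * b41 * t2 :=
    hu.mul_left_cancel (by linear_combination t4 * t12_t23 + (a2 * t2 ^ 2
      + a4 * b34 ^ 2 * b41 ^ 2 * l13 + b34 * b41 * l24 * t2) * t2_t4 + (-a3 * b34 * t3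
      - b12 * b34 * b41 * l13) * t3_t12 + (a1 * a2 * b12 * b41 * t2
      + a1 * b12 * b34 * b41 ^ 2 * l24) * t1_t2 - a1 * a3 * a4 * b34 ^ 2 * b41 ^ 2 * t1_t3)
  have t23_t41 : t23 * t41 = a3 * b34 ^ 2 * a4 * t3 * t4 + b12 * b34 * (l24 * t2 * t4 + l13 * t3 *
      t1)
      + a1 * b12 ^ 2 * a2 * t1 * t2
      + b23 * b34 ^ 2 * b41 * b12 ^ 2 * (a2 * a3 * a4 * a1 - l24 * l13) :=
    hu.mul_left_cancel (by linear_combination t41 * t12_t23 + (a2 * t2 ^ 2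
      + a4 * b34 ^ 2 * b41 ^ 2 * l13 + b34 * b41 * l24 * t2) * t2_t41
      + (a1 * a2 * a3 * a4 * b12 * b23 * b34 ^ 2 * b41 + a1 * a2 * b12 * t1 * t2
      - b12 * b23 * b34 ^ 2 * b41 * l13 * l24) * t1_t2 - b12 * b34 * l24 * t2 * t4_t12
      + (-a3 * a4 * b34 ^ 2 * t4 - b12 * b34 * l13 * t1) * t3_t12
      - a1 * a3 * a4 ^ 2 * b34 ^ 3 * b41 ^ 2 * t4_t1)
  have t23_t34 : t23 * t34 = a3 * t3 ^ 3 + l13 * b41 * b12 * t3 ^ 2 + l24 * b41 ^ 2 * a1 * b12 ^ 2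
      * t3
      + a4 * b41 ^ 3 * a1 ^ 2 * b12 ^ 3 * a2 :=
    hu.mul_left_cancel (by linear_combination (-a1 * b12 ^ 2 * b41 ^ 2 * l24 - a3 * t3 ^ 2
      - b12 * b41 * l13 * t3) * t3_t12 + t34 * t12_t23 + (a2 * t2 ^ 2
      + a4 * b34 ^ 2 * b41 ^ 2 * l13 + b34 * b41 * l24 * t2) * t2_t34
      + (-a1 * a3 * a4 * b34 * b41 ^ 2 * t3 - a1 * a4 * b12 * b34 * b41 ^ 3 * l13) * t1_t3
      + (a1 * a2 * a4 * b12 * b41 ^ 2 * t2 + a1 * a4 * b12 * b34 * b41 ^ 3 * l24) * t2_t4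
      + a1 ^ 2 * a2 * a4 * b12 ^ 2 * b41 ^ 3 * t1_t2
      - a1 * a3 * a4 ^ 2 * b34 ^ 2 * b41 ^ 3 * t3_t4)
  have t34_t41 : t34 * t41 = a4 * t4 ^ 3 + l24 * b12 * b23 * t4 ^ 2 + l13 * b12 ^ 2 * a2 * b23 ^ 2
      * t4
      + a1 * b12 ^ 3 * a2 ^ 2 * b23 ^ 3 * a3 :=
    hu.mul_left_cancel (by linear_combination (-a2 * b12 ^ 2 * b23 ^ 2 * l13 - a4 * t4 ^ 2
      - b12 * b23 * l24 * t4) * t4_t12 + t34 * t41_t12 + (a1 * t1 ^ 2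
      + a3 * b23 ^ 2 * b34 ^ 2 * l24 + b23 * b34 * l13 * t1) * t1_t34
      + (-a2 * a3 * a4 * b23 ^ 2 * b34 * t4 - a2 * a3 * b12 * b23 ^ 3 * b34 * l24) * t2_t4
      + (a1 * a2 * a3 * b12 * b23 ^ 2 * t1 + a2 * a3 * b12 * b23 ^ 3 * b34 * l13) * t1_t3
      - a2 * a3 ^ 2 * a4 * b23 ^ 3 * b34 ^ 2 * t3_t4
      + a1 * a2 ^ 2 * a3 * b12 ^ 2 * b23 ^ 3 * t1_t2)
  constructor <;> assumption

theorem g2Sat_of_isUnit_t1 {Q : Type*} [CommRing Q] (y : G2Var → Q) (hu : IsUnit (y (.th 1)))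
    (h : ∀ i, g2EquationFamily y ![.r 0, .r 3, .r 0, .r 0, .sr 2, .r 3] ![0, 0, 3, 2, 2, 1] i = 0)
        : G2Sat y :=
  (g2Sat_iff y).2 (.of_isUnit_t1 hu (sub_eq_zero.1 (h 0)) (sub_eq_zero.1 (h 1)) (sub_eq_zero.1 (h
      2)) (sub_eq_zero.1 (h 3)) (sub_eq_zero.1 (h 4)) (sub_eq_zero.1 (h 5)))

theorem isCompleteIntersection_of_isUnit_t1 {m : ℕ} (φ : G2Var → MvPolynomial (Fin m) ℂ)
    (hφ : (g2Ideal φ).height = 6) (hu : IsUnit (φ (.th 1))) :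
    IsCompleteIntersection 6 (g2Ideal φ) :=
  isCompleteIntersection_of_g2EquationFamily hφ _ _ fun J h =>
    g2Sat_of_isUnit_t1 _ (hu.map (Ideal.Quotient.mk J)) h

theorem g2Sat_of_isUnit_t12 {Q : Type*} [CommRing Q] (y : G2Var → Q) (hu : IsUnit (y (.thE 1)))
    (h : ∀ i, g2EquationFamily y ![.r 0, .r 0, .r 3, .r 0, .sr 0, .r 3] ![0, 1, 1, 4, 2, 2] i = 0)
        : G2Sat y :=
  (g2Sat_iff y).2 (.of_isUnit_t12 hu (sub_eq_zero.1 (h 0)) (sub_eq_zero.1 (h 1)) (sub_eq_zero.1 (h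
      2)) (sub_eq_zero.1 (h 3)) (sub_eq_zero.1 (h 4)) (sub_eq_zero.1 (h 5)))

theorem isCompleteIntersection_of_isUnit_t12 {m : ℕ} (φ : G2Var → MvPolynomial (Fin m) ℂ)
    (hφ : (g2Ideal φ).height = 6) (hu : IsUnit (φ (.thE 1))) :
    IsCompleteIntersection 6 (g2Ideal φ) :=
  isCompleteIntersection_of_g2EquationFamily hφ _ _ fun J h =>
    g2Sat_of_isUnit_t12 _ (hu.map (Ideal.Quotient.mk J)) h

/-! ### The equations of `X_{C₂}` and `X_{A₂}` in coordinates -/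

/-- The equations of `X_{C₂}`, in the coordinates `θ_i`, `θ_{ij}`, `A_i`, `A_{ij}`, `λ`. -/
structure C2Eqs {Q : Type*} [CommRing Q] (s1 s2 s3 s12 s23 s31 c1 c2 c3 e12 e23 e31 m : Q) : Prop
    where
  s1_s2 : s1 * s2 = e12 * s12 + e23 * c3 * e31
  s2_s3 : s2 * s3 = e23 * s23 + e31 * c1 * e12
  s3_s1 : s3 * s1 = e31 * s31 + e12 * c2 * e23
  s31_s12 : s31 * s12 = c1 * s1 ^ 2 + m * e23 * s1 + c2 * e23 ^ 2 * c3
  s12_s23 : s12 * s23 = c2 * s2 ^ 2 + m * e31 * s2 + c3 * e31 ^ 2 * c1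
  s23_s31 : s23 * s31 = c3 * s3 ^ 2 + m * e12 * s3 + c1 * e12 ^ 2 * c2
  s1_s23 : s1 * s23 = e12 * c2 * s2 + m * e31 * e12 + c3 * e31 * s3
  s2_s31 : s2 * s31 = e23 * c3 * s3 + m * e12 * e23 + c1 * e12 * s1
  s3_s12 : s3 * s12 = e31 * c1 * s1 + m * e23 * e31 + c2 * e23 * s2

/-- The equations of `X_{A₂}`, in the coordinates `θ_i`, `A_i`. -/
structure A2Eqs {Q : Type*} [CommRing Q] (s1 s2 s3 s4 s5 c1 c2 c3 c4 c5 : Q) : Prop where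
  s1_s3 : s1 * s3 = c2 * s2 + c4 * c5
  s2_s4 : s2 * s4 = c3 * s3 + c5 * c1
  s3_s5 : s3 * s5 = c4 * s4 + c1 * c2
  s4_s1 : s4 * s1 = c5 * s5 + c2 * c3
  s5_s2 : s5 * s2 = c1 * s1 + c3 * c4

/-- The point `y` of affine space over `Q` lies on `X_{C₂}`. -/
def C2Sat {Q : Type*} [CommRing Q] (y : C2Var → Q) : Prop :=
  ∀ (g : DihedralGroup 3) (n : Fin 3),
    c2Equation y (dihVertex g 1) (dihVertex g 2) (dihVertex g 3) n = 0

theorem zmod3_cases (a : ZMod 3) : a = 0 ∨ a = 1 ∨ a = 2 := by revert a; decide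

theorem c2Sat_iff {Q : Type*} [CommRing Q] (y : C2Var → Q) : C2Sat y ↔
    C2Eqs (y (.th 1)) (y (.th 2)) (y (.th 3)) (y (.thE 1)) (y (.thE 2)) (y (.thE 3))
      (y (.A 1)) (y (.A 2)) (y (.A 3)) (y (.AE 1)) (y (.AE 2)) (y (.AE 3)) (y .lam) := by
  constructor
  · intro h
    exact
      { s1_s2 := sub_eq_zero.1 (h (.r 0) 0)
        s2_s3 := sub_eq_zero.1 (h (.r 1) 0)
        s3_s1 := sub_eq_zero.1 (h (.r 2) 0)
        s31_s12 := sub_eq_zero.1 (h (.r 0) 1)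
        s12_s23 := sub_eq_zero.1 (h (.r 1) 1)
        s23_s31 := sub_eq_zero.1 (h (.r 2) 1)
        s1_s23 := sub_eq_zero.1 (h (.r 0) 2)
        s2_s31 := sub_eq_zero.1 (h (.r 1) 2)
        s3_s12 := sub_eq_zero.1 (h (.r 2) 2) }
  · intro h g n
    have h1 : polyEdge (1 : ZMod 3) 2 = 1 := rfl
    have h2 : polyEdge (2 : ZMod 3) 0 = 2 := rfl
    have h3 : polyEdge (0 : ZMod 3) 1 = 0 := rfl
    have h4 : polyEdge (2 : ZMod 3) 1 = 1 := rfl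
    have h5 : polyEdge (0 : ZMod 3) 2 = 2 := rfl
    have h6 : polyEdge (1 : ZMod 3) 0 = 0 := rfl
    rw [show (3 : ZMod 3) = 0 from rfl] at h
    rcases g with a | a <;> rcases zmod3_cases a with rfl | rfl | rfl <;> fin_cases n <;>
      simp only [c2Equation, dihVertex, Fin.isValue, Fin.zero_eta, Fin.mk_one, Fin.reduceFinMk,
        Matrix.cons_val, Matrix.cons_val_zero, Matrix.cons_val_one] <;>
      reduce_mod_char <;>
      simp only [h1, h2, h3, h4, h5, h6]
    · linear_combination h.s1_s2
    · linear_combination h.s31_s12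
    · linear_combination h.s1_s23
    · linear_combination h.s2_s3
    · linear_combination h.s12_s23
    · linear_combination h.s2_s31
    · linear_combination h.s3_s1
    · linear_combination h.s23_s31
    · linear_combination h.s3_s12
    · linear_combination h.s1_s2
    · linear_combination h.s12_s23
    · linear_combination h.s2_s31
    · linear_combination h.s2_s3
    · linear_combination h.s23_s31
    · linear_combination h.s3_s12
    · linear_combination h.s3_s1
    · linear_combination h.s31_s12
    · linear_combination h.s1_s23

/-! ### Ideals of the `C₂`, tag and Pfaffian formats. -/

section Maps

variable {R Q : Type*} [CommRing R] [CommRing Q]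

theorem map_c2Equation (f : R →+* Q) (x : C2Var → R) (i j k : ZMod 3) (n : Fin 3) :
    f (c2Equation x i j k n) = c2Equation (fun v => f (x v)) i j k n := by
  fin_cases n <;> simp [c2Equation]

theorem c2Ideal_le_iff (J : Ideal R) (x : C2Var → R) :
    c2Ideal x ≤ J ↔ C2Sat fun v => Ideal.Quotient.mk J (x v) := by
  rw [c2Ideal, Ideal.span_le]
  constructor
  · intro h g n
    rw [← map_c2Equation, Ideal.Quotient.eq_zero_iff_mem]
    exact h ⟨g, n, rfl⟩
  · rintro h _ ⟨g, n, rfl⟩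
    have := h g n
    rw [← map_c2Equation, Ideal.Quotient.eq_zero_iff_mem] at this
    exact this

theorem map_c2Coords (f : R →+* Q) (x : G2Var → R) (v : C2Var) :
    f (c2Coords x v) = c2Coords (fun v => f (x v)) v := by
  rcases v with i | i | i | i | _
  on_goal 5 => rfl
  all_goals rcases zmod3_cases i with rfl | rfl | rfl <;> simp [c2Coords]

theorem map_tagValue (f : R →+* Q) (x : G2Var → R) (i : ZMod 4) :
    f (tagValue x i) = tagValue (fun v => f (x v)) i := by
  simp [tagValue]

theorem tagIdeal_le_iff (J : Ideal R) (E : Finset (ZMod 4)) (x : G2Var → R) :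
    tagIdeal E x ≤ J ↔ ∀ i ∈ E, Ideal.Quotient.mk J (x (.thE i)) =
      tagValue (fun v => Ideal.Quotient.mk J (x v)) i := by
  rw [tagIdeal, Ideal.span_le]
  constructor
  · intro h i hi
    rw [← map_tagValue, Ideal.Quotient.eq]
    exact h ⟨i, hi, rfl⟩
  · rintro h _ ⟨i, hi, rfl⟩
    have := h i hi
    rw [← map_tagValue, Ideal.Quotient.eq] at this
    exact this

/-- The signed `4 × 4` Pfaffians of a `5 × 5` matrix. -/
def pf4 (M : Matrix (Fin 5) (Fin 5) R) : Fin 5 → R :=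
  ![M 1 2 * M 3 4 - M 1 3 * M 2 4 + M 1 4 * M 2 3,
    -(M 0 2 * M 3 4 - M 0 3 * M 2 4 + M 0 4 * M 2 3),
    M 0 1 * M 3 4 - M 0 3 * M 1 4 + M 0 4 * M 1 3,
    -(M 0 1 * M 2 4 - M 0 2 * M 1 4 + M 0 4 * M 1 2),
    M 0 1 * M 2 3 - M 0 2 * M 1 3 + M 0 3 * M 1 2]

/-- A maximal Pfaffian is determined by its omitted index. The alternating signs do not change the
ideal; they make the vector of Pfaffians a syzygy of the rows of a skew matrix. -/
theorem pf4Ideal_eq (M : Matrix (Fin 5) (Fin 5) R) :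
    pf4Ideal M = Ideal.span (Set.range (pf4 M)) := by
  refine le_antisymm (Ideal.span_le.2 ?_) (Ideal.span_le.2 ?_)
  · rintro _ ⟨a, b, c, d, hab, hbc, hcd, rfl⟩
    have h : (a = 1 ∧ b = 2 ∧ c = 3 ∧ d = 4) ∨ (a = 0 ∧ b = 2 ∧ c = 3 ∧ d = 4) ∨
        (a = 0 ∧ b = 1 ∧ c = 3 ∧ d = 4) ∨ (a = 0 ∧ b = 1 ∧ c = 2 ∧ d = 4) ∨
        (a = 0 ∧ b = 1 ∧ c = 2 ∧ d = 3) := by omega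
    rcases h with h | h | h | h | h <;> obtain ⟨rfl, rfl, rfl, rfl⟩ := h
    · exact Ideal.subset_span ⟨0, rfl⟩
    · exact (neg_mem_iff (S := Ideal R)).1 (Ideal.subset_span ⟨1, rfl⟩)
    · exact Ideal.subset_span ⟨2, rfl⟩
    · exact (neg_mem_iff (S := Ideal R)).1 (Ideal.subset_span ⟨3, rfl⟩)
    · exact Ideal.subset_span ⟨4, rfl⟩
  · rintro _ ⟨k, rfl⟩
    fin_cases k
    · exact Ideal.subset_span ⟨1, 2, 3, 4, by decide, by decide, by decide, rfl⟩
    · exact neg_mem (Ideal.subset_span ⟨0, 2, 3, 4, by decide, by decide, by decide, rfl⟩)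
    · exact Ideal.subset_span ⟨0, 1, 3, 4, by decide, by decide, by decide, rfl⟩
    · exact neg_mem (Ideal.subset_span ⟨0, 1, 2, 4, by decide, by decide, by decide, rfl⟩)
    · exact Ideal.subset_span ⟨0, 1, 2, 3, by decide, by decide, by decide, rfl⟩

/-- The five Pfaffians are, up to sign, the five exchange relations of type `A₂`. -/
theorem a2Ideal_le_iff (J : Ideal R) (x : A2Var → R) :
    a2Ideal x ≤ J ↔
      A2Eqs (Ideal.Quotient.mk J (x (.th 1))) (Ideal.Quotient.mk J (x (.th 2)))
        (Ideal.Quotient.mk J (x (.th 3))) (Ideal.Quotient.mk J (x (.th 4)))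
        (Ideal.Quotient.mk J (x (.th 5))) (Ideal.Quotient.mk J (x (.A 1)))
        (Ideal.Quotient.mk J (x (.A 2))) (Ideal.Quotient.mk J (x (.A 3)))
        (Ideal.Quotient.mk J (x (.A 4))) (Ideal.Quotient.mk J (x (.A 5))) := by
  have hJ : a2Ideal x ≤ J ↔ ∀ k, Ideal.Quotient.mk J (pf4 (a2Matrix x) k) = 0 := by
    rw [a2Ideal, pf4Ideal_eq, Ideal.span_le]
    simp only [Ideal.Quotient.eq_zero_iff_mem]
    exact Set.range_subset_iff
  rw [hJ]
  simp only [Fin.forall_fin_succ, pf4, a2Matrix, Matrix.of_apply, Matrix.cons_val', Fin.isValue,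
    Matrix.cons_val, Matrix.cons_val_zero, Matrix.cons_val_one, Matrix.cons_val_succ,
    map_add, map_sub, map_mul, map_neg, IsEmpty.forall_iff, and_true]
  constructor
  · rintro ⟨h0, h1, h2, h3, h4⟩
    exact
      { s1_s3 := by linear_combination -h4
        s2_s4 := by linear_combination -h2
        s3_s5 := by linear_combination -h0
        s4_s1 := by linear_combination h3
        s5_s2 := by linear_combination h1 }
  · intro h
    refine ⟨?_, ?_, ?_, ?_, ?_⟩
    · linear_combination -h.s3_s5
    · linear_combination h.s5_s2
    · linear_combination -h.s2_s4
    · linear_combination h.s4_s1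
    · linear_combination -h.s1_s3

end Maps

/-! ### Formats -/

/-- The nine equations without `θ₁₂` and `θ₂₃` are exactly those of `C₂` when `A₁₂ = A₂₃ = 1`. In
them `A₄` and `λ₂₄` enter only through `A₄θ₄ + λ₂₄`. -/
theorem G2Eqs.c2Eqs {Q : Type*} [CommRing Q]
    {t1 t2 t3 t4 t12 t23 t34 t41 a1 a2 a3 a4 b12 b23 b34 b41 l13 l24 : Q}
    (hb12 : b12 = 1)
    (hb23 : b23 = 1)
    (h : G2Eqs t1 t2 t3 t4 t12 t23 t34 t41 a1 a2 a3 a4 b12 b23 b34 b41 l13 l24)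
    : C2Eqs t1 t3 t4 t2 t34 t41 a1 a3 (a4 * t4 + l24) a2 b34 b41 l13 := by
  subst hb12 hb23
  exact
    { s1_s2 := by linear_combination h.t1_t3
      s2_s3 := by linear_combination h.t3_t4
      s3_s1 := by linear_combination h.t4_t1
      s31_s12 := by linear_combination h.t2_t41
      s12_s23 := by linear_combination h.t2_t34
      s23_s31 := by linear_combination h.t34_t41
      s1_s23 := by linear_combination h.t1_t34
      s2_s31 := by linear_combination h.t3_t41
      s3_s12 := by linear_combination h.t2_t4 }

/-- The other eleven equations contain `θ₁₂` or `θ₂₃`. Substituting the tag values makes each of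
them a combination of the `C₂` equations. -/
theorem C2Eqs.g2Eqs {Q : Type*} [CommRing Q]
    {t1 t2 t3 t4 t12 t23 t34 t41 a1 a2 a3 a4 b12 b23 b34 b41 l13 l24 : Q}
    (hb12 : b12 = 1)
    (hb23 : b23 = 1)
    (ht12 : t12 = t1 * t2 - b23 * a3 * b34 ^ 2 * a4 * b41)
    (ht23 : t23 = t2 * t3 - b34 * a4 * b41 ^ 2 * a1 * b12)
    (h : C2Eqs t1 t3 t4 t2 t34 t41 a1 a3 (a4 * t4 + l24) a2 b34 b41 l13)
    : G2Eqs t1 t2 t3 t4 t12 t23 t34 t41 a1 a2 a3 a4 b12 b23 b34 b41 l13 l24 := by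
  subst hb12 hb23
  exact
    { t1_t2 := by linear_combination -ht12
      t2_t3 := by linear_combination -ht23
      t3_t4 := by linear_combination h.s2_s3
      t4_t1 := by linear_combination h.s3_s1
      t12_t23 := by linear_combination t23 * ht12 + (-a3 * a4 * b34 ^ 2 * b41
        + t1 * t2) * ht23 + t2 ^ 2 * h.s1_s2 + a4 * b34 * b41 * t2 * h.s3_s12
      t23_t34 := by linear_combination t34 * ht23 + t3 * h.s12_s23
        + a1 * a4 * b41 ^ 2 * h.s2_s3
      t34_t41 := by linear_combination h.s23_s31
      t41_t12 := by linear_combination t41 * ht12 + t1 * h.s31_s12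
        + a3 * a4 * b34 ^ 2 * h.s3_s1
      t1_t23 := by linear_combination t1 * ht23 + t2 * h.s1_s2
        + a4 * b34 * b41 * h.s3_s12
      t2_t34 := by linear_combination h.s12_s23
      t3_t41 := by linear_combination h.s2_s31
      t4_t12 := by linear_combination t4 * ht12 + t2 * h.s3_s1 + b41 * h.s31_s12
      t3_t12 := by linear_combination t3 * ht12 + t2 * h.s1_s2
        + a4 * b34 * b41 * h.s3_s12
      t4_t23 := by linear_combination t4 * ht23 + t2 * h.s2_s3 + b34 * h.s12_s23
      t1_t34 := by linear_combination h.s1_s23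
      t2_t41 := by linear_combination h.s31_s12
      t1_t3 := by linear_combination h.s1_s2
      t2_t4 := by linear_combination h.s3_s12
      t12_t34 := by linear_combination t34 * ht12 + t1 * h.s12_s23
        + a3 * t3 * h.s1_s2 - b41 * l24 * h.s3_s12 + a3 * a4 * b34 * b41 * h.s2_s3
      t23_t41 := by linear_combination t41 * ht23 + t3 * h.s31_s12
        + a1 * t1 * h.s1_s2 - b34 * l24 * h.s3_s12 + a1 * a4 * b34 * b41 * h.s3_s1 }

/-- With a third coefficient equal to 1, five equations avoid `θ₁₂`, `θ₂₃` and `θ₃₄`. Now `A₁` and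
`λ₁₃` too enter them only through `A₁θ₁ + λ₁₃`. -/
theorem G2Eqs.a2Eqs {Q : Type*} [CommRing Q]
    {t1 t2 t3 t4 t12 t23 t34 t41 a1 a2 a3 a4 b12 b23 b34 b41 l13 l24 : Q}
    (hb12 : b12 = 1)
    (hb23 : b23 = 1)
    (hb34 : b34 = 1)
    (h : G2Eqs t1 t2 t3 t4 t12 t23 t34 t41 a1 a2 a3 a4 b12 b23 b34 b41 l13 l24)
    : A2Eqs t3 t4 t41 t1 t2 a3 (a4 * t4 + l24) b41 (a1 * t1 + l13) a2 := by
  subst hb12 hb23 hb34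
  exact
    { s1_s3 := by linear_combination h.t3_t41
      s2_s4 := by linear_combination h.t4_t1
      s3_s5 := by linear_combination h.t2_t41
      s4_s1 := by linear_combination h.t1_t3
      s5_s2 := by linear_combination h.t2_t4 }

theorem A2Eqs.g2Eqs {Q : Type*} [CommRing Q]
    {t1 t2 t3 t4 t12 t23 t34 t41 a1 a2 a3 a4 b12 b23 b34 b41 l13 l24 : Q}
    (hb12 : b12 = 1)
    (hb23 : b23 = 1)
    (hb34 : b34 = 1)
    (ht12 : t12 = t1 * t2 - b23 * a3 * b34 ^ 2 * a4 * b41)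
    (ht23 : t23 = t2 * t3 - b34 * a4 * b41 ^ 2 * a1 * b12)
    (ht34 : t34 = t3 * t4 - b41 * a1 * b12 ^ 2 * a2 * b23)
    (h : A2Eqs t3 t4 t41 t1 t2 a3 (a4 * t4 + l24) b41 (a1 * t1 + l13) a2)
    : G2Eqs t1 t2 t3 t4 t12 t23 t34 t41 a1 a2 a3 a4 b12 b23 b34 b41 l13 l24 := by
  subst hb12 hb23 hb34
  exact
    { t1_t2 := by linear_combination -ht12
      t2_t3 := by linear_combination -ht23
      t3_t4 := by linear_combination -ht34
      t4_t1 := by linear_combination h.s2_s4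
      t12_t23 := by linear_combination t23 * ht12 + (-a3 * a4 * b41
        + t1 * t2) * ht23 + t2 ^ 2 * h.s4_s1 + a4 * b41 * t2 * h.s5_s2
      t23_t34 := by linear_combination t34 * ht23 + (-a1 * a4 * b41 ^ 2
        + t2 * t3) * ht34 + t3 ^ 2 * h.s5_s2 + a1 * b41 * t3 * h.s4_s1
      t34_t41 := by linear_combination t41 * ht34 + t4 * h.s1_s3
        + a1 * a2 * h.s2_s4
      t41_t12 := by linear_combination t41 * ht12 + t1 * h.s3_s5
        + a3 * a4 * h.s2_s4
      t1_t23 := by linear_combination t1 * ht23 + t2 * h.s4_s1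
        + a4 * b41 * h.s5_s2
      t2_t34 := by linear_combination t2 * ht34 + t3 * h.s5_s2
        + a1 * b41 * h.s4_s1
      t3_t41 := by linear_combination h.s1_s3
      t4_t12 := by linear_combination t4 * ht12 + t2 * h.s2_s4 + b41 * h.s3_s5
      t3_t12 := by linear_combination t3 * ht12 + t2 * h.s4_s1
        + a4 * b41 * h.s5_s2
      t4_t23 := by linear_combination t4 * ht23 + t3 * h.s5_s2
        + a1 * b41 * h.s4_s1
      t1_t34 := by linear_combination t1 * ht34 + t3 * h.s2_s4 + b41 * h.s1_s3
      t2_t41 := by linear_combination h.s3_s5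
      t1_t3 := by linear_combination h.s4_s1
      t2_t4 := by linear_combination h.s5_s2
      t12_t34 := by linear_combination t34 * ht12 + (-a3 * a4 * b41
        + t1 * t2) * ht34 + t2 * t3 * h.s2_s4 + b41 * t2 * h.s1_s3 + a4 * b41 * t4 * h.s5_s2
        - b41 * l13 * h.s4_s1
      t23_t41 := by linear_combination t41 * ht23 + t2 * h.s1_s3
        + a4 * t4 * h.s5_s2 - l13 * h.s4_s1 + a1 * a4 * b41 * h.s2_s4 }

theorem C2Eqs.a2Eqs {Q : Type*} [CommRing Q] {s1 s2 s3 s12 s23 s31 c1 c2 c3 e12 e23 e31 m : Q}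
    (h : C2Eqs s1 s2 s3 s12 s23 s31 c1 c2 c3 e12 e23 e31 m) :
    A2Eqs s1 s2 s23 s3 s31 (e12 * c1) (e12 * c2) e23 (c3 * s3 + m * e12) e31 :=
    { s1_s3 := by linear_combination h.s1_s23
      s2_s4 := by linear_combination h.s2_s3
      s3_s5 := by linear_combination h.s23_s31
      s4_s1 := by linear_combination h.s3_s1
      s5_s2 := by linear_combination h.s2_s31 }

/-- If the coefficient `e12` is a unit, the `C₂` variable `s12` is redundant: the five equations
without it are Pfaffians, and the remaining ones follow from the equation for `s1 * s2` by
cancelling `e12`. In the `G₂` setting `e12` is `A₂`. -/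
theorem A2Eqs.c2Eqs {Q : Type*} [CommRing Q] {s1 s2 s3 s12 s23 s31 c1 c2 c3 e12 e23 e31 m : Q}
    (hu : IsUnit e12) (s1_s2 : s1 * s2 = e12 * s12 + e23 * c3 * e31)
    (h : A2Eqs s1 s2 s23 s3 s31 (e12 * c1) (e12 * c2) e23 (c3 * s3 + m * e12) e31) :
    C2Eqs s1 s2 s3 s12 s23 s31 c1 c2 c3 e12 e23 e31 m := by
  have s2_s3 : s2 * s3 = e23 * s23 + e31 * c1 * e12 :=
    by linear_combination h.s2_s4
  have s3_s1 : s3 * s1 = e31 * s31 + e12 * c2 * e23 :=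
    by linear_combination h.s4_s1
  have s31_s12 : s31 * s12 = c1 * s1 ^ 2 + m * e23 * s1 + c2 * e23 ^ 2 * c3 :=
    hu.mul_left_cancel (by linear_combination -s31 * s1_s2 + s1 * h.s5_s2
        + c3 * e23 * h.s4_s1)
  have s12_s23 : s12 * s23 = c2 * s2 ^ 2 + m * e31 * s2 + c3 * e31 ^ 2 * c1 :=
    hu.mul_left_cancel (by linear_combination -s23 * s1_s2 + s2 * h.s1_s3
        + c3 * e31 * h.s2_s4)
  have s23_s31 : s23 * s31 = c3 * s3 ^ 2 + m * e12 * s3 + c1 * e12 ^ 2 * c2 :=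
    by linear_combination h.s3_s5
  have s1_s23 : s1 * s23 = e12 * c2 * s2 + m * e31 * e12 + c3 * e31 * s3 :=
    by linear_combination h.s1_s3
  have s2_s31 : s2 * s31 = e23 * c3 * s3 + m * e12 * e23 + c1 * e12 * s1 :=
    by linear_combination h.s5_s2
  have s3_s12 : s3 * s12 = e31 * c1 * s1 + m * e23 * e31 + c2 * e23 * s2 :=
    hu.mul_left_cancel (by linear_combination -s3 * s1_s2 + s1 * h.s2_s4 + e23 * h.s1_s3)
  constructor <;> assumption

/-- The action of the torus which rescales the `θ_{ij}`. -/
theorem G2Eqs.scale {Q : Type*} [CommRing Q]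
    {t1 t2 t3 t4 t12 t23 t34 t41 a1 a2 a3 a4 b12 b23 b34 b41 l13 l24 u1 u2 u3 u4 : Q}
    (h : G2Eqs t1 t2 t3 t4 t12 t23 t34 t41 a1 a2 a3 a4 (u1 * b12) (u2 * b23) (u3 * b34) (u4 * b41)
      l13 l24) :
    G2Eqs t1 t2 t3 t4 (u1 * t12) (u2 * t23) (u3 * t34) (u4 * t41) (u4 * u1 * a1) (u1 * u2 * a2)
      (u2 * u3 * a3) (u3 * u4 * a4) b12 b23 b34 b41 (u1 * u2 * u3 * u4 * l13)
      (u1 * u2 * u3 * u4 * l24) :=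
    { t1_t2 := by linear_combination h.t1_t2
      t2_t3 := by linear_combination h.t2_t3
      t3_t4 := by linear_combination h.t3_t4
      t4_t1 := by linear_combination h.t4_t1
      t12_t23 := by linear_combination u1 * u2 * h.t12_t23
      t23_t34 := by linear_combination u2 * u3 * h.t23_t34
      t34_t41 := by linear_combination u3 * u4 * h.t34_t41
      t41_t12 := by linear_combination u4 * u1 * h.t41_t12
      t1_t23 := by linear_combination u2 * h.t1_t23
      t2_t34 := by linear_combination u3 * h.t2_t34
      t3_t41 := by linear_combination u4 * h.t3_t41
      t4_t12 := by linear_combination u1 * h.t4_t12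
      t3_t12 := by linear_combination u1 * h.t3_t12
      t4_t23 := by linear_combination u2 * h.t4_t23
      t1_t34 := by linear_combination u3 * h.t1_t34
      t2_t41 := by linear_combination u4 * h.t2_t41
      t1_t3 := by linear_combination h.t1_t3
      t2_t4 := by linear_combination h.t2_t4
      t12_t34 := by linear_combination u1 * u3 * h.t12_t34
      t23_t41 := by linear_combination u2 * u4 * h.t23_t41 }

/-! ### Identities of ideals for the specialised formats. -/

section Formats

variable {R : Type*} [CommRing R]

theorem G2Sat.eq_tagValue {y : G2Var → R} (h : G2Sat y) {i : ZMod 4} (hi : y (.AE i) = 1) :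
    y (.thE i) = tagValue y i := by
  have H := (g2Sat_iff y).1 h
  rcases zmod4_cases i with rfl | rfl | rfl | rfl
  · have := H.t4_t1
    rw [show (4 : ZMod 4) = 0 from rfl, hi] at this
    change y (.thE 0) = y (.th 0) * y (.th 1) - y (.AE 1) * y (.A 2) * y (.AE 2) ^ 2 * y (.A 3)
      * y (.AE 3)
    linear_combination -this
  · have := H.t1_t2
    rw [hi] at this
    change y (.thE 1) = y (.th 1) * y (.th 2) - y (.AE 2) * y (.A 3) * y (.AE 3) ^ 2 * y (.A 4)
      * y (.AE 4)
    linear_combination -this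
  · have := H.t2_t3
    rw [hi] at this
    change y (.thE 2) = y (.th 2) * y (.th 3) - y (.AE 3) * y (.A 4) * y (.AE 4) ^ 2 * y (.A 1)
      * y (.AE 1)
    linear_combination -this
  · have := H.t3_t4
    rw [hi] at this
    change y (.thE 3) = y (.th 3) * y (.th 4) - y (.AE 4) * y (.A 1) * y (.AE 1) ^ 2 * y (.A 2)
      * y (.AE 2)
    linear_combination -this

theorem tagIdeal_le_g2Ideal {E : Finset (ZMod 4)} {x : G2Var → R}
    (hE : ∀ i ∈ E, x (.AE i) = 1) : tagIdeal E x ≤ g2Ideal x := by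
  rw [tagIdeal_le_iff]
  intro i hi
  refine (g2Sat_mk_g2Ideal x).eq_tagValue ?_
  simp [hE i hi]

theorem setOne_eq_self {E : Finset (ZMod 4)} {x : G2Var → R}
    (hE : ∀ i ∈ E, x (.AE i) = 1) : setOne E x = x := by
  funext v
  rcases v with i | i | i | i | p <;> try rfl
  simp only [setOne]
  split_ifs with h
  · exact (hE i h).symm
  · rfl

/-- Elimination of the variables which are redundant when some coefficients are `1`. -/
theorem g2Ideal_eq_eliminateEdges {E : Finset (ZMod 4)} {x : G2Var → R}
    (hE : ∀ i ∈ E, x (.AE i) = 1) :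
    g2Ideal x = tagIdeal E x ⊔ g2Ideal (eliminateEdges E x) := by
  -- Modulo the tag equations the eliminated point and the original point coincide, so they satisfy
  -- the same equations.
  have key : ∀ J : Ideal R, tagIdeal E x ≤ J →
      (fun v => Ideal.Quotient.mk J (eliminateEdges E x v)) =
        fun v => Ideal.Quotient.mk J (x v) := by
    intro J hJ
    rw [tagIdeal_le_iff] at hJ
    funext v
    rcases v with i | i | i | i | p <;> simp only [eliminateEdges, setOne_eq_self hE]
    split_ifs with h
    · rw [map_tagValue, hJ i h]
    · rfl
  refine le_antisymm ?_ (sup_le (tagIdeal_le_g2Ideal hE) ?_)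
  · rw [g2Ideal_le_iff, ← key _ le_sup_left, ← g2Ideal_le_iff]
    exact le_sup_right
  · rw [g2Ideal_le_iff, key _ (tagIdeal_le_g2Ideal hE), ← g2Ideal_le_iff]

theorem tagValue_one (y : G2Var → R) : tagValue y 1 = y (.th 1) * y (.th 2)
    - y (.AE 2) * y (.A 3) * y (.AE 3) ^ 2 * y (.A 4) * y (.AE 4) := rfl

theorem tagValue_two (y : G2Var → R) : tagValue y 2 = y (.th 2) * y (.th 3)
    - y (.AE 3) * y (.A 4) * y (.AE 4) ^ 2 * y (.A 1) * y (.AE 1) := rfl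

theorem tagValue_three (y : G2Var → R) : tagValue y 3 = y (.th 3) * y (.th 4)
    - y (.AE 4) * y (.A 1) * y (.AE 1) ^ 2 * y (.A 2) * y (.AE 2) := rfl

/-- The `C₂` format. -/
theorem g2Ideal_eq_c2Ideal {x : G2Var → R} (h1 : x (.AE 1) = 1) (h2 : x (.AE 2) = 1) :
    g2Ideal x = tagIdeal {1, 2} x ⊔ c2Ideal (c2Coords x) := by
  refine le_antisymm ?_ (sup_le (tagIdeal_le_g2Ideal (by simp [h1, h2])) ?_)
  · have hT := (tagIdeal_le_iff _ _ x).1 (le_sup_left (b := c2Ideal (c2Coords x)) (a := tagIdeal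
      {1, 2} x))
    have hC := (c2Ideal_le_iff _ (c2Coords x)).1
      (le_sup_right (b := c2Ideal (c2Coords x)) (a := tagIdeal {1, 2} x))
    rw [g2Ideal_le_iff, g2Sat_iff]
    simp only [map_c2Coords] at hC
    refine C2Eqs.g2Eqs (by simp [h1]) (by simp [h2]) ?_ ?_ ((c2Sat_iff _).1 hC)
    · exact (hT 1 (by decide)).trans (tagValue_one _)
    · exact (hT 2 (by decide)).trans (tagValue_two _)
  · rw [c2Ideal_le_iff, c2Sat_iff]
    simp only [map_c2Coords]
    exact ((g2Sat_iff _).1 (g2Sat_mk_g2Ideal x)).c2Eqs (by simp [h1]) (by simp [h2])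

/-- The `A₂` format. -/
theorem g2Ideal_eq_a2Ideal {x : G2Var → R} (h1 : x (.AE 1) = 1) (h2 : x (.AE 2) = 1)
    (h3 : x (.AE 3) = 1) :
    g2Ideal x = tagIdeal {1, 2, 3} x ⊔ a2Ideal (a2Coords x) := by
  refine le_antisymm ?_ (sup_le (tagIdeal_le_g2Ideal (by simp [h1, h2, h3])) ?_)
  · have hT := (tagIdeal_le_iff _ _ x).1
      (le_sup_left (b := a2Ideal (a2Coords x)) (a := tagIdeal {1, 2, 3} x))
    have hA := (a2Ideal_le_iff _ (a2Coords x)).1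
      (le_sup_right (b := a2Ideal (a2Coords x)) (a := tagIdeal {1, 2, 3} x))
    rw [g2Ideal_le_iff, g2Sat_iff]
    refine A2Eqs.g2Eqs (by simp [h1]) (by simp [h2]) (by simp [h3]) ?_ ?_ ?_ ?_
    · exact (hT 1 (by decide)).trans (tagValue_one _)
    · exact (hT 2 (by decide)).trans (tagValue_two _)
    · exact (hT 3 (by decide)).trans (tagValue_three _)
    · rw [← map_mul, ← map_add, ← map_mul, ← map_add]
      exact hA
  · rw [a2Ideal_le_iff]
    have := ((g2Sat_iff _).1 (g2Sat_mk_g2Ideal x)).a2Eqs (by simp [h1]) (by simp [h2])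
      (by simp [h3])
    rw [← map_mul, ← map_add, ← map_mul, ← map_add] at this
    exact this

/-- The `A₂` coordinates of a `C₂` format in which `A₁₂` is a unit. -/
def a2CoordsOfUnit (x : C2Var → R) : A2Var → R
  | .th i => ![x (.thE 3), x (.th 1), x (.th 2), x (.thE 2), x (.th 3)] i
  | .A i => ![x (.AE 3), x (.AE 1) * x (.A 1), x (.AE 1) * x (.A 2), x (.AE 2),
      x (.A 3) * x (.th 3) + x .lam * x (.AE 1)] i

theorem c2Ideal_eq_a2Ideal {x : C2Var → R} (hu : IsUnit (x (.AE 1))) :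
    c2Ideal x = Ideal.span {c2Equation x 1 2 3 0} ⊔ a2Ideal (a2CoordsOfUnit x) := by
  refine le_antisymm ?_ (sup_le ?_ ?_)
  · set J := Ideal.span {c2Equation x 1 2 3 0} ⊔ a2Ideal (a2CoordsOfUnit x) with hJ
    have hA := (a2Ideal_le_iff J (a2CoordsOfUnit x)).1 le_sup_right
    have h0 : Ideal.Quotient.mk J (c2Equation x 1 2 3 0) = 0 :=
      Ideal.Quotient.eq_zero_iff_mem.2 (Ideal.mem_sup_left (Ideal.mem_span_singleton_self _))
    rw [map_c2Equation] at h0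
    rw [c2Ideal_le_iff, c2Sat_iff]
    refine A2Eqs.c2Eqs (hu.map _) (sub_eq_zero.1 h0) ?_
    simp only [← map_mul, ← map_add]
    exact hA
  · rw [Ideal.span_singleton_le_iff_mem]
    exact Ideal.subset_span ⟨.r 0, 0, rfl⟩
  · rw [a2Ideal_le_iff]
    have := ((c2Sat_iff _).1 ((c2Ideal_le_iff _ x).1 le_rfl)).a2Eqs
    simp only [← map_mul, ← map_add] at this
    exact this

end Formats

/-! ### The torus action -/

theorem torusAct_inv {m : ℕ} (u : ZMod 4 → ℂˣ) (φ : G2Var → MvPolynomial (Fin m) ℂ) :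
    torusAct 1 u⁻¹ (torusAct 1 u φ) = φ := by
  funext v
  have h : g2Character 1 u⁻¹ v * g2Character 1 u v = 1 := by
    rcases v with i | i | i | i | p <;> simp [g2Character]
    · rw [mul_assoc, mul_left_comm (u i)⁻¹]; simp
    · have : ∀ a b c d : ℂˣ, a⁻¹ * b⁻¹ * c⁻¹ * d⁻¹ * (a * b * c * d) = 1 := by
        intro a b c d
        rw [← mul_inv, ← mul_inv, ← mul_inv, inv_mul_cancel]
      exact this _ _ _ _
  simp only [torusAct]
  rw [← mul_assoc, ← C_mul, ← Units.val_mul, h]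
  simp

/-- Only the half of the torus with `t = 1` is needed: it already rescales the four `A_{ij}`
independently. One inclusion is enough, since the inverse element gives the other. -/
theorem g2Ideal_torusAct_le {m : ℕ} (u : ZMod 4 → ℂˣ) (φ : G2Var → MvPolynomial (Fin m) ℂ) :
    g2Ideal (torusAct 1 u φ) ≤ g2Ideal φ := by
  rw [g2Ideal_le_iff, g2Sat_iff]
  have h := (g2Sat_iff _).1 (g2Sat_mk_g2Ideal φ)
  -- The old coefficients are written as multiples of the new ones, so that `G2Eqs.scale` applies
  -- without inverses.
  have hb : ∀ i, Ideal.Quotient.mk (g2Ideal φ) (φ (.AE i)) =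
      Ideal.Quotient.mk (g2Ideal φ) (C (u i : ℂ)) *
        Ideal.Quotient.mk (g2Ideal φ) (torusAct 1 u φ (.AE i)) := by
    intro i
    rw [← map_mul, torusAct, ← mul_assoc, ← C_mul, ← Units.val_mul]
    simp [g2Character]
  have ht : ∀ i, torusAct 1 u φ (.th i) = φ (.th i) := by simp [torusAct, g2Character]
  have hE : ∀ i, torusAct 1 u φ (.thE i) = C (u i : ℂ) * φ (.thE i) := by
    simp [torusAct, g2Character]
  have hA : ∀ i, torusAct 1 u φ (.A i) = C (u (i - 1) : ℂ) * C (u i : ℂ) * φ (.A i) := by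
    simp [torusAct, g2Character]
  have hl : ∀ p, torusAct 1 u φ (.lam p) =
      C (u 1 : ℂ) * C (u 2 : ℂ) * C (u 3 : ℂ) * C (u 4 : ℂ) * φ (.lam p) := by
    simp [torusAct, g2Character]
  simp only [hb] at h
  simp only [ht, hE, hA, hl, map_mul]
  exact h.scale

theorem g2Ideal_torusAct {m : ℕ} (u : ZMod 4 → ℂˣ) (φ : G2Var → MvPolynomial (Fin m) ℂ) :
    g2Ideal (torusAct 1 u φ) = g2Ideal φ :=
  le_antisymm (g2Ideal_torusAct_le u φ) <| by
    conv_lhs => rw [← torusAct_inv u φ]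
    exact g2Ideal_torusAct_le u⁻¹ _

/-! ### Tangent spaces along linear sections -/

/-- Let `Z` be fewer than `m` polynomials which vanish at the origin. If modulo `(Z)²` the ideal `I`
is contained in one which is generated by fewer than `c` elements of `(Z)`, then `I` is not
quasismooth. -/
theorem not_isQuasismoothCone_of_le {m c : ℕ} {I : Ideal (MvPolynomial (Fin m) ℂ)}
    (Z T : List (MvPolynomial (Fin m) ℂ)) (hZ : Z.length < m) (hZ0 : ∀ f ∈ Z, eval 0 f = 0)
    (hT : T.length < c) (hTZ : ∀ f ∈ T, f ∈ Ideal.span {g | g ∈ Z})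
    (h : ∀ J : Ideal (MvPolynomial (Fin m) ℂ),
      (∀ f ∈ Z, ∀ g ∈ Z, f * g ∈ J) → (∀ f ∈ T, f ∈ J) → I ≤ J) :
    ¬ IsQuasismoothCone c I := by
  refine not_isQuasismoothCone (I : Set _) (Submodule.span_eq I).symm Z hZ hZ0 T hT fun P hP => ?_
  set W := Submodule.span ℂ {v | ∃ g ∈ T, v = gradientAt P g} with hW
  have hZP : Ideal.span {g | g ∈ Z} ≤ RingHom.ker (eval P) := Ideal.span_le.2 hP
  -- The functions vanishing at `P` with gradient in `W` form an ideal. It contains every product of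
  -- two elements of `Z`, because such a product has zero gradient at `P`; so the hypothesis places
  -- `I` inside it.
  let J : Ideal (MvPolynomial (Fin m) ℂ) :=
    { carrier := {f | eval P f = 0 ∧ gradientAt P f ∈ W}
      add_mem' := fun {f g} hf hg => ⟨by simp [hf.1, hg.1], by simpa using W.add_mem hf.2 hg.2⟩
      zero_mem' := ⟨by simp, by simp⟩
      smul_mem' := fun a f hf => ⟨by simp [hf.1], by simpa [hf.1] using W.smul_mem _ hf.2⟩ }
  refine fun f hf => h J (fun f hf g hg => ⟨?_, ?_⟩) (fun f hf => ⟨?_, ?_⟩) hf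
  · simp [hP f hf]
  · simp [hP f hf, hP g hg]
  · exact hZP (hTZ f hf)
  · exact Submodule.subset_span ⟨f, hf, rfl⟩

/-- Here the linear section is given by coordinates, and the set of small elements consists of their
classes together with those of the identically zero components. Any two small elements multiply to
zero. -/
theorem not_isQuasismoothCone_g2Ideal {φ : G2Var → MvPolynomial (Fin 10) ℂ}
    (Z : List G2Var) (hZ : Z.length < 10) (hZ0 : ∀ v ∈ Z, eval 0 (φ v) = 0)
    (T : List (MvPolynomial (Fin 10) ℂ)) (hT : T.length < 6)
    (hTZ : ∀ f ∈ T, f ∈ Ideal.span {g | g ∈ Z.map φ})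
    (h : ∀ J : Ideal (MvPolynomial (Fin 10) ℂ),
      (∀ {x y}, x ∈ {x | ∃ v, (v ∈ Z ∨ φ v = 0) ∧ x = Ideal.Quotient.mk J (φ v)} →
        y ∈ {x | ∃ v, (v ∈ Z ∨ φ v = 0) ∧ x = Ideal.Quotient.mk J (φ v)} → x * y = 0) →
      (∀ f ∈ T, Ideal.Quotient.mk J f = 0) → G2Sat fun v => Ideal.Quotient.mk J (φ v)) :
    ¬ IsQuasismoothCone 6 (g2Ideal φ) := by
  refine not_isQuasismoothCone_of_le (Z.map φ) T (by simpa using hZ) (by simpa using hZ0) hT hTZ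
    fun J hJ hTJ => (g2Ideal_le_iff J φ).2 (h J ?_ fun f hf =>
      Ideal.Quotient.eq_zero_iff_mem.2 (hTJ f hf))
  rintro _ _ ⟨v, hv, rfl⟩ ⟨w, hw, rfl⟩
  rw [← map_mul, Ideal.Quotient.eq_zero_iff_mem]
  rcases hv with hv | hv
  · rcases hw with hw | hw
    · exact hJ _ (List.mem_map_of_mem hv) _ (List.mem_map_of_mem hw)
    · simp [hw]
  · simp [hv]

/-- Apart from `A₁₂θ₁₂`, `A₃₄θ₃₄` and their analogues with a factor `θ₁₂` or `θ₃₄`, every monomial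
has two small factors. So only the two gradients of `θ₁₂` and `θ₃₄` can contribute to the rank. -/
theorem G2Eqs.of_small_opposite {Q : Type*} [CommRing Q]
    {t1 t2 t3 t4 t12 t23 t34 t41 a1 a2 a3 a4 b12 b23 b34 b41 l13 l24 : Q} {ε : Set Q}
    (hε : ∀ {x y}, x ∈ ε → y ∈ ε → x * y = 0)
    (m_t1 : t1 ∈ ε) (m_t2 : t2 ∈ ε) (m_t3 : t3 ∈ ε) (m_t4 : t4 ∈ ε) (m_t23 : t23 ∈ ε)
    (m_t41 : t41 ∈ ε) (m_b23 : b23 ∈ ε) (m_b41 : b41 ∈ ε)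
    (h_t12 : t12 = 0) (h_t34 : t34 = 0)
    : G2Eqs t1 t2 t3 t4 t12 t23 t34 t41 a1 a2 a3 a4 b12 b23 b34 b41 l13 l24 := by
  subst h_t12 h_t34
  exact
    { t1_t2 := by linear_combination (hε m_t1 m_t2)
        - a3 * a4 * b34 ^ 2 * (hε m_b23 m_b41)
      t2_t3 := by linear_combination (hε m_t2 m_t3) - (hε m_t23 m_b23)
        - a1 * a4 * b12 * b34 * (hε m_b41 m_b41)
      t3_t4 := by linear_combination (hε m_t3 m_t4)
        - a1 * a2 * b12 ^ 2 * (hε m_b23 m_b41)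
      t4_t1 := by linear_combination (hε m_t1 m_t4) - (hε m_t41 m_b41)
        - a2 * a3 * b12 * b34 * (hε m_b23 m_b23)
      t12_t23 := by linear_combination (-a2 * t2
        - b34 * b41 * l24) * (hε m_t2 m_t2) - a4 * b34 ^ 2 * b41 * l13 * (hε m_t2 m_b41)
        - a1 * a3 * a4 ^ 2 * b34 ^ 3 * b41 * (hε m_b41 m_b41)
      t23_t34 := by linear_combination (-a3 * t3
        - b12 * b41 * l13) * (hε m_t3 m_t3) - a1 * b12 ^ 2 * b41 * l24 * (hε m_t3 m_b41)
        - a1 ^ 2 * a2 * a4 * b12 ^ 3 * b41 * (hε m_b41 m_b41)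
      t34_t41 := by linear_combination (-a4 * t4
        - b12 * b23 * l24) * (hε m_t4 m_t4) - a2 * b12 ^ 2 * b23 * l13 * (hε m_t4 m_b23)
        - a1 * a2 ^ 2 * a3 * b12 ^ 3 * b23 * (hε m_b23 m_b23)
      t41_t12 := by linear_combination (-a1 * t1
        - b23 * b34 * l13) * (hε m_t1 m_t1) - a3 * b23 * b34 ^ 2 * l24 * (hε m_t1 m_b23)
        - a2 * a3 ^ 2 * a4 * b23 * b34 ^ 3 * (hε m_b23 m_b23)
      t1_t23 := by linear_combination (hε m_t1 m_t23) - a2 * b12 * (hε m_t2 m_t2)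
        - b12 * b34 * l24 * (hε m_t2 m_b41) - a3 * a4 * b34 ^ 2 * (hε m_t3 m_b41)
        - a4 * b12 * b34 ^ 2 * l13 * (hε m_b41 m_b41)
      t2_t34 := by linear_combination -a3 * b23 * (hε m_t3 m_t3)
        - b12 * b41 * l13 * (hε m_t3 m_b23) - a1 * a4 * b12 * b41 * (hε m_t4 m_b41)
        - a1 * b12 ^ 2 * b41 * l24 * (hε m_b23 m_b41)
      t3_t41 := by linear_combination (hε m_t3 m_t41) - a4 * b34 * (hε m_t4 m_t4)
        - b12 * b34 * l24 * (hε m_t4 m_b23) - a1 * a2 * b12 ^ 2 * (hε m_t1 m_b23)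
        - a2 * b12 ^ 2 * b34 * l13 * (hε m_b23 m_b23)
      t4_t12 := by linear_combination -a1 * b41 * (hε m_t1 m_t1)
        - b34 * b41 * l13 * (hε m_t1 m_b23) - a2 * a3 * b23 * b34 * (hε m_t2 m_b23)
        - a3 * b34 ^ 2 * b41 * l24 * (hε m_b23 m_b23)
      t3_t12 := by linear_combination -a2 * b23 * (hε m_t2 m_t2)
        - b34 * b41 * l24 * (hε m_t2 m_b23) - a1 * a4 * b34 * b41 * (hε m_t1 m_b41)
        - a4 * b34 ^ 2 * b41 * l13 * (hε m_b23 m_b41)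
      t4_t23 := by linear_combination (hε m_t4 m_t23) - a3 * b34 * (hε m_t3 m_t3)
        - b12 * b34 * l13 * (hε m_t3 m_b41) - a1 * a2 * b12 ^ 2 * (hε m_t2 m_b41)
        - a1 * b12 ^ 2 * b34 * l24 * (hε m_b41 m_b41)
      t1_t34 := by linear_combination -a4 * b41 * (hε m_t4 m_t4)
        - b12 * b41 * l24 * (hε m_t4 m_b23) - a2 * a3 * b12 * b23 * (hε m_t3 m_b23)
        - a2 * b12 ^ 2 * b41 * l13 * (hε m_b23 m_b23)
      t2_t41 := by linear_combination (hε m_t2 m_t41) - a1 * b12 * (hε m_t1 m_t1)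
        - b12 * b34 * l13 * (hε m_t1 m_b23) - a3 * a4 * b34 ^ 2 * (hε m_t4 m_b23)
        - a3 * b12 * b34 ^ 2 * l24 * (hε m_b23 m_b23)
      t1_t3 := by linear_combination (hε m_t1 m_t3) - a4 * b34 * (hε m_t4 m_b41)
        - a2 * b12 * (hε m_t2 m_b23) - b12 * b34 * l24 * (hε m_b23 m_b41)
      t2_t4 := by linear_combination (hε m_t2 m_t4) - a3 * b34 * (hε m_t3 m_b23)
        - a1 * b12 * (hε m_t1 m_b41) - b12 * b34 * l13 * (hε m_b23 m_b41)
      t12_t34 := by linear_combination -b23 * b41 * l24 * (hε m_t2 m_t4)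
        - b23 * b41 * l13 * (hε m_t1 m_t3) - a2 * a3 * b23 ^ 2 * (hε m_t2 m_t3)
        - a1 * a4 * b41 ^ 2 * (hε m_t1 m_t4) + (-a1 * a2 * a3 * a4 * b12 * b34 * b41 ^ 2
        + b12 * b34 * b41 ^ 2 * l13 * l24) * (hε m_b23 m_b23)
      t23_t41 := by linear_combination (hε m_t23 m_t41)
        - b12 * b34 * l24 * (hε m_t2 m_t4) - b12 * b34 * l13 * (hε m_t1 m_t3)
        - a3 * a4 * b34 ^ 2 * (hε m_t3 m_t4) - a1 * a2 * b12 ^ 2 * (hε m_t1 m_t2)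
        + (-a1 * a2 * a3 * a4 * b12 ^ 2 * b34 ^ 2
        + b12 ^ 2 * b34 ^ 2 * l13 * l24) * (hε m_b23 m_b41) }

/-- The free direction is `θ₁₂`. With `A₁₂ = 0` the term `A₁₂θ₁₂` disappears, and `θ₁₂` then occurs
linearly only against the five variables set to zero. -/
theorem G2Eqs.of_small_edge {Q : Type*} [CommRing Q]
    {t1 t2 t3 t4 t12 t23 t34 t41 a1 a2 a3 a4 b12 b23 b34 b41 l13 l24 : Q} {ε : Set Q}
    (hε : ∀ {x y}, x ∈ ε → y ∈ ε → x * y = 0)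
    (m_t1 : t1 ∈ ε) (m_t2 : t2 ∈ ε) (m_b23 : b23 ∈ ε) (m_b41 : b41 ∈ ε)
    (h_b12 : b12 = 0) (h_t23 : t23 = 0) (h_t34 : t34 = 0) (h_t41 : t41 = 0) (h_t3 : t3 = 0)
    (h_t4 : t4 = 0)
    : G2Eqs t1 t2 t3 t4 t12 t23 t34 t41 a1 a2 a3 a4 b12 b23 b34 b41 l13 l24 := by
  subst h_b12 h_t23 h_t34 h_t41 h_t3 h_t4
  exact
    { t1_t2 := by linear_combination (hε m_t1 m_t2)
        - a3 * a4 * b34 ^ 2 * (hε m_b23 m_b41)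
      t2_t3 := by ring
      t3_t4 := by ring
      t4_t1 := by ring
      t12_t23 := by linear_combination (-a2 * t2
        - b34 * b41 * l24) * (hε m_t2 m_t2) - a4 * b34 ^ 2 * b41 * l13 * (hε m_t2 m_b41)
        - a1 * a3 * a4 ^ 2 * b34 ^ 3 * b41 * (hε m_b41 m_b41)
      t23_t34 := by ring
      t34_t41 := by ring
      t41_t12 := by linear_combination (-a1 * t1
        - b23 * b34 * l13) * (hε m_t1 m_t1) - a3 * b23 * b34 ^ 2 * l24 * (hε m_t1 m_b23)
        - a2 * a3 ^ 2 * a4 * b23 * b34 ^ 3 * (hε m_b23 m_b23)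
      t1_t23 := by ring
      t2_t34 := by ring
      t3_t41 := by ring
      t4_t12 := by linear_combination -a1 * b41 * (hε m_t1 m_t1)
        - b34 * b41 * l13 * (hε m_t1 m_b23) - a2 * a3 * b23 * b34 * (hε m_t2 m_b23)
        - a3 * b34 ^ 2 * b41 * l24 * (hε m_b23 m_b23)
      t3_t12 := by linear_combination -a2 * b23 * (hε m_t2 m_t2)
        - b34 * b41 * l24 * (hε m_t2 m_b23) - a1 * a4 * b34 * b41 * (hε m_t1 m_b41)
        - a4 * b34 ^ 2 * b41 * l13 * (hε m_b23 m_b41)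
      t4_t23 := by ring
      t1_t34 := by ring
      t2_t41 := by ring
      t1_t3 := by ring
      t2_t4 := by ring
      t12_t34 := by ring
      t23_t41 := by ring }

/-- The free direction is `θ₁`. With `A₁ = 0` the term `A₁θ₁³` disappears, while `λ₁₃θ₁²` is
harmless because it carries `A₂₃A₃₄`. What remains linear is `θ₁` against `θ₃`, `θ₂₃`, `θ₃₄`, and
the two equations `h12` and `h41`. -/
theorem G2Eqs.of_small_vertex {Q : Type*} [CommRing Q]
    {t1 t2 t3 t4 t12 t23 t34 t41 a1 a2 a3 a4 b12 b23 b34 b41 l13 l24 : Q} {ε : Set Q}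
    (hε : ∀ {x y}, x ∈ ε → y ∈ ε → x * y = 0)
    (m_t2 : t2 ∈ ε) (m_t4 : t4 ∈ ε) (m_t12 : t12 ∈ ε) (m_t41 : t41 ∈ ε) (m_b23 : b23 ∈ ε)
    (m_b34 : b34 ∈ ε)
    (h_a1 : a1 = 0) (h_t3 : t3 = 0) (h_t23 : t23 = 0) (h_t34 : t34 = 0)
    (h12 : t1 * t2 = b12 * t12)
    (h41 : t1 * t4 = b41 * t41)
    : G2Eqs t1 t2 t3 t4 t12 t23 t34 t41 a1 a2 a3 a4 b12 b23 b34 b41 l13 l24 := by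
  subst h_a1 h_t3 h_t23 h_t34
  exact
    { t1_t2 := by linear_combination h12 - a3 * a4 * b34 * b41 * (hε m_b23 m_b34)
      t2_t3 := by ring
      t3_t4 := by ring
      t4_t1 := by linear_combination h41 - a2 * a3 * b12 * b34 * (hε m_b23 m_b23)
      t12_t23 := by linear_combination (-a2 * t2
        - b34 * b41 * l24) * (hε m_t2 m_t2) - a4 * b34 * b41 ^ 2 * l13 * (hε m_t2 m_b34)
      t23_t34 := by ring
      t34_t41 := by linear_combination (-a4 * t4
        - b12 * b23 * l24) * (hε m_t4 m_t4) - a2 * b12 ^ 2 * b23 * l13 * (hε m_t4 m_b23)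
      t41_t12 := by linear_combination (hε m_t12 m_t41)
        - l13 * t1 ^ 2 * (hε m_b23 m_b34) + (-a2 * a3 ^ 2 * a4 * b23 * b34 ^ 3
        - a3 * b34 ^ 2 * l24 * t1) * (hε m_b23 m_b23)
      t1_t23 := by linear_combination -a2 * b12 * (hε m_t2 m_t2)
        - b12 * b41 * l24 * (hε m_t2 m_b34) - a4 * b12 * b41 ^ 2 * l13 * (hε m_b34 m_b34)
      t2_t34 := by ring
      t3_t41 := by linear_combination -a4 * b34 * (hε m_t4 m_t4)
        - b12 * b34 * l24 * (hε m_t4 m_b23) - a2 * b12 ^ 2 * b34 * l13 * (hε m_b23 m_b23)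
      t4_t12 := by linear_combination (hε m_t4 m_t12)
        - b41 * l13 * t1 * (hε m_b23 m_b34) - a2 * a3 * b23 * b34 * (hε m_t2 m_b23)
        - a3 * b34 ^ 2 * b41 * l24 * (hε m_b23 m_b23)
      t3_t12 := by linear_combination -a2 * b23 * (hε m_t2 m_t2)
        - b34 * b41 * l24 * (hε m_t2 m_b23) - a4 * b34 * b41 ^ 2 * l13 * (hε m_b23 m_b34)
      t4_t23 := by ring
      t1_t34 := by linear_combination -a4 * b41 * (hε m_t4 m_t4)
        - b12 * b41 * l24 * (hε m_t4 m_b23) - a2 * b12 ^ 2 * b41 * l13 * (hε m_b23 m_b23)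
      t2_t41 := by linear_combination (hε m_t2 m_t41)
        - b12 * l13 * t1 * (hε m_b23 m_b34) - a3 * a4 * b34 ^ 2 * (hε m_t4 m_b23)
        - a3 * b12 * b34 ^ 2 * l24 * (hε m_b23 m_b23)
      t1_t3 := by linear_combination -a4 * b41 * (hε m_t4 m_b34)
        - a2 * b12 * (hε m_t2 m_b23) - b12 * b41 * l24 * (hε m_b23 m_b34)
      t2_t4 := by linear_combination (hε m_t2 m_t4)
        - b12 * b41 * l13 * (hε m_b23 m_b34)
      t12_t34 := by linear_combination -b23 * b41 * l24 * (hε m_t2 m_t4)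
        + b12 * b34 * b41 ^ 2 * l13 * l24 * (hε m_b23 m_b23)
      t23_t41 := by linear_combination -b12 * b34 * l24 * (hε m_t2 m_t4)
        + b12 ^ 2 * b34 * b41 * l13 * l24 * (hε m_b23 m_b34) }

/-- The free direction is `θ₃`, and `A₄₁` is the only small edge coefficient. With `A₂₃` possibly
not small, the terms in `λ₁₃` can be linear in the small elements or free of them, so `A₃` and `λ₁₃`
must both vanish. -/
theorem G2Eqs.of_small_vertex_lam {Q : Type*} [CommRing Q]
    {t1 t2 t3 t4 t12 t23 t34 t41 a1 a2 a3 a4 b12 b23 b34 b41 l13 l24 : Q} {ε : Set Q}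
    (hε : ∀ {x y}, x ∈ ε → y ∈ ε → x * y = 0)
    (m_t1 : t1 ∈ ε) (m_t2 : t2 ∈ ε) (m_t4 : t4 ∈ ε) (m_t23 : t23 ∈ ε) (m_t34 : t34 ∈ ε)
    (m_t41 : t41 ∈ ε) (m_b41 : b41 ∈ ε)
    (h_a3 : a3 = 0) (h_l13 : l13 = 0) (h_t12 : t12 = 0)
    (h23 : t2 * t3 = b23 * t23)
    (h34 : t3 * t4 = b34 * t34 + b41 * a1 * b12 ^ 2 * a2 * b23)
    (h341 : t3 * t41 = l24 * b12 * b23 * b34 * t4 + a1 * b12 ^ 2 * a2 * b23 * t1)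
    (h13 : t1 * t3 = b12 * a2 * b23 * t2 + l24 * b12 * b23 * b34 * b41)
    : G2Eqs t1 t2 t3 t4 t12 t23 t34 t41 a1 a2 a3 a4 b12 b23 b34 b41 l13 l24 := by
  subst h_a3 h_l13 h_t12
  exact
    { t1_t2 := by linear_combination (hε m_t1 m_t2)
      t2_t3 := by linear_combination h23 - a1 * a4 * b12 * b34 * (hε m_b41 m_b41)
      t3_t4 := by linear_combination h34
      t4_t1 := by linear_combination (hε m_t1 m_t4) - (hε m_t41 m_b41)
      t12_t23 := by linear_combination (-a2 * t2
        - b34 * b41 * l24) * (hε m_t2 m_t2)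
      t23_t34 := by linear_combination (hε m_t23 m_t34) + (-a1 * b12 ^ 2 * l24 * t3
        - a1 ^ 2 * a2 * a4 * b12 ^ 3 * b41) * (hε m_b41 m_b41)
      t34_t41 := by linear_combination (-a4 * t4
        - b12 * b23 * l24) * (hε m_t4 m_t4) + (hε m_t34 m_t41)
      t41_t12 := by linear_combination -a1 * t1 * (hε m_t1 m_t1)
      t1_t23 := by linear_combination (hε m_t1 m_t23) - a2 * b12 * (hε m_t2 m_t2)
        - b12 * b34 * l24 * (hε m_t2 m_b41)
      t2_t34 := by linear_combination (hε m_t2 m_t34)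
        - a1 * a4 * b12 * b41 * (hε m_t4 m_b41) - a1 * b12 ^ 2 * b23 * l24 * (hε m_b41 m_b41)
      t3_t41 := by linear_combination h341 - a4 * b34 * (hε m_t4 m_t4)
      t4_t12 := by linear_combination -a1 * b41 * (hε m_t1 m_t1)
      t3_t12 := by linear_combination -a2 * b23 * (hε m_t2 m_t2)
        - b23 * b34 * l24 * (hε m_t2 m_b41) - a1 * a4 * b34 * b41 * (hε m_t1 m_b41)
      t4_t23 := by linear_combination (hε m_t4 m_t23)
        - a1 * a2 * b12 ^ 2 * (hε m_t2 m_b41) - a1 * b12 ^ 2 * b34 * l24 * (hε m_b41 m_b41)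
      t1_t34 := by linear_combination (hε m_t1 m_t34) - a4 * b41 * (hε m_t4 m_t4)
        - b12 * b23 * l24 * (hε m_t4 m_b41)
      t2_t41 := by linear_combination (hε m_t2 m_t41) - a1 * b12 * (hε m_t1 m_t1)
      t1_t3 := by linear_combination h13 - a4 * b34 * (hε m_t4 m_b41)
      t2_t4 := by linear_combination (hε m_t2 m_t4) - a1 * b12 * (hε m_t1 m_b41)
      t12_t34 := by linear_combination -b23 * b41 * l24 * (hε m_t2 m_t4)
        - a1 * a4 * b41 ^ 2 * (hε m_t1 m_t4)
      t23_t41 := by linear_combination (hε m_t23 m_t41)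
        - b12 * b34 * l24 * (hε m_t2 m_t4) - a1 * a2 * b12 ^ 2 * (hε m_t1 m_t2) }

/-- The free direction is `θ₃₄`, which occurs linearly against `A₃₄`, `θ₄₁`, `θ₁` and `θ₂`; the tag
equations add `θ₁₂` and `θ₂₃`. That makes six gradients, one too many unless one of the first four
variables vanishes identically. -/
theorem G2Eqs.of_small_adjacent_edge {Q : Type*} [CommRing Q]
    {t1 t2 t3 t4 t12 t23 t34 t41 a1 a2 a3 a4 b12 b23 b34 b41 l13 l24 : Q} {ε : Set Q}
    (hε : ∀ {x y}, x ∈ ε → y ∈ ε → x * y = 0)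
    (m_t3 : t3 ∈ ε) (m_t4 : t4 ∈ ε) (m_a2 : a2 ∈ ε) (m_b41 : b41 ∈ ε)
    (h_b12 : b12 = 1) (h_b23 : b23 = 1) (h_t12 : t12 = 0) (h_t23 : t23 = 0) (h_b34 : b34 = 0)
    (h_t41 : t41 = 0) (h_t2 : t2 = 0) (h_t1 : t1 = 0)
    : G2Eqs t1 t2 t3 t4 t12 t23 t34 t41 a1 a2 a3 a4 b12 b23 b34 b41 l13 l24 := by
  subst h_b12 h_b23 h_t12 h_t23 h_b34 h_t41 h_t2 h_t1
  exact
    { t1_t2 := by ring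
      t2_t3 := by ring
      t3_t4 := by linear_combination (hε m_t3 m_t4) - a1 * (hε m_a2 m_b41)
      t4_t1 := by ring
      t12_t23 := by ring
      t23_t34 := by linear_combination (-a3 * t3 - b41 * l13) * (hε m_t3 m_t3)
        - a1 * b41 * l24 * (hε m_t3 m_b41) - a1 ^ 2 * a4 * b41 ^ 2 * (hε m_a2 m_b41)
      t34_t41 := by linear_combination (-a4 * t4 - l24) * (hε m_t4 m_t4)
        - l13 * (hε m_t4 m_a2) - a1 * a3 * (hε m_a2 m_a2)
      t41_t12 := by ring
      t1_t23 := by ring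
      t2_t34 := by linear_combination -a3 * (hε m_t3 m_t3) - l13 * (hε m_t3 m_b41)
        - a1 * a4 * b41 * (hε m_t4 m_b41) - a1 * l24 * (hε m_b41 m_b41)
      t3_t41 := by ring
      t4_t12 := by ring
      t3_t12 := by ring
      t4_t23 := by ring
      t1_t34 := by linear_combination -a4 * b41 * (hε m_t4 m_t4)
        - l24 * (hε m_t4 m_b41) - a3 * (hε m_t3 m_a2) - l13 * (hε m_a2 m_b41)
      t2_t41 := by ring
      t1_t3 := by ring
      t2_t4 := by ring
      t12_t34 := by ring
      t23_t41 := by ring }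

/-- The free direction is `θ₂`, with linear terms against `θ₃₄`, `θ₄₁`, `A₂` and `θ₄` besides the
two tags. The vanishing of `θ₄` reduces the six gradients to five. -/
theorem G2Eqs.of_small_adjacent_vertex {Q : Type*} [CommRing Q]
    {t1 t2 t3 t4 t12 t23 t34 t41 a1 a2 a3 a4 b12 b23 b34 b41 l13 l24 : Q} {ε : Set Q}
    (hε : ∀ {x y}, x ∈ ε → y ∈ ε → x * y = 0)
    (m_t1 : t1 ∈ ε) (m_t3 : t3 ∈ ε) (m_t12 : t12 ∈ ε) (m_t23 : t23 ∈ ε) (m_b34 : b34 ∈ ε)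
    (m_b41 : b41 ∈ ε)
    (h_b12 : b12 = 1) (h_b23 : b23 = 1) (h_t41 : t41 = 0) (h_t34 : t34 = 0) (h_a2 : a2 = 0)
    (h_t4 : t4 = 0)
    (h12 : t12 = t1 * t2)
    (h23 : t23 = t2 * t3)
    : G2Eqs t1 t2 t3 t4 t12 t23 t34 t41 a1 a2 a3 a4 b12 b23 b34 b41 l13 l24 := by
  subst h_b12 h_b23 h_t41 h_t34 h_a2 h_t4
  exact
    { t1_t2 := by linear_combination -h12 - a3 * a4 * b41 * (hε m_b34 m_b34)
      t2_t3 := by linear_combination -h23 - a1 * a4 * b41 * (hε m_b34 m_b41)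
      t3_t4 := by ring
      t4_t1 := by ring
      t12_t23 := by linear_combination (hε m_t12 m_t23)
        - l24 * t2 ^ 2 * (hε m_b34 m_b41) + (-a1 * a3 * a4 ^ 2 * b34 * b41 ^ 3
        - a4 * b41 ^ 2 * l13 * t2) * (hε m_b34 m_b34)
      t23_t34 := by linear_combination (-a3 * t3 - b41 * l13) * (hε m_t3 m_t3)
        - a1 * b41 * l24 * (hε m_t3 m_b41)
      t34_t41 := by ring
      t41_t12 := by linear_combination (-a1 * t1 - b34 * l13) * (hε m_t1 m_t1)
        - a3 * b34 * l24 * (hε m_t1 m_b34)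
      t1_t23 := by linear_combination (hε m_t1 m_t23)
        - l24 * t2 * (hε m_b34 m_b41) - a3 * a4 * b34 * b41 * (hε m_t3 m_b34)
        - a4 * b41 ^ 2 * l13 * (hε m_b34 m_b34)
      t2_t34 := by linear_combination -a3 * (hε m_t3 m_t3) - l13 * (hε m_t3 m_b41)
        - a1 * l24 * (hε m_b41 m_b41)
      t3_t41 := by ring
      t4_t12 := by linear_combination -a1 * b41 * (hε m_t1 m_t1)
        - b41 * l13 * (hε m_t1 m_b34) - a3 * b41 * l24 * (hε m_b34 m_b34)
      t3_t12 := by linear_combination (hε m_t3 m_t12)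
        - l24 * t2 * (hε m_b34 m_b41) - a1 * a4 * b41 ^ 2 * (hε m_t1 m_b34)
        - a4 * b41 ^ 2 * l13 * (hε m_b34 m_b34)
      t4_t23 := by linear_combination -a3 * b34 * (hε m_t3 m_t3)
        - b41 * l13 * (hε m_t3 m_b34) - a1 * b41 * l24 * (hε m_b34 m_b41)
      t1_t34 := by ring
      t2_t41 := by linear_combination -a1 * (hε m_t1 m_t1) - l13 * (hε m_t1 m_b34)
        - a3 * l24 * (hε m_b34 m_b34)
      t1_t3 := by linear_combination (hε m_t1 m_t3) - l24 * (hε m_b34 m_b41)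
      t2_t4 := by linear_combination -a3 * (hε m_t3 m_b34) - a1 * (hε m_t1 m_b41)
        - l13 * (hε m_b34 m_b41)
      t12_t34 := by linear_combination -b41 * l13 * (hε m_t1 m_t3)
        + b41 * l13 * l24 * (hε m_b34 m_b41)
      t23_t41 := by linear_combination -b34 * l13 * (hε m_t1 m_t3)
        + b41 * l13 * l24 * (hε m_b34 m_b34) }

/-! ### Components that cannot vanish identically. -/

section Loci

variable {φ : G2Var → MvPolynomial (Fin 10) ℂ}

theorem mem_erase_or_eq_zero {L : List G2Var} {v : G2Var} (hv : φ v = 0) {w : G2Var} (hw : w ∈ L) :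
    w ∈ L.erase v ∨ φ w = 0 := by
  by_cases h : w = v
  · exact Or.inr (h ▸ hv)
  · exact Or.inl ((List.mem_erase_of_ne h).2 hw)

theorem mem_span_map_of_mem_or {Z : List G2Var} {w : G2Var} (hw : w ∈ Z ∨ φ w = 0) :
    φ w ∈ Ideal.span {g | g ∈ Z.map φ} := by
  rcases hw with hw | hw
  · exact Ideal.subset_span (List.mem_map_of_mem hw)
  · simp [hw]

/-- If two opposite coefficients vanish at the origin then no cluster variable is identically
zero. -/
theorem ne_zero_of_opposite (hq : IsQuasismoothCone 6 (g2Ideal φ)) {v : G2Var}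
    (hv : v ∈ [.th 1, .th 2, .th 3, .th 4, .thE 1, .thE 2, .thE 3, .thE 4, .AE 2, .AE 4])
    (h0 : ∀ w ∈ [.th 1, .th 2, .th 3, .th 4, .thE 1, .thE 2, .thE 3, .thE 4, .AE 2, .AE 4],
      eval 0 (φ w) = 0) : φ v ≠ 0 := by
  intro hv0
  set L : List G2Var :=
    [.th 1, .th 2, .th 3, .th 4, .thE 1, .thE 2, .thE 3, .thE 4, .AE 2, .AE 4] with hL
  have hm : ∀ w, w ∈ L → w ∈ L.erase v ∨ φ w = 0 := fun w => mem_erase_or_eq_zero hv0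
  -- Ten functions could meet only at the vertex of `𝔸¹⁰`. Erasing the identically zero one leaves
  -- nine, so another common zero exists.
  refine not_isQuasismoothCone_g2Ideal (L.erase v) ?_ ?_ [φ (.thE 1), φ (.thE 3)] (by simp) ?_ ?_ hq
  · rw [List.length_erase_of_mem hv]
    decide
  · exact fun w hw => h0 w (List.mem_of_mem_erase hw)
  · simp only [List.forall_mem_cons, List.not_mem_nil, IsEmpty.forall_iff, implies_true, and_true]
    exact ⟨mem_span_map_of_mem_or (hm _ (by decide)), mem_span_map_of_mem_or (hm _ (by decide))⟩
  · intro J hJ hT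
    simp only [List.forall_mem_cons, List.not_mem_nil, IsEmpty.forall_iff, implies_true, and_true]
      at hT
    rw [g2Sat_iff]
    exact .of_small_opposite hJ ⟨_, hm _ (by decide), rfl⟩ ⟨_, hm _ (by decide), rfl⟩
      ⟨_, hm _ (by decide), rfl⟩ ⟨_, hm _ (by decide), rfl⟩ ⟨_, hm _ (by decide), rfl⟩
      ⟨_, hm _ (by decide), rfl⟩ ⟨_, hm _ (by decide), rfl⟩ ⟨_, hm _ (by decide), rfl⟩ hT.1 hT.2

theorem coeff_edge_ne_zero (hq : IsQuasismoothCone 6 (g2Ideal φ))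
    (h0 : ∀ w ∈ [.th 1, .th 2, .th 3, .th 4, .thE 2, .thE 3, .thE 4, .AE 2, .AE 4],
      eval 0 (φ w) = 0) : φ (.AE 1) ≠ 0 := by
  intro hv0
  refine not_isQuasismoothCone_g2Ideal _ (by simp) h0
    [φ (.thE 2), φ (.thE 3), φ (.thE 4), φ (.th 3), φ (.th 4)] (by simp) ?_ ?_ hq
  · simp only [List.forall_mem_cons, List.not_mem_nil, IsEmpty.forall_iff, implies_true, and_true]
    refine ⟨?_, ?_, ?_, ?_, ?_⟩ <;> exact mem_span_map_of_mem_or (.inl (by decide))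
  · intro J hJ hT
    simp only [List.forall_mem_cons, List.not_mem_nil, IsEmpty.forall_iff, implies_true, and_true]
      at hT
    obtain ⟨h1, h2, h3, h4, h5⟩ := hT
    rw [g2Sat_iff]
    exact .of_small_edge hJ ⟨_, .inl (by decide), rfl⟩ ⟨_, .inl (by decide), rfl⟩
      ⟨_, .inl (by decide), rfl⟩ ⟨_, .inl (by decide), rfl⟩ (by simp [hv0]) h1 h2 h3 h4 h5

theorem coeff_vertex_ne_zero (hq : IsQuasismoothCone 6 (g2Ideal φ))
    (h0 : ∀ w ∈ [.th 2, .th 3, .th 4, .thE 1, .thE 2, .thE 3, .thE 4, .AE 2, .AE 3],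
      eval 0 (φ w) = 0) : φ (.A 1) ≠ 0 := by
  intro hv0
  refine not_isQuasismoothCone_g2Ideal _ (by simp) h0
    [φ (.th 1) * φ (.th 2) - φ (.AE 1) * φ (.thE 1), φ (.th 1) * φ (.th 4) - φ (.AE 4) * φ (.thE 4),
      φ (.th 3), φ (.thE 2), φ (.thE 3)] (by simp) ?_ ?_ hq
  · simp only [List.forall_mem_cons, List.not_mem_nil, IsEmpty.forall_iff, implies_true, and_true]
    refine ⟨sub_mem (Ideal.mul_mem_left _ _ ?_) (Ideal.mul_mem_left _ _ ?_),
      sub_mem (Ideal.mul_mem_left _ _ ?_) (Ideal.mul_mem_left _ _ ?_), ?_, ?_, ?_⟩ <;>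
    exact mem_span_map_of_mem_or (.inl (by decide))
  · intro J hJ hT
    simp only [List.forall_mem_cons, List.not_mem_nil, IsEmpty.forall_iff, implies_true, and_true,
      map_sub, map_mul, sub_eq_zero] at hT
    obtain ⟨h1, h2, h3, h4, h5⟩ := hT
    rw [g2Sat_iff]
    exact .of_small_vertex hJ ⟨_, .inl (by decide), rfl⟩ ⟨_, .inl (by decide), rfl⟩
      ⟨_, .inl (by decide), rfl⟩ ⟨_, .inl (by decide), rfl⟩ ⟨_, .inl (by decide), rfl⟩
      ⟨_, .inl (by decide), rfl⟩ (by simp [hv0]) h3 h4 h5 h1 h2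

theorem coeff_vertex_or_lam_ne_zero (hq : IsQuasismoothCone 6 (g2Ideal φ))
    (h0 : ∀ w ∈ [.th 1, .th 2, .th 4, .thE 1, .thE 2, .thE 3, .thE 4, .AE 4],
      eval 0 (φ w) = 0) (hA : φ (.A 3) = 0) : φ (.lam 1) ≠ 0 := by
  intro hl
  refine not_isQuasismoothCone_g2Ideal _ (by simp) h0
    [φ (.th 2) * φ (.th 3) - φ (.AE 2) * φ (.thE 2),
      φ (.th 3) * φ (.th 4) - (φ (.AE 3) * φ (.thE 3) +
        φ (.AE 4) * φ (.A 1) * φ (.AE 1) ^ 2 * φ (.A 2) * φ (.AE 2)),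
      φ (.thE 1),
      φ (.th 3) * φ (.thE 4) - (φ (.lam 0) * φ (.AE 1) * φ (.AE 2) * φ (.AE 3) * φ (.th 4) +
        φ (.A 1) * φ (.AE 1) ^ 2 * φ (.A 2) * φ (.AE 2) * φ (.th 1)),
      φ (.th 1) * φ (.th 3) - (φ (.AE 1) * φ (.A 2) * φ (.AE 2) * φ (.th 2) +
        φ (.lam 0) * φ (.AE 1) * φ (.AE 2) * φ (.AE 3) * φ (.AE 4))] (by simp) ?_ ?_ hq
  · have hm : ∀ w ∈ [G2Var.th 1, .th 2, .th 4, .thE 1, .thE 2, .thE 3, .thE 4, .AE 4],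
        φ w ∈ Ideal.span {g | g ∈ List.map φ
          [.th 1, .th 2, .th 4, .thE 1, .thE 2, .thE 3, .thE 4, .AE 4]} :=
      fun w hw => mem_span_map_of_mem_or (.inl hw)
    simp only [List.forall_mem_cons, List.not_mem_nil, IsEmpty.forall_iff, implies_true, and_true]
      at hm ⊢
    obtain ⟨m1, m2, m4, m12, m23, m34, m41, b41⟩ := hm
    exact ⟨sub_mem (Ideal.mul_mem_right _ _ m2) (Ideal.mul_mem_left _ _ m23),
      sub_mem (Ideal.mul_mem_left _ _ m4) (add_mem (Ideal.mul_mem_left _ _ m34)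
        (Ideal.mul_mem_right _ _ (Ideal.mul_mem_right _ _ (Ideal.mul_mem_right _ _
          (Ideal.mul_mem_right _ _ b41))))), m12,
      sub_mem (Ideal.mul_mem_left _ _ m41) (add_mem (Ideal.mul_mem_left _ _ m4)
        (Ideal.mul_mem_left _ _ m1)),
      sub_mem (Ideal.mul_mem_right _ _ m1) (add_mem (Ideal.mul_mem_left _ _ m2)
        (Ideal.mul_mem_left _ _ b41))⟩
  · intro J hJ hT
    simp only [List.forall_mem_cons, List.not_mem_nil, IsEmpty.forall_iff, implies_true, and_true,
      map_sub, map_mul, map_add, map_pow, sub_eq_zero] at hT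
    obtain ⟨h1, h2, h3, h4, h5⟩ := hT
    rw [g2Sat_iff]
    exact .of_small_vertex_lam hJ ⟨_, .inl (by decide), rfl⟩ ⟨_, .inl (by decide), rfl⟩
      ⟨_, .inl (by decide), rfl⟩ ⟨_, .inl (by decide), rfl⟩ ⟨_, .inl (by decide), rfl⟩
      ⟨_, .inl (by decide), rfl⟩ ⟨_, .inl (by decide), rfl⟩ (by simp [hA]) (by simp [hl]) h3 h1 h2
      h4 h5

/-- If two adjacent coefficients are `1` and the `C₂` format does not degenerate, then some of the
variables are not identically zero. -/
theorem ne_zero_of_adjacent_edge (hq : IsQuasismoothCone 6 (g2Ideal φ))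
    (h1 : φ (.AE 1) = 1) (h2 : φ (.AE 2) = 1) {v : G2Var}
    (hv : v ∈ [.th 1, .th 2, .thE 4, .AE 3])
    (h0 : ∀ w ∈ [.th 1, .th 2, .th 3, .th 4, .thE 1, .thE 2, .thE 4, .A 2, .AE 3, .AE 4],
      eval 0 (φ w) = 0) : φ v ≠ 0 := by
  intro hv0
  set L : List G2Var :=
    [.th 1, .th 2, .th 3, .th 4, .thE 1, .thE 2, .thE 4, .A 2, .AE 3, .AE 4] with hL
  set L' : List G2Var := [.thE 1, .thE 2, .AE 3, .thE 4, .th 2, .th 1] with hL'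
  have hm : ∀ w, w ∈ L → w ∈ L.erase v ∨ φ w = 0 := fun w => mem_erase_or_eq_zero hv0
  have hvL' : v ∈ L' := (by decide : ∀ w ∈ [G2Var.th 1, .th 2, .thE 4, .AE 3],
    w ∈ [G2Var.thE 1, .thE 2, .AE 3, .thE 4, .th 2, .th 1]) v hv
  have hsub : ∀ w ∈ L', w ∈ L := by rw [hL, hL']; decide
  have hvL : v ∈ L := hsub v hvL'
  -- Erasing `v` serves both counts: the ten functions become nine and the six gradients become
  -- five.
  refine not_isQuasismoothCone_g2Ideal (L.erase v) ?_ ?_ ((L'.erase v).map φ) ?_ ?_ ?_ hq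
  · rw [List.length_erase_of_mem hvL]
    decide
  · exact fun w hw => h0 w (List.mem_of_mem_erase hw)
  · rw [List.length_map, List.length_erase_of_mem hvL']
    decide
  · intro f hf
    obtain ⟨w, hw, rfl⟩ := List.mem_map.1 hf
    exact mem_span_map_of_mem_or (hm w (hsub w (List.mem_of_mem_erase hw)))
  · intro J hJ hT
    have hT' : ∀ w ∈ L', Ideal.Quotient.mk J (φ w) = 0 := by
      intro w hw
      rcases mem_erase_or_eq_zero hv0 hw with h | h
      · exact hT _ (List.mem_map_of_mem h)
      · simp [h]
    rw [g2Sat_iff]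
    exact .of_small_adjacent_edge hJ ⟨_, hm _ (by decide), rfl⟩ ⟨_, hm _ (by decide), rfl⟩
      ⟨_, hm _ (by decide), rfl⟩ ⟨_, hm _ (by decide), rfl⟩ (by simp [h1]) (by simp [h2])
      (hT' _ (by decide)) (hT' _ (by decide)) (hT' _ (by decide)) (hT' _ (by decide))
      (hT' _ (by decide)) (hT' _ (by decide))

theorem ne_zero_of_adjacent_vertex (hq : IsQuasismoothCone 6 (g2Ideal φ))
    (h1 : φ (.AE 1) = 1) (h2 : φ (.AE 2) = 1)
    (h0 : ∀ w ∈ [.th 1, .th 3, .thE 1, .thE 2, .thE 3, .thE 4, .A 2, .AE 3, .AE 4],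
      eval 0 (φ w) = 0) : φ (.th 4) ≠ 0 := by
  intro hv0
  refine not_isQuasismoothCone_g2Ideal _ (by simp) h0
    [φ (.thE 1) - φ (.th 1) * φ (.th 2), φ (.thE 2) - φ (.th 2) * φ (.th 3), φ (.thE 4),
      φ (.thE 3), φ (.A 2)] (by simp) ?_ ?_ hq
  · simp only [List.forall_mem_cons, List.not_mem_nil, IsEmpty.forall_iff, implies_true, and_true]
    refine ⟨sub_mem ?_ (Ideal.mul_mem_right _ _ ?_),
      sub_mem ?_ (Ideal.mul_mem_left _ _ ?_), ?_, ?_, ?_⟩ <;>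
    exact mem_span_map_of_mem_or (.inl (by decide))
  · intro J hJ hT
    simp only [List.forall_mem_cons, List.not_mem_nil, IsEmpty.forall_iff, implies_true, and_true,
      map_sub, map_mul, sub_eq_zero] at hT
    obtain ⟨e1, e2, e3, e4, e5⟩ := hT
    rw [g2Sat_iff]
    exact .of_small_adjacent_vertex hJ ⟨_, .inl (by decide), rfl⟩ ⟨_, .inl (by decide), rfl⟩
      ⟨_, .inl (by decide), rfl⟩ ⟨_, .inl (by decide), rfl⟩ ⟨_, .inl (by decide), rfl⟩
      ⟨_, .inl (by decide), rfl⟩ (by simp [h1]) (by simp [h2]) e3 e4 e5 (by simp [hv0]) e1 e2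

end Loci

/-! ### Pfaffian formats -/

section Pfaffians

variable {R : Type*} [CommRing R] {M : Matrix (Fin 5) (Fin 5) R}

theorem sum_mul_pf4 (h0 : ∀ a, M a a = 0) (hs : ∀ a b, M b a = -M a b) (a : Fin 5) :
    ∑ b, M a b * pf4 M b = 0 := by
  fin_cases a <;>
    simp only [pf4, Fin.sum_univ_five, Matrix.cons_val, Matrix.cons_val_zero, Matrix.cons_val_one,
      Fin.isValue, Fin.zero_eta, Fin.mk_one, Fin.reduceFinMk, h0, hs 0 1, hs 0 2, hs 0 3, hs 0 4,
      hs 1 2, hs 1 3, hs 1 4, hs 2 3, hs 2 4, hs 3 4] <;>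
    ring

/-- Row `a` of the syzygy `M · Pf = 0` expresses `M a b` times the Pfaffian with index `b` through
the others. The one with index `a` does not occur, because the diagonal is zero. -/
theorem pf4_mem_of_isUnit (h0 : ∀ a, M a a = 0) (hs : ∀ a b, M b a = -M a b) {a b : Fin 5}
    (hu : IsUnit (M a b)) {J : Ideal R} (hJ : ∀ k, k ≠ a → k ≠ b → pf4 M k ∈ J) :
    pf4 M b ∈ J := by
  rw [← Ideal.unit_mul_mem_iff_mem J hu]
  have h := sum_mul_pf4 h0 hs a
  rw [← Finset.add_sum_erase _ _ (Finset.mem_univ b)] at h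
  rw [eq_neg_of_add_eq_zero_left h]
  refine neg_mem (sum_mem fun k hk => ?_)
  by_cases hka : k = a
  · simp [hka, h0]
  · exact J.mul_mem_left _ (hJ k hka (Finset.ne_of_mem_erase hk))

theorem pf4Ideal_le_of_isUnit (h0 : ∀ a, M a a = 0) (hs : ∀ a b, M b a = -M a b) {a b : Fin 5}
    (hu : IsUnit (M a b)) {J : Ideal R} (hJ : ∀ k, k ≠ a → k ≠ b → pf4 M k ∈ J) :
    pf4Ideal M ≤ J := by
  rw [pf4Ideal_eq, Ideal.span_le]
  rintro _ ⟨k, rfl⟩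
  by_cases ha : k = a
  · subst ha
    refine pf4_mem_of_isUnit h0 hs (a := b) ?_ fun l h1 h2 => hJ l h2 h1
    rw [hs k b]
    exact hu.neg
  · by_cases hb : k = b
    · subst hb
      exact pf4_mem_of_isUnit h0 hs hu hJ
    · exact hJ k ha hb

theorem fin5_cases (a : Fin 5) : a = 0 ∨ a = 1 ∨ a = 2 ∨ a = 3 ∨ a = 4 := by revert a; decide

/-- If neither `a` nor `b` is omitted, each monomial of the Pfaffian either contains the entry `M a
b` or pairs an entry of row `a` with one of row `b`. -/
theorem pf4_eq_zero_of_mul_eq_zero (hs : ∀ a b, M b a = -M a b) {a b : Fin 5} (hab : a ≠ b)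
    (hz : M a b = 0) (h : ∀ c d, M a c * M b d = 0) {k : Fin 5} (hka : k ≠ a) (hkb : k ≠ b) :
    pf4 M k = 0 := by
  have hz' : M b a = 0 := by rw [hs, hz, neg_zero]
  have h1 : ∀ c d, M a c * M d b = 0 := fun c d => by rw [hs b d, mul_neg, h, neg_zero]
  have h2 : ∀ c d, M c a * M b d = 0 := fun c d => by rw [hs a c, neg_mul, h, neg_zero]
  have h3 : ∀ c d, M c a * M d b = 0 := fun c d => by rw [hs a c, neg_mul, h1, neg_zero]
  have h' : ∀ c d, M b c * M a d = 0 := fun c d => by rw [mul_comm, h]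
  have h1' : ∀ c d, M b c * M d a = 0 := fun c d => by rw [mul_comm, h2]
  have h2' : ∀ c d, M c b * M a d = 0 := fun c d => by rw [mul_comm, h1]
  have h3' : ∀ c d, M c b * M d a = 0 := fun c d => by rw [mul_comm, h3]
  clear hs
  rcases fin5_cases a with rfl | rfl | rfl | rfl | rfl <;>
    rcases fin5_cases b with rfl | rfl | rfl | rfl | rfl <;> first | exact absurd rfl hab | skip
  all_goals
    rcases fin5_cases k with rfl | rfl | rfl | rfl | rfl <;> first
      | exact absurd rfl hka
      | exact absurd rfl hkb
      | simp only [pf4, Fin.isValue, Matrix.cons_val, Matrix.cons_val_zero, Matrix.cons_val_one,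
          hz, hz', h, h1, h2, h3, h', h1', h2', h3', zero_mul, mul_zero, sub_zero, add_zero,
          neg_zero]

/-- Every monomial of a Pfaffian that does not omit `b` contains an entry of row or column `b`. -/
theorem pf4_eq_zero_of_row_eq_zero (hs : ∀ a b, M b a = -M a b) {b : Fin 5}
    (h : ∀ c, M b c = 0) {k : Fin 5} (hkb : k ≠ b) : pf4 M k = 0 := by
  have h' : ∀ c, M c b = 0 := fun c => by rw [hs b c, h, neg_zero]
  clear hs
  rcases fin5_cases b with rfl | rfl | rfl | rfl | rfl <;>
    rcases fin5_cases k with rfl | rfl | rfl | rfl | rfl <;> first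
      | exact absurd rfl hkb
      | simp only [pf4, Fin.isValue, Matrix.cons_val, Matrix.cons_val_zero, Matrix.cons_val_one,
          h, h', zero_mul, mul_zero, sub_zero, add_zero, neg_zero]

theorem map_pf4 {Q : Type*} [CommRing Q] (f : R →+* Q) (M : Matrix (Fin 5) (Fin 5) R) (k : Fin 5) :
    f (pf4 M k) = pf4 (M.map f) k := by
  fin_cases k <;> simp [pf4]

theorem pf4_mem_of_eq_zero (hs : ∀ a b, M b a = -M a b) {a b : Fin 5} (hab : a ≠ b)
    (hz : M a b = 0) {J : Ideal R}
    (hJ : ∀ c d, M a c * M b d ∈ J) {k : Fin 5} (hka : k ≠ a) (hkb : k ≠ b) : pf4 M k ∈ J := by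
  rw [← Ideal.Quotient.eq_zero_iff_mem, map_pf4]
  refine pf4_eq_zero_of_mul_eq_zero (fun a b => ?_) hab ?_ (fun c d => ?_) hka hkb
  · simp [hs a b]
  · simp [hz]
  · rw [Matrix.map_apply, Matrix.map_apply, ← map_mul, Ideal.Quotient.eq_zero_iff_mem]
    exact hJ c d

theorem pf4_mem_of_row_mem (hs : ∀ a b, M b a = -M a b) {b : Fin 5} {J : Ideal R}
    (hJ : ∀ c, M b c ∈ J) {k : Fin 5} (hkb : k ≠ b) : pf4 M k ∈ J := by
  rw [← Ideal.Quotient.eq_zero_iff_mem, map_pf4]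
  refine pf4_eq_zero_of_row_eq_zero (fun a b => ?_) (fun c => ?_) hkb
  · simp [hs a b]
  · rw [Matrix.map_apply, Ideal.Quotient.eq_zero_iff_mem]
    exact hJ c

theorem isCompleteIntersection_of_list {m c : ℕ} {I : Ideal (MvPolynomial (Fin m) ℂ)}
    (hI : I.height = c) (L : List (MvPolynomial (Fin m) ℂ)) (hL : L.length = c)
    (h : I = Ideal.span {f | f ∈ L}) : IsCompleteIntersection c I := by
  refine ⟨hI, fun i => L.get (i.cast hL.symm), ?_⟩
  rw [h]
  congr 1
  ext f
  subst hL
  simp [List.mem_iff_get]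

/-- A Pfaffian format with an entry which is a unit is a complete intersection. -/
theorem isCompleteIntersection_of_pf4Ideal {I : Ideal (MvPolynomial (Fin 10) ℂ)}
    {M : Matrix (Fin 5) (Fin 5) (MvPolynomial (Fin 10) ℂ)} (h0 : ∀ a, M a a = 0)
    (hs : ∀ a b, M b a = -M a b) (T : List (MvPolynomial (Fin 10) ℂ)) (hT : T.length = 3)
    (hI : I = Ideal.span {f | f ∈ T} ⊔ pf4Ideal M) (hht : I.height = 6) {a b : Fin 5} (hab : a ≠ b)
    (hu : IsUnit (M a b)) : IsCompleteIntersection 6 I := by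
  have hlen : ((List.finRange 5).filter fun k => k ≠ a ∧ k ≠ b).length = 3 := by
    clear hu
    revert a b
    decide
  refine isCompleteIntersection_of_list hht
    (T ++ ((List.finRange 5).filter fun k => k ≠ a ∧ k ≠ b).map (pf4 M)) ?_ ?_
  · rw [List.length_append, List.length_map, hlen, hT]
  · rw [hI]
    refine le_antisymm (sup_le (Ideal.span_mono fun f hf => ?_) ?_) (Ideal.span_le.2 ?_)
    · exact List.mem_append_left _ hf
    · refine pf4Ideal_le_of_isUnit h0 hs hu fun k hka hkb => Ideal.subset_span ?_
      exact List.mem_append_right _ (List.mem_map_of_mem (by simp [hka, hkb]))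
    · intro f hf
      rcases List.mem_append.1 hf with hf | hf
      · exact Ideal.mem_sup_left (Ideal.subset_span hf)
      · obtain ⟨k, _, rfl⟩ := List.mem_map.1 hf
        rw [pf4Ideal_eq]
        exact Ideal.mem_sup_right (Ideal.subset_span ⟨k, rfl⟩)

/-- The entries of the matrix of a quasismooth Pfaffian format are not identically zero. -/
theorem pf4Ideal_entry_ne_zero {I : Ideal (MvPolynomial (Fin 10) ℂ)}
    {M : Matrix (Fin 5) (Fin 5) (MvPolynomial (Fin 10) ℂ)}
    (hs : ∀ a b, M b a = -M a b) (T : List (MvPolynomial (Fin 10) ℂ)) (hT : T.length = 3)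
    (hI : I = Ideal.span {f | f ∈ T} ⊔ pf4Ideal M) (hq : IsQuasismoothCone 6 I)
    (hT0 : ∀ f ∈ T, eval 0 f = 0) (hM0 : ∀ a b, eval 0 (M a b) = 0) {a b : Fin 5} (hab : a ≠ b) :
    M a b ≠ 0 := by
  intro hz
  set K := (List.finRange 5).filter fun k => k ≠ a ∧ k ≠ b with hK
  have hlen : K.length = 3 := by
    clear hz
    revert a b
    decide
  -- These are nine functions: the three in `T` and the three remaining entries of each of the rows
  -- `a` and `b`. The Pfaffians with index outside `{a, b}` are quadratic in these entries, so only
  -- `T` and two Pfaffians, five functions in all, contribute gradients.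
  set Z := T ++ (K.map (M a) ++ K.map (M b)) with hZ
  have hKk : ∀ k, k ≠ a → k ≠ b → k ∈ K := fun k h1 h2 => by simp [hK, h1, h2]
  have hZa : ∀ k, k ≠ a → k ≠ b → M a k ∈ Z := fun k h1 h2 =>
    List.mem_append_right _ (List.mem_append_left _ (List.mem_map_of_mem (hKk k h1 h2)))
  have hZb : ∀ k, k ≠ a → k ≠ b → M b k ∈ Z := fun k h1 h2 =>
    List.mem_append_right _ (List.mem_append_right _ (List.mem_map_of_mem (hKk k h1 h2)))
  have hdiag : ∀ a, M a a = 0 := fun a => self_eq_neg.1 (hs a a)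
  have hz' : M b a = 0 := by rw [hs, hz, neg_zero]
  refine not_isQuasismoothCone_of_le Z (T ++ [pf4 M a, pf4 M b]) ?_ ?_ ?_ ?_ ?_ hq
  · simp [hZ, hlen, hT]
  · intro f hf
    rcases List.mem_append.1 hf with hf | hf
    · exact hT0 f hf
    · rcases List.mem_append.1 hf with hf | hf <;> obtain ⟨k, _, rfl⟩ := List.mem_map.1 hf <;>
        exact hM0 _ _
  · simp [hT]
  · have hMa : ∀ k, M a k ∈ Ideal.span {g | g ∈ Z} := fun k => by
      by_cases h1 : k = a
      · simp [h1, hdiag]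
      · by_cases h2 : k = b
        · simp [h2, hz]
        · exact Ideal.subset_span (hZa k h1 h2)
    have hMb : ∀ k, M b k ∈ Ideal.span {g | g ∈ Z} := fun k => by
      by_cases h1 : k = a
      · simp [h1, hz']
      · by_cases h2 : k = b
        · simp [h2, hdiag]
        · exact Ideal.subset_span (hZb k h1 h2)
    intro f hf
    rcases List.mem_append.1 hf with hf | hf
    · exact Ideal.subset_span (List.mem_append_left _ hf)
    · simp only [List.mem_cons, List.not_mem_nil, or_false] at hf
      rcases hf with rfl | rfl
      · exact pf4_mem_of_row_mem hs hMb hab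
      · exact pf4_mem_of_row_mem hs hMa hab.symm
  · intro J hJ hTJ
    rw [hI]
    refine sup_le (Ideal.span_le.2 fun f hf => hTJ f (List.mem_append_left _ hf)) ?_
    rw [pf4Ideal_eq, Ideal.span_le]
    rintro _ ⟨k, rfl⟩
    by_cases ha : k = a
    · subst ha
      exact hTJ _ (List.mem_append_right _ (by simp))
    · by_cases hb : k = b
      · subst hb
        exact hTJ _ (List.mem_append_right _ (by simp))
      · refine pf4_mem_of_eq_zero hs hab hz (fun c d => ?_) ha hb
        by_cases h1 : c = a
        · simp [h1, hdiag]
        by_cases h2 : c = b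
        · simp [h2, hz]
        by_cases h3 : d = a
        · simp [h3, hz']
        by_cases h4 : d = b
        · simp [h4, hdiag]
        exact hJ _ (hZa c h1 h2) _ (hZb d h3 h4)

end Pfaffians

/-! ### Degrees -/

theorem relabel_r_thE (a i : ZMod 4) : (G2Var.thE i).relabel (.r a) = .thE (i + a) := by
  have : ∀ a i : ZMod 4, polyEdge (i + a) (i + 1 + a) = i + a := by decide
  simp [G2Var.relabel, dihVertex, this]

theorem relabel_r_AE (a i : ZMod 4) : (G2Var.AE i).relabel (.r a) = .AE (i + a) := by
  have : ∀ a i : ZMod 4, polyEdge (i + a) (i + 1 + a) = i + a := by decide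
  simp [G2Var.relabel, dihVertex, this]

theorem relabel_sr_thE (a i : ZMod 4) : (G2Var.thE i).relabel (.sr a) = .thE (a - i - 1) := by
  have : ∀ a i : ZMod 4, polyEdge (a - i) (a - (i + 1)) = a - i - 1 := by decide
  simp only [G2Var.relabel, dihVertex, this]

theorem relabel_sr_AE (a i : ZMod 4) : (G2Var.AE i).relabel (.sr a) = .AE (a - i - 1) := by
  have : ∀ a i : ZMod 4, polyEdge (a - i) (a - (i + 1)) = a - i - 1 := by decide
  simp only [G2Var.relabel, dihVertex, this]

theorem zmod4_sum (f : ZMod 4 → ℤ) : f 1 + f 2 + f 3 + f 4 = ∑ i, f i := by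
  have h : ∑ i, f i = f 0 + f 1 + f 2 + f 3 := Fin.sum_univ_four f
  rw [h, show (4 : ZMod 4) = 0 from rfl]
  ring

theorem diagVertex_sum (f : ZMod 4 → ℤ) (i : ZMod 4) :
    f (diagVertex (diagThrough i)) + f (diagVertex (diagThrough i) + 2) = f i + f (i + 2) := by
  have h : ∀ i : ZMod 4, (diagVertex (diagThrough i) = i ∧ diagVertex (diagThrough i) + 2 = i + 2) ∨
      (diagVertex (diagThrough i) = i + 2 ∧ diagVertex (diagThrough i) + 2 = i) := by decide
  rcases h i with ⟨h1, h2⟩ | ⟨h1, h2⟩ <;> rw [h2, h1]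
  ring

/-- The relabelled degrees come from a cocharacter again. This lets every sign statement be proved
in one position of the square and transported by symmetry. -/
theorem g2Degree_relabel (r s : ZMod 4 → ℤ) (g : DihedralGroup 4) :
    ∃ r' s' : ZMod 4 → ℤ, ∀ v, g2Degree r' s' v = g2Degree r s (v.relabel g) := by
  have hlam : ∀ (r s : ZMod 4 → ℤ) (p : ZMod 2), g2Degree r s (.lam p) =
      ∑ i, s i - ∑ i, r i - (r (diagVertex p) + r (diagVertex p + 2)) := by
    intro r s p
    rw [← zmod4_sum, ← zmod4_sum]
    simp only [g2Degree]
    ring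
  rcases g with a | a
  · refine ⟨fun i => r (i + a), fun i => s (i + a), fun v => ?_⟩
    rcases v with i | i | i | i | p
    · rfl
    · rw [relabel_r_thE]; rfl
    · simp only [g2Degree, G2Var.relabel, dihVertex, sub_add_eq_add_sub]
    · rw [relabel_r_AE]
      simp only [g2Degree]
      rw [add_right_comm]
    · rw [G2Var.relabel, hlam, hlam, diagVertex_sum]
      simp only [dihVertex]
      have h1 : ∑ i, s (i + a) = ∑ i, s i := Equiv.sum_comp (Equiv.addRight a) s
      have h2 : ∑ i, r (i + a) = ∑ i, r i := Equiv.sum_comp (Equiv.addRight a) r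
      rw [h1, h2, add_right_comm _ (2 : ZMod 4)]
  · refine ⟨fun i => r (a - i), fun i => s (a - i - 1), fun v => ?_⟩
    rcases v with i | i | i | i | p
    · rfl
    · rw [relabel_sr_thE]; rfl
    · simp only [g2Degree, G2Var.relabel, dihVertex]
      rw [show a - (i - 1) - 1 = a - i by ring]
      ring
    · rw [relabel_sr_AE]
      simp only [g2Degree]
      rw [show a - (i + 1) = a - i - 1 by ring, show a - i - 1 + 1 = a - i by ring]
      ring
    · rw [G2Var.relabel, hlam, hlam, diagVertex_sum]
      simp only [dihVertex]
      have h1 : ∑ i, s (a - i - 1) = ∑ i, s i := by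
        simp_rw [sub_right_comm a _ 1]
        exact Equiv.sum_comp (Equiv.subLeft (a - 1)) s
      have h2 : ∑ i, r (a - i) = ∑ i, r i := Equiv.sum_comp (Equiv.subLeft a) r
      have h3 : a - (diagVertex p + 2) = a - diagVertex p + 2 := by
        rw [sub_add_eq_sub_sub, sub_eq_add_neg _ (2 : ZMod 4)]; rfl
      rw [h1, h2, h3]

/-- A regular pullback in `G₂` format which is quasismooth and not a complete intersection. -/
structure IsG2Format (w : Fin 10 → ℕ) (r s : ZMod 4 → ℤ) (φ : G2Var → MvPolynomial (Fin 10) ℂ) :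
    Prop extends IsG2RegularPullback w r s φ where
  quasismooth : IsQuasismoothCone 6 (g2Ideal φ)
  not_ci : ¬ IsCompleteIntersection 6 (g2Ideal φ)

/-! ### Signs of degrees of homogeneous polynomials. -/

section Homogeneous

variable {w : Fin 10 → ℕ}

theorem weightedHomogeneous_isUnit_or (hw : ∀ i, 0 < w i) {f : MvPolynomial (Fin 10) ℂ} {d : ℤ}
    (hf : IsWeightedHomogeneous (fun i => (w i : ℤ)) f d) : IsUnit f ∨ eval 0 f = 0 := by
  by_cases h : eval 0 f = 0
  · exact .inr h
  · rcases weightedHomogeneous_trichotomy hw hf with ⟨_, h'⟩ | ⟨_, h'⟩ | ⟨_, h'⟩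
    · exact absurd (by simp [h']) h
    · exact .inl (h' ▸ (IsUnit.mk0 _ h).map C)
    · exact absurd h' h

theorem weightedHomogeneous_nonneg (hw : ∀ i, 0 < w i) {f : MvPolynomial (Fin 10) ℂ} {d : ℤ}
    (hf : IsWeightedHomogeneous (fun i => (w i : ℤ)) f d) (h0 : f ≠ 0) : 0 ≤ d := by
  rcases weightedHomogeneous_trichotomy hw hf with ⟨_, h'⟩ | ⟨h, _⟩ | ⟨h, _⟩
  · exact absurd h' h0
  · exact h.ge
  · exact h.le

theorem weightedHomogeneous_pos (hw : ∀ i, 0 < w i) {f : MvPolynomial (Fin 10) ℂ} {d : ℤ}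
    (hf : IsWeightedHomogeneous (fun i => (w i : ℤ)) f d) (h0 : f ≠ 0 ∧ eval 0 f = 0) : 0 < d := by
  rcases weightedHomogeneous_trichotomy hw hf with ⟨_, h'⟩ | ⟨_, h'⟩ | ⟨h, _⟩
  · exact absurd h' h0.1
  · exact absurd (by rw [h', h0.2, C_0]) h0.1
  · exact h

end Homogeneous

/-! ### Regular pullbacks: symmetry and normalisation. -/

namespace IsG2RegularPullback

variable {w : Fin 10 → ℕ} {r s : ZMod 4 → ℤ} {φ : G2Var → MvPolynomial (Fin 10) ℂ}

/-- This is where the convention on degree zero is used: a component of degree zero is a non-zero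
constant, so vanishing at the vertex is a condition on the degree alone. -/
theorem eval_eq_zero_iff (H : IsG2RegularPullback w r s φ) (v : G2Var) :
    eval 0 (φ v) = 0 ↔ g2Degree r s v ≠ 0 := by
  constructor
  · intro h hd
    have h0 := H.ne_zero_of_degree_zero v hd
    exact (weightedHomogeneous_pos H.weight_pos (H.graded v) ⟨h0, h⟩).ne' hd
  · intro hd
    rcases weightedHomogeneous_trichotomy H.weight_pos (H.graded v) with ⟨_, h'⟩ | ⟨h, _⟩ | ⟨_, h⟩
    · simp [h']
    · exact absurd h hd
    · exact h

theorem isUnit (H : IsG2RegularPullback w r s φ) {v : G2Var} (hv : g2Degree r s v = 0) :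
    IsUnit (φ v) :=
  (weightedHomogeneous_isUnit_or H.weight_pos (H.graded v)).resolve_right fun h =>
    (H.eval_eq_zero_iff v).1 h hv

theorem eq_zero (H : IsG2RegularPullback w r s φ) {v : G2Var} (hv : g2Degree r s v < 0) :
    φ v = 0 := by
  by_contra h
  exact hv.not_ge (weightedHomogeneous_nonneg H.weight_pos (H.graded v) h)

theorem relabel (H : IsG2RegularPullback w r s φ) (g : DihedralGroup 4) {r' s' : ZMod 4 → ℤ}
    (h : ∀ v, g2Degree r' s' v = g2Degree r s (v.relabel g)) :
    IsG2RegularPullback w r' s' fun v => φ (v.relabel g) where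
  weight_pos := H.weight_pos
  graded v := by rw [h]; exact H.graded _
  ne_zero_of_degree_zero v hv := H.ne_zero_of_degree_zero _ (h v ▸ hv)
  codim := by rw [g2Ideal_relabel]; exact H.codim

theorem torusAct (H : IsG2RegularPullback w r s φ) (u : ZMod 4 → ℂˣ) :
    IsG2RegularPullback w r s (torusAct 1 u φ) where
  weight_pos := H.weight_pos
  graded v := (H.graded v).C_mul _
  ne_zero_of_degree_zero v hv :=
    mul_ne_zero (C_ne_zero.2 (Units.ne_zero _)) (H.ne_zero_of_degree_zero v hv)
  codim := by rw [g2Ideal_torusAct]; exact H.codim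

/-- The constant coefficients `A_{ij}` can be normalised to `1` by the torus. -/
theorem exists_torusAct_eq_one (H : IsG2RegularPullback w r s φ) :
    ∃ u : ZMod 4 → ℂˣ, ∀ i, g2Degree r s (.AE i) = 0 → _root_.torusAct 1 u φ (.AE i) = 1 := by
  have hne : ∀ i, g2Degree r s (.AE i) = 0 → eval 0 (φ (.AE i)) ≠ 0 := fun i hi h =>
    (H.eval_eq_zero_iff _).1 h hi
  -- With `t = 1` the character of `A_{i,i+1}` is the inverse of `u i`, so `u i` is taken to be the
  -- constant itself.
  refine ⟨fun i => if h : g2Degree r s (.AE i) = 0 then Units.mk0 _ (hne i h) else 1,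
    fun i hi => ?_⟩
  have hC : φ (.AE i) = C (eval 0 (φ (.AE i))) := by
    rcases weightedHomogeneous_trichotomy H.weight_pos (H.graded (.AE i)) with h | h | h
    · exact absurd hi h.1.ne
    · exact h.2
    · exact absurd hi h.1.ne'
  simp only [_root_.torusAct, g2Character, hi, dif_pos, Pi.one_apply, one_mul, mul_one]
  refine (congrArg _ hC).trans ?_
  rw [← C_mul, Units.val_inv_eq_inv_val, Units.val_mk0, inv_mul_cancel₀ (hne i hi), C_1]

end IsG2RegularPullback

/-! ### Quasismooth formats: cluster variables vanish at the vertex. -/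

namespace IsG2Format

variable {w : Fin 10 → ℕ} {r s : ZMod 4 → ℤ} {φ : G2Var → MvPolynomial (Fin 10) ℂ}

theorem relabel (H : IsG2Format w r s φ) (g : DihedralGroup 4) {r' s' : ZMod 4 → ℤ}
    (h : ∀ v, g2Degree r' s' v = g2Degree r s (v.relabel g)) :
    IsG2Format w r' s' fun v => φ (v.relabel g) where
  toIsG2RegularPullback := H.toIsG2RegularPullback.relabel g h
  quasismooth := by rw [g2Ideal_relabel]; exact H.quasismooth
  not_ci := by rw [g2Ideal_relabel]; exact H.not_ci

theorem torusAct (H : IsG2Format w r s φ) (u : ZMod 4 → ℂˣ) :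
    IsG2Format w r s (torusAct 1 u φ) where
  toIsG2RegularPullback := H.toIsG2RegularPullback.torusAct u
  quasismooth := by rw [g2Ideal_torusAct]; exact H.quasismooth
  not_ci := by rw [g2Ideal_torusAct]; exact H.not_ci

/-- Otherwise `θ_i` would be a non-zero constant, and after a rotation the chart `θ₁ ≠ 0` would show
a complete intersection. -/
theorem eval_th (H : IsG2Format w r s φ) (i : ZMod 4) : eval 0 (φ (.th i)) = 0 := by
  rw [H.eval_eq_zero_iff]
  intro h
  refine H.not_ci ?_
  rw [← g2Ideal_relabel φ (.r (i - 1))]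
  refine isCompleteIntersection_of_isUnit_t1 _ (by rw [g2Ideal_relabel]; exact H.codim) ?_
  have : (G2Var.th 1).relabel (.r (i - 1)) = .th i := by simp [G2Var.relabel, dihVertex]
  rw [this]
  exact H.isUnit h

theorem eval_thE (H : IsG2Format w r s φ) (i : ZMod 4) : eval 0 (φ (.thE i)) = 0 := by
  rw [H.eval_eq_zero_iff]
  intro h
  refine H.not_ci ?_
  rw [← g2Ideal_relabel φ (.r (i - 1))]
  refine isCompleteIntersection_of_isUnit_t12 _ (by rw [g2Ideal_relabel]; exact H.codim) ?_
  have : (G2Var.thE 1).relabel (.r (i - 1)) = .thE i := by simp [relabel_r_thE]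
  rw [this]
  exact H.isUnit h

theorem degree_nonneg (H : IsG2Format w r s φ) {v : G2Var} (hv : φ v ≠ 0) : 0 ≤ g2Degree r s v :=
  weightedHomogeneous_nonneg H.weight_pos (H.graded v) hv

theorem degree_pos (H : IsG2Format w r s φ) {v : G2Var} (hv : φ v ≠ 0) (h0 : eval 0 (φ v) = 0) :
    0 < g2Degree r s v :=
  weightedHomogeneous_pos H.weight_pos (H.graded v) ⟨hv, h0⟩

end IsG2Format

/-! ### Formats with a matrix of Pfaffians -/

section A2Format

variable {R : Type*} [CommRing R]

theorem a2Matrix_diag (y : A2Var → R) (a : Fin 5) : a2Matrix y a a = 0 := by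
  rcases fin5_cases a with rfl | rfl | rfl | rfl | rfl <;> rfl

theorem a2Matrix_skew (y : A2Var → R) (a b : Fin 5) : a2Matrix y b a = -a2Matrix y a b := by
  rcases fin5_cases a with rfl | rfl | rfl | rfl | rfl <;>
    rcases fin5_cases b with rfl | rfl | rfl | rfl | rfl <;>
    simp [a2Matrix]

theorem exists_a2Matrix_eq (v : A2Var) :
    ∃ a b : Fin 5, a ≠ b ∧ ∀ y : A2Var → R, a2Matrix y a b = y v := by
  have hc : ∀ i : ZMod 5, i = 0 ∨ i = 1 ∨ i = 2 ∨ i = 3 ∨ i = 4 := by decide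
  rcases v with i | i <;> rcases hc i with rfl | rfl | rfl | rfl | rfl
  · exact ⟨2, 4, by decide, fun _ => rfl⟩
  · exact ⟨0, 2, by decide, fun _ => rfl⟩
  · exact ⟨0, 3, by decide, fun _ => rfl⟩
  · exact ⟨1, 3, by decide, fun _ => rfl⟩
  · exact ⟨1, 4, by decide, fun _ => rfl⟩
  · exact ⟨0, 1, by decide, fun _ => rfl⟩
  · exact ⟨3, 4, by decide, fun _ => rfl⟩
  · exact ⟨1, 2, by decide, fun _ => rfl⟩
  · exact ⟨0, 4, by decide, fun _ => rfl⟩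
  · exact ⟨2, 3, by decide, fun _ => rfl⟩

theorem a2Matrix_mem {y : A2Var → R} {J : Ideal R} (h : ∀ v, y v ∈ J) (a b : Fin 5) :
    a2Matrix y a b ∈ J := by
  rcases fin5_cases a with rfl | rfl | rfl | rfl | rfl <;>
    rcases fin5_cases b with rfl | rfl | rfl | rfl | rfl <;>
    simp [a2Matrix, h]

end A2Format

theorem isCompleteIntersection_of_a2Ideal {I : Ideal (MvPolynomial (Fin 10) ℂ)}
    {y : A2Var → MvPolynomial (Fin 10) ℂ} (T : List (MvPolynomial (Fin 10) ℂ)) (hT : T.length = 3)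
    (hI : I = Ideal.span {f | f ∈ T} ⊔ a2Ideal y) (hht : I.height = 6) {v : A2Var}
    (hu : IsUnit (y v)) : IsCompleteIntersection 6 I := by
  obtain ⟨a, b, hab, h⟩ := exists_a2Matrix_eq (R := MvPolynomial (Fin 10) ℂ) v
  exact isCompleteIntersection_of_pf4Ideal (a2Matrix_diag y) (a2Matrix_skew y) T hT hI hht hab
    (by rwa [h])

/-- In a quasismooth `A₂` format which is not a complete intersection all coordinates are non-zero
and vanish at the vertex. -/
theorem a2Ideal_coord_ne_zero {I : Ideal (MvPolynomial (Fin 10) ℂ)}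
    {y : A2Var → MvPolynomial (Fin 10) ℂ} (T : List (MvPolynomial (Fin 10) ℂ)) (hT : T.length = 3)
    (hT0 : ∀ f ∈ T, eval 0 f = 0) (hI : I = Ideal.span {f | f ∈ T} ⊔ a2Ideal y)
    (hht : I.height = 6) (hq : IsQuasismoothCone 6 I) (hci : ¬ IsCompleteIntersection 6 I)
    (hy : ∀ v, IsUnit (y v) ∨ eval 0 (y v) = 0) (v : A2Var) : y v ≠ 0 ∧ eval 0 (y v) = 0 := by
  have h0 : ∀ v, eval 0 (y v) = 0 := fun v =>
    (hy v).resolve_left fun hu => hci (isCompleteIntersection_of_a2Ideal T hT hI hht hu)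
  refine ⟨?_, h0 v⟩
  obtain ⟨a, b, hab, h⟩ := exists_a2Matrix_eq (R := MvPolynomial (Fin 10) ℂ) v
  rw [← h y]
  refine pf4Ideal_entry_ne_zero (a2Matrix_skew y) T hT hI hq hT0 (fun a b => ?_) hab
  exact RingHom.mem_ker.1
    (a2Matrix_mem (J := RingHom.ker (eval (0 : Fin 10 → ℂ))) (fun v => RingHom.mem_ker.2 (h0 v)) a
        b)

theorem tagIdeal_triple {R : Type*} [CommRing R] (x : G2Var → R) :
    tagIdeal {1, 2, 3} x = Ideal.span {f | f ∈
      [x (.thE 1) - tagValue x 1, x (.thE 2) - tagValue x 2, x (.thE 3) - tagValue x 3]} := by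
  rw [tagIdeal]
  congr 1
  ext f
  simp

theorem tagIdeal_pair_sup {R : Type*} [CommRing R] (x : G2Var → R) (c : R) :
    tagIdeal {1, 2} x ⊔ Ideal.span {c} = Ideal.span {f | f ∈
      [x (.thE 1) - tagValue x 1, x (.thE 2) - tagValue x 2, c]} := by
  rw [tagIdeal, ← Ideal.span_union]
  congr 1
  ext f
  simp only [Finset.mem_insert, Finset.mem_singleton, exists_eq_or_imp, exists_eq_left,
    Set.mem_union, Set.mem_ofPred_eq, Set.mem_singleton_iff, List.mem_cons, List.not_mem_nil,
    or_false, or_assoc]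

/-! ### Gradings of the degenerate formats -/

namespace IsG2RegularPullback

variable {w : Fin 10 → ℕ} {r s : ZMod 4 → ℤ} {φ : G2Var → MvPolynomial (Fin 10) ℂ}

theorem isWeightedHomogeneous (H : IsG2RegularPullback w r s φ) (v : G2Var) {d : ℤ}
    (h : g2Degree r s v = d) : IsWeightedHomogeneous (fun i => (w i : ℤ)) (φ v) d :=
  h ▸ H.graded v

theorem isWeightedHomogeneous_vertex (H : IsG2RegularPullback w r s φ) (v v' v'' : G2Var) {d : ℤ}
    (h : g2Degree r s v + g2Degree r s v' = d) (h' : g2Degree r s v'' = d) :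
    IsWeightedHomogeneous (fun i => (w i : ℤ)) (φ v * φ v' + φ v'') d :=
  (h ▸ (H.graded v).mul (H.graded v')).add (h' ▸ H.graded v'')

/-- The two vanishing degrees say `s 1 = r 1 + r 2` and `s 2 = r 2 + r 3`. These relations make
`A₄θ₄` and `λ₂₄` have the same degree. -/
theorem c2Coords_graded (H : IsG2RegularPullback w r s φ)
    (h1 : g2Degree r s (.AE 1) = 0) (h2 : g2Degree r s (.AE 2) = 0) :
    IsGradedMorphism w (c2Degree ![r 4, r 1, r 3] ![s 4, r 2, s 3]) (c2Coords φ) := by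
  change r 1 - s 1 + r 2 = 0 at h1
  change r 2 - s 2 + r 3 = 0 at h2
  intro v
  rcases v with i | i | i | i | _
  · rcases zmod3_cases i with rfl | rfl | rfl
    · exact H.graded (.th 4)
    · exact H.graded (.th 1)
    · exact H.graded (.th 3)
  · rcases zmod3_cases i with rfl | rfl | rfl
    · exact H.graded (.thE 4)
    · exact H.graded (.th 2)
    · exact H.graded (.thE 3)
  · rcases zmod3_cases i with rfl | rfl | rfl
    · refine H.isWeightedHomogeneous_vertex (.A 4) (.th 4) (.lam 0) ?_ ?_
      · change s 3 - 3 * r 4 + s 4 + r 4 = s 3 - 2 * r 4 + s 4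
        ring
      · change s 1 + s 2 + s 3 + s 4 - (r 1 + r 2 + r 3 + r 4) - r 4 - r 2 = s 3 - 2 * r 4 + s 4
        linarith
    · refine H.isWeightedHomogeneous (.A 1) ?_
      change s 4 - 3 * r 1 + s 1 = s 4 - 2 * r 1 + r 2
      linarith
    · refine H.isWeightedHomogeneous (.A 3) ?_
      change s 2 - 3 * r 3 + s 3 = r 2 - 2 * r 3 + s 3
      linarith
  · rcases zmod3_cases i with rfl | rfl | rfl
    · exact H.isWeightedHomogeneous (.AE 4) rfl
    · refine H.isWeightedHomogeneous (.A 2) ?_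
      change s 1 - 3 * r 2 + s 2 = r 1 - r 2 + r 3
      linarith
    · exact H.isWeightedHomogeneous (.AE 3) rfl
  · refine H.isWeightedHomogeneous (.lam 1) ?_
    change s 1 + s 2 + s 3 + s 4 - (r 1 + r 2 + r 3 + r 4) - r 1 - r 3 =
      r 2 + s 3 + s 4 - r 1 - r 3 - r 4
    linarith

theorem a2Coords_graded (H : IsG2RegularPullback w r s φ) (h1 : g2Degree r s (.AE 1) = 0)
    (h2 : g2Degree r s (.AE 2) = 0) (h3 : g2Degree r s (.AE 3) = 0) :
    IsGradedMorphism w (a2Degree ![r 2, r 3, r 4, s 4, r 1]) (a2Coords φ) := by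
  change r 1 - s 1 + r 2 = 0 at h1
  change r 2 - s 2 + r 3 = 0 at h2
  change r 3 - s 3 + r 4 = 0 at h3
  have hc : ∀ i : ZMod 5, i = 0 ∨ i = 1 ∨ i = 2 ∨ i = 3 ∨ i = 4 := by decide
  intro v
  rcases v with i | i <;> rcases hc i with rfl | rfl | rfl | rfl | rfl
  · exact H.graded (.th 2)
  · exact H.graded (.th 3)
  · exact H.graded (.th 4)
  · exact H.graded (.thE 4)
  · exact H.graded (.th 1)
  · refine H.isWeightedHomogeneous (.A 2) ?_
    change s 1 - 3 * r 2 + s 2 = r 1 - r 2 + r 3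
    linarith
  · refine H.isWeightedHomogeneous (.A 3) ?_
    change s 2 - 3 * r 3 + s 3 = r 2 - r 3 + r 4
    linarith
  · refine H.isWeightedHomogeneous_vertex (.A 4) (.th 4) (.lam 0) ?_ ?_
    · change s 3 - 3 * r 4 + s 4 + r 4 = r 3 - r 4 + s 4
      linarith
    · change s 1 + s 2 + s 3 + s 4 - (r 1 + r 2 + r 3 + r 4) - r 4 - r 2 = r 3 - r 4 + s 4
      linarith
  · exact H.isWeightedHomogeneous (.AE 4) rfl
  · refine H.isWeightedHomogeneous_vertex (.A 1) (.th 1) (.lam 1) ?_ ?_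
    · change s 4 - 3 * r 1 + s 1 + r 1 = s 4 - r 1 + r 2
      linarith
    · change s 1 + s 2 + s 3 + s 4 - (r 1 + r 2 + r 3 + r 4) - r 1 - r 3 = s 4 - r 1 + r 2
      linarith

/-- The `CI⁽⁶⁾` format. -/
theorem isCompleteIntersection (H : IsG2RegularPullback w r s φ)
    (h : ∀ i, g2Degree r s (.AE i) = 0) : IsCompleteIntersection 6 (g2Ideal φ) := by
  obtain ⟨u, hu⟩ := H.exists_torusAct_eq_one
  have H' := H.torusAct u
  rw [← g2Ideal_torusAct u φ]
  -- The matrix entry with index `.A 3` is `A₄₁`, a unit since its degree is zero. Three tags and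
  -- three Pfaffians then generate.
  refine isCompleteIntersection_of_a2Ideal (y := a2Coords (_root_.torusAct 1 u φ)) (v := .A 3) _ ?_
    ((g2Ideal_eq_a2Ideal (hu 1 (h 1)) (hu 2 (h 2)) (hu 3 (h 3))).trans
      (congrArg (· ⊔ _) (tagIdeal_triple _))) H'.codim ?_
  · rfl
  · exact H'.isUnit (h 4)

end IsG2RegularPullback

namespace IsG2Format

variable {w : Fin 10 → ℕ} {r s : ZMod 4 → ℤ} {φ : G2Var → MvPolynomial (Fin 10) ℂ}

/-! ### Signs of the degrees -/

theorem degree_A_nonneg (H : IsG2Format w r s φ) (i : ZMod 4)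
    (h1 : g2Degree r s (.AE (i + 1)) ≠ 0) (h2 : g2Degree r s (.AE (i + 2)) ≠ 0) :
    0 ≤ g2Degree r s (.A i) := by
  obtain ⟨r', s', h⟩ := g2Degree_relabel r s (.r (i - 1))
  have H' := H.relabel _ h
  have e1 : eval 0 (φ ((G2Var.AE 2).relabel (.r (i - 1)))) = 0 := by
    refine (H'.eval_eq_zero_iff (.AE 2)).2 ?_
    rw [h, relabel_r_AE, show 2 + (i - 1) = i + 1 by ring]
    exact h1
  have e2 : eval 0 (φ ((G2Var.AE 3).relabel (.r (i - 1)))) = 0 := by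
    refine (H'.eval_eq_zero_iff (.AE 3)).2 ?_
    rw [h, relabel_r_AE, show 3 + (i - 1) = i + 2 by ring]
    exact h2
  have := H'.degree_nonneg (coeff_vertex_ne_zero H'.quasismooth (by
    simp only [List.forall_mem_cons, List.not_mem_nil, IsEmpty.forall_iff, implies_true, and_true,
      H'.eval_th, H'.eval_thE, e1, e2]))
  rw [h] at this
  simpa [G2Var.relabel, dihVertex] using this

theorem degree_lam_one_nonneg (H : IsG2Format w r s φ) (h4 : g2Degree r s (.AE 4) ≠ 0)
    (hA : g2Degree r s (.A 3) < 0) : 0 ≤ g2Degree r s (.lam 1) :=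
  H.degree_nonneg <| coeff_vertex_or_lam_ne_zero H.quasismooth (by
    simp only [List.forall_mem_cons, List.not_mem_nil, IsEmpty.forall_iff, implies_true, and_true,
      H.eval_th, H.eval_thE, (H.eval_eq_zero_iff _).2 h4]) (H.eq_zero hA)

/-- The reflection `i ↦ 3 - i` exchanges the two diagonals, and sends `A₃` to `A₄` and `A₄₁` to
`A₂₃`. -/
theorem degree_lam_zero_nonneg (H : IsG2Format w r s φ) (h2 : g2Degree r s (.AE 2) ≠ 0)
    (hA : g2Degree r s (.A 4) < 0) : 0 ≤ g2Degree r s (.lam 0) := by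
  obtain ⟨r', s', h⟩ := g2Degree_relabel r s (.sr 3)
  have := (H.relabel _ h).degree_lam_one_nonneg ((h _).trans_ne h2) ((h _).trans_lt hA)
  exact this.trans_eq (h _)

theorem degree_lam_nonneg (H : IsG2Format w r s φ)
    (h2 : g2Degree r s (.AE 2) ≠ 0) (h3 : g2Degree r s (.AE 3) ≠ 0)
    (h4 : g2Degree r s (.AE 4) ≠ 0) :
    0 ≤ g2Degree r s (.A 1) ∧ 0 ≤ g2Degree r s (.A 2) ∧
      0 ≤ g2Degree r s (.lam 1) ∧ 0 ≤ g2Degree r s (.lam 0) := by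
  have a1 := H.degree_A_nonneg 1 h2 h3
  have a2 := H.degree_A_nonneg 2 h3 h4
  refine ⟨a1, a2, ?_⟩
  have l1 := H.degree_lam_one_nonneg h4
  have l0 := H.degree_lam_zero_nonneg h2
  change 0 ≤ s 4 - 3 * r 1 + s 1 at a1
  change 0 ≤ s 1 - 3 * r 2 + s 2 at a2
  change s 2 - 3 * r 3 + s 3 < 0 →
    0 ≤ s 1 + s 2 + s 3 + s 4 - (r 1 + r 2 + r 3 + r 4) - r 1 - r 3 at l1
  change s 3 - 3 * r 4 + s 4 < 0 →
    0 ≤ s 1 + s 2 + s 3 + s 4 - (r 1 + r 2 + r 3 + r 4) - r 4 - r 2 at l0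
  change 0 ≤ s 1 + s 2 + s 3 + s 4 - (r 1 + r 2 + r 3 + r 4) - r 1 - r 3 ∧
    0 ≤ s 1 + s 2 + s 3 + s 4 - (r 1 + r 2 + r 3 + r 4) - r 4 - r 2
  -- Suppose `d(λ₁₃) < 0`. Then `d(A₃) ≥ 0`, so `2d(λ₁₃) - d(λ₂₄) = d(A₁) + d(A₃) ≥ 0` and `d(λ₂₄) <
  -- d(λ₁₃) < 0`. The mirror argument with `A₂` and `A₄` gives `d(λ₁₃) < d(λ₂₄)`, a contradiction.
  omega

/-- Positivity if two opposite coefficients are not constant. -/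
theorem degree_pos_of_opposite (H : IsG2Format w r s φ)
    (h2 : g2Degree r s (.AE 2) ≠ 0) (h4 : g2Degree r s (.AE 4) ≠ 0) :
    (∀ i, 0 < r i) ∧ (∀ i, 0 < s i) ∧ 0 < g2Degree r s (.AE 2) ∧ 0 < g2Degree r s (.AE 4) := by
  have hne := fun v hv => ne_zero_of_opposite H.quasismooth (v := v) hv (by
    simp only [List.forall_mem_cons, List.not_mem_nil, IsEmpty.forall_iff, implies_true, and_true,
      H.eval_th, H.eval_thE, (H.eval_eq_zero_iff _).2 h2, (H.eval_eq_zero_iff _).2 h4])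
  refine ⟨fun i => ?_, fun i => ?_, ?_, ?_⟩
  · refine H.degree_pos (v := .th i) (hne _ ?_) (H.eval_th i)
    rcases zmod4_cases i with rfl | rfl | rfl | rfl <;> decide
  · refine H.degree_pos (v := .thE i) (hne _ ?_) (H.eval_thE i)
    rcases zmod4_cases i with rfl | rfl | rfl | rfl <;> decide
  · exact H.degree_pos (hne _ (by decide)) ((H.eval_eq_zero_iff _).2 h2)
  · exact H.degree_pos (hne _ (by decide)) ((H.eval_eq_zero_iff _).2 h4)

theorem degree_edge_nonneg (H : IsG2Format w r s φ)
    (h2 : g2Degree r s (.AE 2) ≠ 0) (h4 : g2Degree r s (.AE 4) ≠ 0) :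
    0 ≤ g2Degree r s (.AE 1) := by
  refine H.degree_nonneg (coeff_edge_ne_zero H.quasismooth ?_)
  simp only [List.forall_mem_cons, List.not_mem_nil, IsEmpty.forall_iff, implies_true, and_true,
      H.eval_th, H.eval_thE, (H.eval_eq_zero_iff _).2 h2, (H.eval_eq_zero_iff _).2 h4]

theorem degree_edge_nonneg' (H : IsG2Format w r s φ)
    (h2 : g2Degree r s (.AE 2) ≠ 0) (h4 : g2Degree r s (.AE 4) ≠ 0) :
    0 ≤ g2Degree r s (.AE 3) := by
  obtain ⟨r', s', h⟩ := g2Degree_relabel r s (.r 2)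
  have := (H.relabel _ h).degree_edge_nonneg ((h _).trans_ne h4) ((h _).trans_ne h2)
  exact this.trans_eq (h _)

end IsG2Format

theorem c2Equation_c2Coords {R : Type*} [CommRing R] (x : G2Var → R) :
    c2Equation (c2Coords x) 1 2 3 0 = x (.th 1) * x (.th 3)
      - (x (.A 2) * x (.th 2) +
        x (.AE 3) * (x (.A 4) * x (.th 4) + x (.lam 0)) * x (.AE 4)) := by
  have h1 : polyEdge (1 : ZMod 3) 2 = 1 := by decide
  have h2 : polyEdge (2 : ZMod 3) 3 = 2 := by decide
  have h3 : polyEdge (3 : ZMod 3) 1 = 3 := by decide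
  simp only [c2Equation, h1, h2, h3]
  rfl

/-! ### Adjacent constant coefficients and the classification. -/

namespace IsG2Format

variable {w : Fin 10 → ℕ} {r s : ZMod 4 → ℤ} {φ : G2Var → MvPolynomial (Fin 10) ℂ}

theorem degree_pos_of_adjacent_of_ne (H : IsG2Format w r s φ)
    (h1 : φ (.AE 1) = 1) (h2 : φ (.AE 2) = 1) (h3 : g2Degree r s (.AE 3) ≠ 0)
    (h4 : g2Degree r s (.AE 4) ≠ 0) (hA : g2Degree r s (.A 2) ≠ 0) :
    0 < r 1 ∧ 0 < r 2 ∧ 0 < r 4 ∧ 0 < s 4 ∧ 0 < g2Degree r s (.AE 3) := by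
  have e3 := (H.eval_eq_zero_iff _).2 h3
  have e4 := (H.eval_eq_zero_iff _).2 h4
  have eA := (H.eval_eq_zero_iff _).2 hA
  have hne := fun v hv => ne_zero_of_adjacent_edge H.quasismooth h1 h2 (v := v) hv (by
    simp only [List.forall_mem_cons, List.not_mem_nil, IsEmpty.forall_iff, implies_true, and_true,
      H.eval_th, H.eval_thE, e3, e4, eA])
  have hne' := ne_zero_of_adjacent_vertex H.quasismooth h1 h2 (by
    simp only [List.forall_mem_cons, List.not_mem_nil, IsEmpty.forall_iff, implies_true, and_true,
      H.eval_th, H.eval_thE, e3, e4, eA])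
  exact ⟨H.degree_pos (hne (.th 1) (by decide)) (H.eval_th 1),
    H.degree_pos (hne (.th 2) (by decide)) (H.eval_th 2), H.degree_pos hne' (H.eval_th 4),
    H.degree_pos (hne (.thE 4) (by decide)) (H.eval_thE 4), H.degree_pos (hne _ (by decide)) e3⟩

/-- Here `A₂` is a unit, so `θ₂` can be eliminated as well, by the equation for `θ₁θ₃`. The rest is
a Pfaffian format in which every coordinate is non-zero and vanishes at the vertex. -/
theorem degree_pos_of_adjacent_of_eq (H : IsG2Format w r s φ)
    (h1 : φ (.AE 1) = 1) (h2 : φ (.AE 2) = 1) (hd1 : g2Degree r s (.AE 1) = 0)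
    (hd2 : g2Degree r s (.AE 2) = 0) (h3 : g2Degree r s (.AE 3) ≠ 0)
    (h4 : g2Degree r s (.AE 4) ≠ 0) (hA : g2Degree r s (.A 2) = 0) :
    0 < r 1 ∧ 0 < r 3 ∧ 0 < r 4 ∧ 0 < s 3 ∧ 0 < s 4 ∧
      0 < g2Degree r s (.AE 3) ∧ 0 < g2Degree r s (.AE 4) := by
  have e3 := (H.eval_eq_zero_iff _).2 h3
  have e4 := (H.eval_eq_zero_iff _).2 h4
  have hc := H.c2Coords_graded hd1 hd2
  have hor : ∀ v, IsUnit (φ v) ∨ eval 0 (φ v) = 0 := fun v =>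
    weightedHomogeneous_isUnit_or H.weight_pos (H.graded v)
  have hmul : ∀ v v', IsUnit (c2Coords φ v * c2Coords φ v') ∨
      eval 0 (c2Coords φ v * c2Coords φ v') = 0 := fun v v' =>
    weightedHomogeneous_isUnit_or H.weight_pos ((hc v).mul (hc v'))
  have hadd : IsUnit (c2Coords φ (.A 3) * c2Coords φ (.th 3) + c2Coords φ .lam * c2Coords φ (.AE 1))
      ∨ eval 0 (c2Coords φ (.A 3) * c2Coords φ (.th 3) + c2Coords φ .lam * c2Coords φ (.AE 1)) =
        0 := by
    refine weightedHomogeneous_isUnit_or H.weight_pos (((hc (.A 3)).mul (hc (.th 3))).add ?_)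
    convert (hc .lam).mul (hc (.AE 1)) using 1
    change s 3 - 2 * r 4 + s 4 + r 4 = r 2 + s 3 + s 4 - r 1 - r 3 - r 4 + (r 1 - r 2 + r 3)
    ring
  have key := a2Ideal_coord_ne_zero (y := a2CoordsOfUnit (c2Coords φ))
    [φ (.thE 1) - tagValue φ 1, φ (.thE 2) - tagValue φ 2, c2Equation (c2Coords φ) 1 2 3 0] rfl
    ?_ ?_ H.codim H.quasismooth H.not_ci ?_
  · have pos : ∀ v v', a2CoordsOfUnit (c2Coords φ) v' = φ v → 0 < g2Degree r s v := fun v v' e =>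
      weightedHomogeneous_pos H.weight_pos (H.graded v) (e ▸ key v')
    exact ⟨pos (.th 1) (.th 1) rfl, pos (.th 3) (.th 2) rfl, pos (.th 4) (.th 4) rfl,
      pos (.thE 3) (.th 3) rfl, pos (.thE 4) (.th 0) rfl, pos (.AE 3) (.A 3) rfl,
      pos (.AE 4) (.A 0) rfl⟩
  · simp only [List.forall_mem_cons, List.not_mem_nil, IsEmpty.forall_iff, implies_true,
      c2Equation_c2Coords, tagValue_one, tagValue_two, map_sub, map_add, map_mul, map_pow,
          H.eval_th, H.eval_thE,
      e3, e4, mul_zero, zero_mul, sub_zero, add_zero, zero_pow two_ne_zero, and_self]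
  · rw [← tagIdeal_pair_sup, sup_assoc, ← c2Ideal_eq_a2Ideal (H.isUnit hA)]
    exact g2Ideal_eq_c2Ideal h1 h2
  · have hc : ∀ i : ZMod 5, i = 0 ∨ i = 1 ∨ i = 2 ∨ i = 3 ∨ i = 4 := by decide
    intro v
    rcases v with i | i <;> rcases hc i with rfl | rfl | rfl | rfl | rfl
    · exact hor (.thE 4)
    · exact hor (.th 1)
    · exact hor (.th 3)
    · exact hor (.thE 3)
    · exact hor (.th 4)
    · exact hor (.AE 4)
    · exact hmul (.AE 1) (.A 1)
    · exact hmul (.AE 1) (.A 2)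
    · exact hor (.AE 3)
    · exact hadd

/-- Positivity if precisely two adjacent coefficients are constant. -/
theorem degree_pos_of_adjacent (H : IsG2Format w r s φ)
    (h1 : φ (.AE 1) = 1) (h2 : φ (.AE 2) = 1) (hd1 : g2Degree r s (.AE 1) = 0)
    (hd2 : g2Degree r s (.AE 2) = 0) (h3 : g2Degree r s (.AE 3) ≠ 0)
    (h4 : g2Degree r s (.AE 4) ≠ 0) :
    (∀ i, 0 < r i) ∧ (∀ i, 0 < s i) ∧ 0 < g2Degree r s (.AE 3) ∧ 0 < g2Degree r s (.AE 4) := by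
  have key : 0 < r 1 ∧ 0 < r 2 ∧ 0 < r 3 ∧ 0 < r 4 ∧ 0 < s 3 ∧ 0 < s 4 ∧
      0 < g2Degree r s (.AE 3) ∧ 0 < g2Degree r s (.AE 4) := by
    by_cases hA : g2Degree r s (.A 2) = 0
    · obtain ⟨p1, p3, p4, q3, q4, b⟩ := H.degree_pos_of_adjacent_of_eq h1 h2 hd1 hd2 h3 h4 hA
      change s 1 - 3 * r 2 + s 2 = 0 at hA
      change r 1 - s 1 + r 2 = 0 at hd1
      change r 2 - s 2 + r 3 = 0 at hd2
      -- The three degree equations combine to `r 2 = r 1 + r 3`.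
      exact ⟨p1, by linarith, p3, p4, q3, q4, b⟩
    · obtain ⟨p1, p2, p4, q4, b3⟩ := H.degree_pos_of_adjacent_of_ne h1 h2 h3 h4 hA
      -- The reflection fixing the vertices 2 and 4 exchanges `A₁₂` with `A₂₃` and supplies the
      -- missing signs for `θ₃`, `θ₃₄` and `A₄₁`.
      obtain ⟨r', s', h⟩ := g2Degree_relabel r s (.sr 0)
      obtain ⟨p3, _, _, q3, b4⟩ := (H.relabel _ h).degree_pos_of_adjacent_of_ne h2 h1
        ((h _).trans_ne h4) ((h _).trans_ne h3) ((h _).trans_ne hA)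
      exact ⟨p1, p2, p3.trans_eq (h (.th 1)), p4, q3.trans_eq (h (.thE 4)), q4, b3,
        b4.trans_eq (h (.AE 3))⟩
  obtain ⟨p1, p2, p3, p4, q3, q4, b⟩ := key
  change r 1 - s 1 + r 2 = 0 at hd1
  change r 2 - s 2 + r 3 = 0 at hd2
  refine ⟨fun i => ?_, fun i => ?_, b⟩
  · rcases zmod4_cases i with rfl | rfl | rfl | rfl
    exacts [p4, p1, p2, p3]
  · rcases zmod4_cases i with rfl | rfl | rfl | rfl
    exacts [q4, by linarith, by linarith, q3]

/-- Positivity if precisely three coefficients are constant. -/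
theorem degree_pos_of_triple (H : IsG2Format w r s φ)
    (h1 : φ (.AE 1) = 1) (h2 : φ (.AE 2) = 1) (h3 : φ (.AE 3) = 1)
    (hd1 : g2Degree r s (.AE 1) = 0) (hd2 : g2Degree r s (.AE 2) = 0)
    (hd3 : g2Degree r s (.AE 3) = 0) (h4 : g2Degree r s (.AE 4) ≠ 0) :
    (∀ i, 0 < r i) ∧ (∀ i, 0 < s i) ∧ 0 < g2Degree r s (.AE 4) := by
  have e4 := (H.eval_eq_zero_iff _).2 h4
  have key := a2Ideal_coord_ne_zero (y := a2Coords φ)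
    [φ (.thE 1) - tagValue φ 1, φ (.thE 2) - tagValue φ 2, φ (.thE 3) - tagValue φ 3] rfl
    ?_ ?_ H.codim H.quasismooth H.not_ci
    (fun v => weightedHomogeneous_isUnit_or H.weight_pos (H.a2Coords_graded hd1 hd2 hd3 v))
  · have pos := fun v => weightedHomogeneous_pos H.weight_pos (H.a2Coords_graded hd1 hd2 hd3 v)
      (key v)
    have p1 : 0 < r 1 := pos (.th 4)
    have p2 : 0 < r 2 := pos (.th 0)
    have p3 : 0 < r 3 := pos (.th 1)
    have p4 : 0 < r 4 := pos (.th 2)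
    have q4 : 0 < s 4 := pos (.th 3)
    refine ⟨fun i => ?_, fun i => ?_, H.degree_pos (key (.A 3)).1 e4⟩
    · rcases zmod4_cases i with rfl | rfl | rfl | rfl
      exacts [p4, p1, p2, p3]
    · change r 1 - s 1 + r 2 = 0 at hd1
      change r 2 - s 2 + r 3 = 0 at hd2
      change r 3 - s 3 + r 4 = 0 at hd3
      rcases zmod4_cases i with rfl | rfl | rfl | rfl
      exacts [q4, by linarith, by linarith, by linarith]
  · simp only [List.forall_mem_cons, List.not_mem_nil, IsEmpty.forall_iff, implies_true,
      tagValue_one, tagValue_two, tagValue_three, map_sub, map_mul, map_pow, H.eval_th, H.eval_thE,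
      e4, mul_zero, zero_mul, sub_zero, zero_pow two_ne_zero, and_self]
  · rw [← tagIdeal_triple]
    exact g2Ideal_eq_a2Ideal h1 h2 h3

/-- The `G₂` formats, after normalising the position and the value of the constant coefficients. -/
theorem classification (H : IsG2Format w r s φ)
    (hn : ∀ i, g2Degree r s (.AE i) = 0 → φ (.AE i) = 1) (p : ZMod 4 → Bool)
    (hp : ∀ i, p i = true ↔ g2Degree r s (.AE i) = 0)
    (hcases : (p 2 = false ∧ p 4 = false ∧ (p 3 = true → p 1 = true)) ∨
      (p 1 = true ∧ p 2 = true ∧ p 3 = false ∧ p 4 = false) ∨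
      (p 1 = true ∧ p 2 = true ∧ p 3 = true ∧ p 4 = false) ∨ ∀ i, p i = true) :
    (∀ i, 0 < r i) ∧ (∀ i, 0 < s i) ∧
    (((∀ i, 0 < g2Degree r s (.AE i)) ∧ (∀ i, 0 ≤ g2Degree r s (.A i)) ∧
        0 ≤ g2Degree r s (.lam 1) ∧ 0 ≤ g2Degree r s (.lam 0)) ∨
      ((g2Degree r s (.AE 1) = 0 ∧ 0 < g2Degree r s (.AE 2) ∧ 0 < g2Degree r s (.AE 3) ∧
          0 < g2Degree r s (.AE 4)) ∧
        (0 ≤ g2Degree r s (.A 1) ∧ 0 ≤ g2Degree r s (.A 2) ∧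
          0 ≤ g2Degree r s (.lam 1) ∧ 0 ≤ g2Degree r s (.lam 0)) ∧
        φ (.AE 1) = 1 ∧ g2Ideal φ = tagIdeal {1} φ ⊔ g25Ideal φ) ∨
      ((g2Degree r s (.AE 1) = 0 ∧ g2Degree r s (.AE 3) = 0 ∧ 0 < g2Degree r s (.AE 2) ∧
          0 < g2Degree r s (.AE 4)) ∧
        φ (.AE 1) = 1 ∧ φ (.AE 3) = 1 ∧ g2Ideal φ = tagIdeal {1, 3} φ ⊔ g24Ideal φ) ∨
      ((g2Degree r s (.AE 1) = 0 ∧ g2Degree r s (.AE 2) = 0 ∧ 0 < g2Degree r s (.AE 3) ∧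
          0 < g2Degree r s (.AE 4)) ∧
        φ (.AE 1) = 1 ∧ φ (.AE 2) = 1 ∧
        IsGradedMorphism w (c2Degree ![r 4, r 1, r 3] ![s 4, r 2, s 3]) (c2Coords φ) ∧
        g2Ideal φ = tagIdeal {1, 2} φ ⊔ c2Ideal (c2Coords φ)) ∨
      ((g2Degree r s (.AE 1) = 0 ∧ g2Degree r s (.AE 2) = 0 ∧ g2Degree r s (.AE 3) = 0 ∧
          0 < g2Degree r s (.AE 4)) ∧
        φ (.AE 1) = 1 ∧ φ (.AE 2) = 1 ∧ φ (.AE 3) = 1 ∧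
        IsGradedMorphism w (a2Degree ![r 2, r 3, r 4, s 4, r 1]) (a2Coords φ) ∧
        g2Ideal φ = tagIdeal {1, 2, 3} φ ⊔ a2Ideal (a2Coords φ))) := by
  have hf : ∀ i, p i = false → g2Degree r s (.AE i) ≠ 0 := fun i hi h => by
    rw [(hp i).2 h] at hi; exact absurd hi (by decide)
  have ht : ∀ i, p i = true → g2Degree r s (.AE i) = 0 := fun i => (hp i).1
  rcases hcases with ⟨h2, h4, h31⟩ | ⟨h1, h2, h3, h4⟩ | ⟨h1, h2, h3, h4⟩ | h
  -- With `A₂₃` and `A₄₁` not constant, one argument covers none, one or two opposite constant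
  -- coefficients. The normalisation `h31` ensures that a single one sits at `A₁₂`.
  · obtain ⟨hr, hs, b2, b4⟩ := H.degree_pos_of_opposite (hf 2 h2) (hf 4 h4)
    have b1 := H.degree_edge_nonneg (hf 2 h2) (hf 4 h4)
    have b3 := H.degree_edge_nonneg' (hf 2 h2) (hf 4 h4)
    refine ⟨hr, hs, ?_⟩
    cases h1 : p 1
    · have h3 : p 3 = false := by
        cases h : p 3
        · rfl
        · rw [h31 h] at h1; exact h1
      have hl := H.degree_lam_nonneg (hf 2 h2) (hf 3 h3) (hf 4 h4)
      have hE : ∀ i, p i = false := fun i => by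
        rcases zmod4_cases i with rfl | rfl | rfl | rfl
        exacts [h4, h1, h2, h3]
      refine .inl ⟨fun i => ?_, fun i => H.degree_A_nonneg i (hf _ (hE _)) (hf _ (hE _)), hl.2.2⟩
      rcases zmod4_cases i with rfl | rfl | rfl | rfl
      exacts [b4, lt_of_le_of_ne b1 (hf 1 h1).symm, b2, lt_of_le_of_ne b3 (hf 3 h3).symm]
    · cases h3 : p 3
      · refine .inr (.inl ⟨⟨ht 1 h1, b2, lt_of_le_of_ne b3 (hf 3 h3).symm, b4⟩,
          H.degree_lam_nonneg (hf 2 h2) (hf 3 h3) (hf 4 h4), hn 1 (ht 1 h1), ?_⟩)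
        exact g2Ideal_eq_eliminateEdges (by simpa using hn 1 (ht 1 h1))
      · refine .inr (.inr (.inl ⟨⟨ht 1 h1, ht 3 h3, b2, b4⟩, hn 1 (ht 1 h1), hn 3 (ht 3 h3), ?_⟩))
        exact g2Ideal_eq_eliminateEdges (by simpa using ⟨hn 1 (ht 1 h1), hn 3 (ht 3 h3)⟩)
  · have e1 := hn 1 (ht 1 h1)
    have e2 := hn 2 (ht 2 h2)
    obtain ⟨hr, hs, b3, b4⟩ := H.degree_pos_of_adjacent e1 e2 (ht 1 h1) (ht 2 h2) (hf 3 h3) (hf 4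
        h4)
    exact ⟨hr, hs, .inr (.inr (.inr (.inl ⟨⟨ht 1 h1, ht 2 h2, b3, b4⟩, e1, e2,
      H.c2Coords_graded (ht 1 h1) (ht 2 h2), g2Ideal_eq_c2Ideal e1 e2⟩)))⟩
  · have e1 := hn 1 (ht 1 h1)
    have e2 := hn 2 (ht 2 h2)
    have e3 := hn 3 (ht 3 h3)
    obtain ⟨hr, hs, b4⟩ :=
      H.degree_pos_of_triple e1 e2 e3 (ht 1 h1) (ht 2 h2) (ht 3 h3) (hf 4 h4)
    exact ⟨hr, hs, .inr (.inr (.inr (.inr ⟨⟨ht 1 h1, ht 2 h2, ht 3 h3, b4⟩, e1, e2, e3,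
      H.a2Coords_graded (ht 1 h1) (ht 2 h2) (ht 3 h3), g2Ideal_eq_a2Ideal e1 e2 e3⟩)))⟩
  · exact absurd (H.isCompleteIntersection fun i => ht i (h i)) H.not_ci

end IsG2Format

/-- Up to rotation, there are six subsets of the edges of the square. -/
theorem exists_rotation (p : ZMod 4 → Bool) : ∃ a : ZMod 4,
    (p (2 + a) = false ∧ p (4 + a) = false ∧ (p (3 + a) = true → p (1 + a) = true)) ∨
    (p (1 + a) = true ∧ p (2 + a) = true ∧ p (3 + a) = false ∧ p (4 + a) = false) ∨
    (p (1 + a) = true ∧ p (2 + a) = true ∧ p (3 + a) = true ∧ p (4 + a) = false) ∨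
    ∀ i, p (i + a) = true := by
  revert p
  decide

/-! ### The main theorem -/

theorem mainTheorem5 :
    -- the degree inequalities and the five formats
    (∀ (w : Fin 10 → ℕ) (r s : ZMod 4 → ℤ) (φ : G2Var → MvPolynomial (Fin 10) ℂ),
      IsG2RegularPullback w r s φ →
      IsQuasismoothCone 6 (g2Ideal φ) →
      ¬ IsCompleteIntersection 6 (g2Ideal φ) →
      (∀ i, 0 < g2Degree r s (.th i)) ∧ (∀ i, 0 < g2Degree r s (.thE i)) ∧
      ∃ (g : DihedralGroup 4) (t u : ZMod 4 → ℂˣ),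
        let d : G2Var → ℤ := fun v => g2Degree r s (G2Var.relabel g v)
        let ψ : G2Var → MvPolynomial (Fin 10) ℂ :=
          torusAct t u (fun v => φ (G2Var.relabel g v))
        g2Ideal ψ = g2Ideal φ ∧
        ( -- `G₂⁽⁶⁾` format
          ((∀ i, 0 < d (.AE i)) ∧ (∀ i, 0 ≤ d (.A i)) ∧ 0 ≤ d (.lam 1) ∧ 0 ≤ d (.lam 0)) ∨
          -- `G₂⁽⁵⁾ + CI⁽¹⁾` format
          ((d (.AE 1) = 0 ∧ 0 < d (.AE 2) ∧ 0 < d (.AE 3) ∧ 0 < d (.AE 4)) ∧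
            (0 ≤ d (.A 1) ∧ 0 ≤ d (.A 2) ∧ 0 ≤ d (.lam 1) ∧ 0 ≤ d (.lam 0)) ∧
            ψ (.AE 1) = 1 ∧
            g2Ideal φ = tagIdeal {1} ψ ⊔ g25Ideal ψ) ∨
          -- `G₂⁽⁴⁾ + CI⁽²⁾` format
          ((d (.AE 1) = 0 ∧ d (.AE 3) = 0 ∧ 0 < d (.AE 2) ∧ 0 < d (.AE 4)) ∧
            ψ (.AE 1) = 1 ∧ ψ (.AE 3) = 1 ∧
            g2Ideal φ = tagIdeal {1, 3} ψ ⊔ g24Ideal ψ) ∨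
          -- `C₂ + CI⁽²⁾` format
          ((d (.AE 1) = 0 ∧ d (.AE 2) = 0 ∧ 0 < d (.AE 3) ∧ 0 < d (.AE 4)) ∧
            ψ (.AE 1) = 1 ∧ ψ (.AE 2) = 1 ∧
            IsGradedMorphism w
              (c2Degree ![d (.th 4), d (.th 1), d (.th 3)] ![d (.thE 4), d (.th 2), d (.thE 3)])
              (c2Coords ψ) ∧
            g2Ideal φ = tagIdeal {1, 2} ψ ⊔ c2Ideal (c2Coords ψ)) ∨
          -- `A₂ + CI⁽³⁾` format
          ((d (.AE 1) = 0 ∧ d (.AE 2) = 0 ∧ d (.AE 3) = 0 ∧ 0 < d (.AE 4)) ∧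
            ψ (.AE 1) = 1 ∧ ψ (.AE 2) = 1 ∧ ψ (.AE 3) = 1 ∧
            IsGradedMorphism w
              (a2Degree ![d (.th 2), d (.th 3), d (.th 4), d (.thE 4), d (.th 1)])
              (a2Coords ψ) ∧
            g2Ideal φ = tagIdeal {1, 2, 3} ψ ⊔ a2Ideal (a2Coords ψ)))) ∧
    -- if all four `d(A_{ij})` vanish then we are in `CI⁽⁶⁾` format
    (∀ (w : Fin 10 → ℕ) (r s : ZMod 4 → ℤ) (φ : G2Var → MvPolynomial (Fin 10) ℂ),
      IsG2RegularPullback w r s φ → (∀ i, g2Degree r s (.AE i) = 0) →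
      IsCompleteIntersection 6 (g2Ideal φ)) ∧
    -- the specialisation `A₁₂ = A₂₃ = 1` of `X_{G₂}` is `C₂ + CI⁽²⁾`
    (g2Ideal (genericSpecialisation {1, 2}) =
      tagIdeal {1, 2} (genericSpecialisation {1, 2}) ⊔
        c2Ideal (c2Coords (genericSpecialisation {1, 2}))) ∧
    -- the specialisation `A₁₂ = A₂₃ = A₃₄ = 1` of `X_{G₂}` is `A₂ + CI⁽³⁾`
    (g2Ideal (genericSpecialisation {1, 2, 3}) =
      tagIdeal {1, 2, 3} (genericSpecialisation {1, 2, 3}) ⊔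
        a2Ideal (a2Coords (genericSpecialisation {1, 2, 3}))) := by
  refine ⟨fun w r s φ hφ hq hci => ?_, fun w r s φ hφ h => hφ.isCompleteIntersection h, ?_, ?_⟩
  -- Only which coefficients have degree zero matters for choosing the position, and rotations
  -- suffice to normalise that set.
  · obtain ⟨a, ha⟩ := exists_rotation fun i => decide (g2Degree r s (.AE i) = 0)
    obtain ⟨r', s', h⟩ := g2Degree_relabel r s (.r a)
    have H : IsG2Format w r' s' fun v => φ (v.relabel (.r a)) :=
      IsG2Format.relabel ⟨hφ, hq, hci⟩ (.r a) h
    obtain ⟨u, hu⟩ := H.exists_torusAct_eq_one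
    have hE : ∀ i, g2Degree r' s' (.AE i) = g2Degree r s (.AE (i + a)) := fun i => by
      rw [h, relabel_r_AE]
    have hI : g2Ideal (torusAct 1 u fun v => φ (v.relabel (.r a))) = g2Ideal φ := by
      rw [g2Ideal_torusAct, g2Ideal_relabel]
    obtain ⟨hr, hs, hcases⟩ := (H.torusAct u).classification hu
      (fun i => decide (g2Degree r s (.AE (i + a)) = 0)) (fun i => by rw [hE, decide_eq_true_iff])
          ha
    refine ⟨fun i => ?_, fun i => ?_, .r a, 1, u, ?_⟩
    · have := hr (i - a)
      rw [show r' (i - a) = _ from h (.th (i - a))] at this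
      simpa [G2Var.relabel, dihVertex] using this
    · have := hs (i - a)
      rw [show s' (i - a) = _ from h (.thE (i - a)), relabel_r_thE, sub_add_cancel] at this
      exact this
    · simp only [← h]
      refine ⟨hI, ?_⟩
      rw [hI] at hcases
      exact hcases
  · exact g2Ideal_eq_c2Ideal (by simp [genericSpecialisation]) (by simp [genericSpecialisation])
  · exact g2Ideal_eq_a2Ideal (by simp [genericSpecialisation]) (by simp [genericSpecialisation])
      (by simp [genericSpecialisation])
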